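/- Let $\mathcal G$ be a connected simple graph of bounded degree, i.e. $\sup_{v}\deg(v)<\infty$ (finite or infinite), let $\rho>1$, and put $w(k)=k^\rho$ for $k\ge 1$. Consider the edge-reinforced random walk $(I_n)_{n\ge 0}$ on $\mathcal G$ with reinforcement weight function $w$ and all initial edge weights equal to $1$, started at time $0$ from a vertex $v_0$: with $X_n^e = 1+\#\{0\le i<n : \{I_i,I_{i+1}\}=e\}$, we have $I_0=v_0$ almost surely and, for every $n\ge0$, given $I_0,\dots,I_n$ the walk jumps from $I_n=u$ to a neighbour $v$ of $u$ with probability $$\frac{w\big(X_n^{\{u,v\}}\big)}{\sum_{y\sim u} w\big(X_n^{\{u,y\}}\big)} .$$ Let $T=\inf\{k\ge 0:\ \{I_n,I_{n+1}\}=\{I_{n+1},I_{n+2}\}\ \text{for all } n\ge k\}$ (with $\inf\emptyset=\infty$) be the time of attraction, the first time after which only a single edge is traversed. Then there exists $p>0$, not depending on the starting vertex $v_0$, such that for every integer $k\ge 1$ $$P^{\mathcal G}(T>k)\le \frac{1}{k^{p}} .$$ -/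

import Mathlib

open MeasureTheory

noncomputable section

/-- The weight `X_n^e` of the edge `e` at time `n` along the trajectory `x` (started at time `0`):
the initial weight of `e` plus the number of undirected traversals of `e` prior to time `n`. -/
def edgeWeight {V : Type*} (ℓ₀ : Sym2 V → ℕ) (x : ℕ → V) (n : ℕ) (e : Sym2 V) : ℕ :=
  ℓ₀ e + {i : ℕ | i < n ∧ s(x i, x (i + 1)) = e}.ncard

open Classical in
/-- The conditional probability, given the trajectory `x 0, …, x n` up to time `n`, that the
edge-reinforced walk with reinforcement weight function `w` jumps to `v` in its next step:
proportional to `w (X_n^{x n, v})` among the neighbours `v` of `x n`, and zero for every other `v`.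
Only `x 0, …, x n` matter here. -/
def stepProb {V : Type*} (G : SimpleGraph V) [G.LocallyFinite] (w : ℕ → ℝ) (ℓ₀ : Sym2 V → ℕ)
    (x : ℕ → V) (n : ℕ) (v : V) : ℝ :=
  if G.Adj (x n) v then
    w (edgeWeight ℓ₀ x n s(x n, v)) /
      ∑ y ∈ G.neighborFinset (x n), w (edgeWeight ℓ₀ x n s(x n, y))
  else 0

/-- The process `I = (I_n)_{n ≥ 0}` on the probability space `(Ω, μ)` is an edge-reinforced random
walk on `G` with reinforcement weight function `w`, initial edge weights `ℓ₀` (only their values on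
the edges of `G` matter) and initial position `v₀`. The conditional law of the next position
given the history is expressed through the probabilities of finite trajectories. -/
structure IsERRW {V : Type*} (G : SimpleGraph V) [G.LocallyFinite] (w : ℕ → ℝ) (ℓ₀ : Sym2 V → ℕ)
    (v₀ : V) {Ω : Type*} [MeasurableSpace Ω] (μ : Measure Ω) (I : ℕ → Ω → V) : Prop where
  measurableSet_eq : ∀ (n : ℕ) (v : V), MeasurableSet {ω | I n ω = v}
  initial : ∀ᵐ ω ∂μ, I 0 ω = v₀
  transition : ∀ (n : ℕ) (x : ℕ → V),
    μ.real {ω | ∀ i ≤ n + 1, I i ω = x i} =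
      μ.real {ω | ∀ i ≤ n, I i ω = x i} * stepProb G w ℓ₀ x n (x (n + 1))

/-- The time of attraction
`T = inf {k ≥ 0 : {x_n, x_{n+1}} = {x_{n+1}, x_{n+2}} for all n ≥ k}` of a trajectory `x`: the first
time after which a single edge is traversed; it is `⊤` if there is no such time. -/
def attractionTime {V : Type*} (x : ℕ → V) : ℕ∞ :=
  ⨅ (k : ℕ) (_ : ∀ n ≥ k, s(x n, x (n + 1)) = s(x (n + 1), x (n + 2))), (k : ℕ∞)

end

/-! Fix a vertex `u` and two of its edges `uv`, `uw`, and measure an edge of weight `n` by its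
residual lifetime `∑_{j ≥ n} j ^ (-ρ)`, finite since `ρ > 1`. A visit to an endpoint `x` of an edge
shortens its lifetime by `1 / W_x` in conditional mean, `W_x` being the sum of the reinforced
weights at `x`. At `u` both edges lose the same amount, so the difference of lifetimes `lead` drifts
only at `v` and `w`, by `1 / W_v` and `-1 / W_w`. Up to the killing, this is minus the drift, for
frozen conductances, of the potential `pot` at the walker of a unit dipole between `v` and `w` in
the electrical network whose conductances are the reinforced weights. Hence `lead` plus potential is
nearly a martingale (`sum_linStep_le`). If both edges have weight at least `y`, the path `v, u, w`
bounds the potential by `2 y ^ (-ρ)`, and traversing an edge of weight `j` changes it by a relative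
amount `O(1 / j)`. The accumulated error is governed by `harmonicSum`, which is logarithmic in time
when few vertices are visited. A small killing rate makes the finite network equations solvable.

The natural unit of `lead` at weight `y` is `y ^ (1/2 - ρ)`, the order of the fluctuations of the
remaining lifetimes. The exponential supermartingale `psi` shows that a lead of many units rarely
shrinks (`hit_gap_le`). A tilt of strength `ε` of order `y ^ (-1/2)` in favour of `v` creates such a
lead, and by Cauchy–Schwarz this costs only a constant factor in probability, since `ε ^ 2` times
the number of departures from `u` stays bounded (`exists_kick`). From `y` to `2y` the unit shrinks
by `2 ^ (1/2 - ρ)`, so a large gap grows in its unit. A Lyapunov function therefore contracts by a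
fixed factor per dyadic level, and two edges at one vertex reach weight `M` with probability
exponentially small in the number of levels (`exists_hit_twoHeavy_le`).

Globally, when the walk first visits a vertex that still has an unvisited neighbour, it may bounce
forever on one light edge with probability bounded below (`hit_le_of_bounce`). So the number of
visited vertices has an exponential tail (`hit_openSet_le`). If few vertices are visited up to time
`k` and no vertex gets two edges of weight `M`, some traversed edge must reach a much larger weight
`L` while its adjacent edges stay below `M` (`exists_trap`). Such a trap is left with probability
`O(M ^ ρ L ^ (1 - ρ))`. Taking `M`, `L` and the number of levels as powers or logarithms of `k`
makes every error a negative power of `k`. Small `k` is covered by the bound `escapeProb ρ D 1 1 <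
1`. -/

noncomputable section

/-! ### Partial sums of `j ^ (-ρ)` -/

/-- The partial sums `∑_{j < n} j ^ (-ρ)`. -/
def powSum (ρ : ℝ) (n : ℕ) : ℝ := ∑ j ∈ Finset.range n, (j : ℝ) ^ (-ρ)

theorem powSum_succ (ρ : ℝ) (n : ℕ) : powSum ρ (n + 1) = powSum ρ n + (n : ℝ) ^ (-ρ) := by
  simp [powSum, Finset.sum_range_succ]

theorem powSum_mono (ρ : ℝ) : Monotone (powSum ρ) := by
  refine monotone_nat_of_le_succ fun n => ?_
  rw [powSum_succ]
  have : (0 : ℝ) ≤ (n : ℝ) ^ (-ρ) := by positivity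
  linarith

/-- The constant bounding the tails of `∑ j ^ (-ρ)`. -/
def tailConst (ρ : ℝ) : ℝ := (ρ + 1) / (ρ - 1)

theorem tailConst_pos {ρ : ℝ} (hρ : 1 < ρ) : 0 < tailConst ρ := by
  unfold tailConst
  exact div_pos (by linarith) (by linarith)

/-- With `x = j / (j + 1)`, the inequality `log x ≤ x - 1` gives `1 - x ^ (ρ - 1) ≥ (ρ - 1) / (j +
ρ)`. The numerator `ρ + 1` of `tailConst` then absorbs `(j + ρ) / j`, which is largest at `j = 1`.
-/
theorem rpow_neg_le_telescope {ρ : ℝ} (hρ : 1 < ρ) {j : ℕ} (hj : 1 ≤ j) :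
    (j : ℝ) ^ (-ρ) ≤ tailConst ρ * ((j : ℝ) ^ (1 - ρ) - ((j + 1 : ℕ) : ℝ) ^ (1 - ρ)) := by
  have hj' : (1 : ℝ) ≤ j := by exact_mod_cast hj
  have hj0 : (0 : ℝ) < j := by linarith
  have ha : 0 < ρ - 1 := by linarith
  set x : ℝ := j / (j + 1) with hx
  have hx0 : 0 < x := by positivity
  have hxa : x ^ (ρ - 1) ≤ 1 / (1 + (ρ - 1) / (j + 1)) := by
    rw [Real.rpow_def_of_pos hx0]
    have h1 : Real.log x ≤ x - 1 := Real.log_le_sub_one_of_pos hx0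
    have h2 : x - 1 = - (1 / (j + 1)) := by rw [hx]; field_simp; ring
    have h3 : Real.log x * (ρ - 1) ≤ -((ρ - 1) / (j + 1)) := by
      rw [h2] at h1
      have := mul_le_mul_of_nonneg_right h1 ha.le
      calc _ ≤ _ := this
        _ = _ := by ring
    calc Real.exp (Real.log x * (ρ - 1)) ≤ Real.exp (-((ρ - 1) / (j + 1))) :=
          Real.exp_le_exp.2 h3
      _ ≤ _ := by
          rw [Real.exp_neg, one_div]
          apply inv_anti₀ (by positivity)
          have := Real.add_one_le_exp ((ρ - 1) / (j + 1 : ℝ))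
          linarith
  have e1 : ((j + 1 : ℕ) : ℝ) ^ (1 - ρ) = (j : ℝ) ^ (1 - ρ) * x ^ (ρ - 1) := by
    have : ((j + 1 : ℕ) : ℝ) = j * x⁻¹ := by rw [hx]; push_cast; field_simp
    rw [this, Real.mul_rpow hj0.le (by positivity), Real.inv_rpow hx0.le, ← Real.rpow_neg hx0.le]
    congr 2; ring
  have e2 : (j : ℝ) ^ (-ρ) = (j : ℝ) ^ (1 - ρ) * (1 / j) := by
    rw [show -ρ = (1 - ρ) - 1 by ring, Real.rpow_sub_one hj0.ne']
    ring
  rw [e1, e2]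
  have hp : 0 < (j : ℝ) ^ (1 - ρ) := by positivity
  have key : 1 / (j : ℝ) ≤ tailConst ρ * (1 - x ^ (ρ - 1)) := by
    have h4 : (ρ - 1) / (j + ρ) ≤ 1 - x ^ (ρ - 1) := by
      have : (1 : ℝ) - 1 / (1 + (ρ - 1) / (j + 1)) = (ρ - 1) / (j + ρ) := by
        have : (j : ℝ) + 1 + (ρ - 1) ≠ 0 := by positivity
        have : (j : ℝ) + ρ ≠ 0 := by positivity
        field_simp
        ring
      linarith
    calc 1 / (j : ℝ) ≤ tailConst ρ * ((ρ - 1) / (j + ρ)) := by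
          unfold tailConst
          have : (j : ℝ) + ρ ≠ 0 := by positivity
          rw [div_mul_div_comm, div_le_div_iff₀ hj0 (by positivity)]
          nlinarith [mul_nonneg (mul_nonneg ha.le (by linarith : (0:ℝ) ≤ ρ)) (sub_nonneg.2 hj')]
      _ ≤ _ := mul_le_mul_of_nonneg_left h4 (tailConst_pos hρ).le
  calc _ ≤ (j : ℝ) ^ (1 - ρ) * (tailConst ρ * (1 - x ^ (ρ - 1))) :=
        mul_le_mul_of_nonneg_left key hp.le
    _ = _ := by ring

theorem powSum_sub_le {ρ : ℝ} (hρ : 1 < ρ) {a b : ℕ} (ha : 1 ≤ a) (hab : a ≤ b) :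
    powSum ρ b - powSum ρ a ≤ tailConst ρ * (a : ℝ) ^ (1 - ρ) := by
  have h : ∀ b, a ≤ b → powSum ρ b - powSum ρ a ≤
      tailConst ρ * ((a : ℝ) ^ (1 - ρ) - (b : ℝ) ^ (1 - ρ)) := by
    intro b hb
    induction b, hb using Nat.le_induction with
    | base => simp
    | succ n hn ih =>
      have := rpow_neg_le_telescope hρ (ha.trans hn)
      rw [powSum_succ]
      linarith
  have h1 := h b hab
  have h2 : 0 ≤ (b : ℝ) ^ (1 - ρ) := by positivity
  nlinarith [tailConst_pos hρ]

theorem le_powSum_sub {ρ : ℝ} (hρ : 0 ≤ ρ) {a b : ℕ} (ha : 1 ≤ a) (hab : a ≤ b) :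
    ((b : ℝ) - a) * (b : ℝ) ^ (-ρ) ≤ powSum ρ b - powSum ρ a := by
  have h : ∀ c, a ≤ c → c ≤ b → ((c : ℝ) - a) * (b : ℝ) ^ (-ρ) ≤ powSum ρ c - powSum ρ a := by
    intro c hc
    induction c, hc using Nat.le_induction with
    | base => simp
    | succ n hn ih =>
      intro hnb
      have h1 := ih (by omega)
      have h2 : (b : ℝ) ^ (-ρ) ≤ (n : ℝ) ^ (-ρ) :=
        Real.rpow_le_rpow_of_nonpos (by exact_mod_cast (by omega : 0 < n))
          (by exact_mod_cast (by omega : n ≤ b)) (by linarith)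
      rw [powSum_succ]; push_cast
      linarith
  exact h b hab le_rfl

/-! ### Dipole potentials of finite electrical networks with killing -/

section Dipole

variable {V : Type*}

/-- Maximum principle for a finite network with killing. -/
theorem network_nonpos {c : V → V → ℝ} (hc : ∀ x y, 0 ≤ c x y) {κ : ℝ} (hκ : 0 < κ)
    (B : Finset V) {h : V → ℝ}
    (hh : ∀ x ∈ B, 0 < h x → κ * h x + ∑ y ∈ B, c x y * (h x - h y) ≤ 0) :
    ∀ x ∈ B, h x ≤ 0 := by
  intro x hx
  obtain ⟨m, hm, hmax⟩ := B.exists_max_image h ⟨x, hx⟩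
  refine (hmax x hx).trans ?_
  by_contra hcon
  push Not at hcon
  have h1 := hh m hm hcon
  have h2 : 0 ≤ ∑ y ∈ B, c m y * (h m - h y) :=
    Finset.sum_nonneg fun y hy => mul_nonneg (hc _ _) (sub_nonneg.2 (hmax y hy))
  nlinarith

theorem network_unique {c : V → V → ℝ} (hc : ∀ x y, 0 ≤ c x y) {κ : ℝ} (hκ : 0 < κ)
    (B : Finset V) {h₁ h₂ : V → ℝ}
    (hh : ∀ x ∈ B, κ * h₁ x + ∑ y ∈ B, c x y * (h₁ x - h₁ y) =
      κ * h₂ x + ∑ y ∈ B, c x y * (h₂ x - h₂ y)) :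
    ∀ x ∈ B, h₁ x = h₂ x := by
  have key : ∀ g₁ g₂ : V → ℝ, (∀ x ∈ B, κ * g₁ x + ∑ y ∈ B, c x y * (g₁ x - g₁ y) =
      κ * g₂ x + ∑ y ∈ B, c x y * (g₂ x - g₂ y)) → ∀ x ∈ B, g₁ x ≤ g₂ x := by
    intro g₁ g₂ hg x hx
    have := network_nonpos hc hκ B (h := fun x => g₁ x - g₂ x) (fun x hx _ => by
      have h1 := hg x hx
      have h2 : ∑ y ∈ B, c x y * (g₁ x - g₂ x - (g₁ y - g₂ y)) =
          ∑ y ∈ B, c x y * (g₁ x - g₁ y) - ∑ y ∈ B, c x y * (g₂ x - g₂ y) := by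
        rw [← Finset.sum_sub_distrib]
        exact Finset.sum_congr rfl fun y _ => by ring
      simp only [h2]
      linarith) x hx
    linarith
  exact fun x hx => le_antisymm (key _ _ hh x hx) (key _ _ (fun x hx => (hh x hx).symm) x hx)

/-- Killing makes the operator injective by the maximum principle, and an injective endomorphism of
the finite-dimensional space `B → ℝ` is surjective. The solution is extended by zero off `B`. -/
theorem exists_network_solution {c : V → V → ℝ} (hc : ∀ x y, 0 ≤ c x y) {κ : ℝ} (hκ : 0 < κ)
    (B : Finset V) (f : V → ℝ) :
    ∃ h : V → ℝ, (∀ x ∉ B, h x = 0) ∧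
      ∀ x ∈ B, κ * h x + ∑ y ∈ B, c x y * (h x - h y) = f x := by
  classical
  let T : (B → ℝ) →ₗ[ℝ] (B → ℝ) :=
    { toFun := fun h x => κ * h x + ∑ y : B, c x y * (h x - h y)
      map_add' := by
        intro h g; ext x
        simp only [Pi.add_apply]
        have : ∑ y : B, c x y * (h x + g x - (h y + g y)) =
          ∑ y : B, c x y * (h x - h y) + ∑ y : B, c x y * (g x - g y) := by
          rw [← Finset.sum_add_distrib]; exact Finset.sum_congr rfl fun y _ => by ring
        rw [this]; ring
      map_smul' := by
        intro r h; ext x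
        simp only [Pi.smul_apply, smul_eq_mul, RingHom.id_apply]
        have : ∑ y : B, c x y * (r * h x - r * h y) = r * ∑ y : B, c x y * (h x - h y) := by
          rw [Finset.mul_sum]; exact Finset.sum_congr rfl fun y _ => by ring
        rw [this]; ring }
  let ex : (B → ℝ) → V → ℝ := fun h x => if hx : x ∈ B then h ⟨x, hx⟩ else 0
  have hex : ∀ (h : B → ℝ) (x : B), ex h x = h x := fun h x => by simp [ex]
  have hsum : ∀ (h : B → ℝ) (x : B), ∑ y ∈ B, c x y * (ex h x - ex h y) =
      ∑ y : B, c x y * (h x - h y) := by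
    intro h x
    rw [← Finset.sum_coe_sort B]
    exact Finset.sum_congr rfl fun y _ => by rw [hex, hex]
  have hinj : Function.Injective T := by
    intro h g hhg
    ext x
    have := network_unique hc hκ B (h₁ := ex h) (h₂ := ex g) (fun x hx => by
      have := congrFun hhg ⟨x, hx⟩
      have e1 := hsum h ⟨x, hx⟩
      have e2 := hsum g ⟨x, hx⟩
      have e3 := hex h ⟨x, hx⟩
      have e4 := hex g ⟨x, hx⟩
      simp only at e1 e2 e3 e4
      rw [e1, e2, e3, e4]
      exact this) x x.2
    rwa [hex, hex] at this
  obtain ⟨h, hh⟩ := LinearMap.injective_iff_surjective.1 hinj (fun x => f x)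
  refine ⟨ex h, fun x hx => by simp [ex, hx], fun x hx => ?_⟩
  have e1 := hsum h ⟨x, hx⟩
  have e3 := hex h ⟨x, hx⟩
  simp only at e1 e3
  rw [e1, e3]
  exact congrFun hh ⟨x, hx⟩

open Classical in
/-- The unit dipole charge between `a` and `b`. -/
def dipoleCharge (a b x : V) : ℝ := (if x = a then 1 else 0) - (if x = b then 1 else 0)

/-- `IsDipole c κ B a b h`: `h` is the potential of a unit current from `a` to `b` in the network on
the finite set `B` with conductances `c` and killing `κ`. -/
structure IsDipole (c : V → V → ℝ) (κ : ℝ) (B : Finset V) (a b : V) (h : V → ℝ) : Prop where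
  zero_off : ∀ x ∉ B, h x = 0
  eq : ∀ x ∈ B, κ * h x + ∑ y ∈ B, c x y * (h x - h y) = dipoleCharge a b x

theorem dipoleCharge_neg (a b x : V) : - dipoleCharge a b x = dipoleCharge b a x := by
  simp [dipoleCharge]

theorem IsDipole.neg {c : V → V → ℝ} {κ : ℝ} {B : Finset V} {a b : V} {h : V → ℝ}
    (H : IsDipole c κ B a b h) : IsDipole c κ B b a (fun x => - h x) where
  zero_off x hx := by simp [H.zero_off x hx]
  eq x hx := by
    rw [← dipoleCharge_neg, ← H.eq x hx, neg_add, ← Finset.sum_neg_distrib]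
    congr 1
    · ring
    · exact Finset.sum_congr rfl fun y _ => by ring

/-- Summing the equation over `B` cancels the currents by symmetry and the two charges against each
other, which leaves only the killing term. -/
theorem IsDipole.sum_eq_zero {c : V → V → ℝ} (hs : ∀ x y, c x y = c y x) {κ : ℝ} (hκ : 0 < κ)
    {B : Finset V} {a b : V} (ha : a ∈ B) (hb : b ∈ B) {h : V → ℝ}
    (H : IsDipole c κ B a b h) : ∑ x ∈ B, h x = 0 := by
  classical
  have h1 : ∑ x ∈ B, (κ * h x + ∑ y ∈ B, c x y * (h x - h y)) = ∑ x ∈ B, dipoleCharge a b x :=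
    Finset.sum_congr rfl H.eq
  have h2 : ∑ x ∈ B, dipoleCharge a b x = 0 := by
    simp [dipoleCharge, Finset.sum_sub_distrib, ha, hb]
  have h3 : ∑ x ∈ B, ∑ y ∈ B, c x y * (h x - h y) = 0 := by
    have : ∑ x ∈ B, ∑ y ∈ B, c x y * (h x - h y) = - ∑ x ∈ B, ∑ y ∈ B, c x y * (h x - h y) := by
      conv_lhs => rw [Finset.sum_comm]
      rw [← Finset.sum_neg_distrib]
      refine Finset.sum_congr rfl fun x _ => ?_
      rw [← Finset.sum_neg_distrib]
      refine Finset.sum_congr rfl fun y _ => ?_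
      rw [hs]; ring
    linarith
  rw [Finset.sum_add_distrib, h2, h3, ← Finset.mul_sum] at h1
  have : κ * ∑ x ∈ B, h x = 0 := by linarith
  rcases mul_eq_zero.1 this with h | h
  · exact absurd h hκ.ne'
  · exact h

/-- The maximum is nonnegative because the potential has total sum zero. At a maximiser other than
`a` the charge is nonpositive, so the equation forces the maximum to be zero, and then the potential
vanishes on all of `B`. -/
theorem IsDipole.le_source {c : V → V → ℝ} (hc : ∀ x y, 0 ≤ c x y) (hs : ∀ x y, c x y = c y x)
    {κ : ℝ} (hκ : 0 < κ) {B : Finset V} {a b : V} (ha : a ∈ B) (hb : b ∈ B)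
    {h : V → ℝ} (H : IsDipole c κ B a b h) : 0 ≤ h a ∧ ∀ x, h x ≤ h a := by
  classical
  obtain ⟨m, hm, hmax⟩ := B.exists_max_image h ⟨a, ha⟩
  have hsum := H.sum_eq_zero hs hκ ha hb
  have hm0 : 0 ≤ h m := by
    by_contra hcon
    push Not at hcon
    have : ∑ x ∈ B, h x < 0 := Finset.sum_neg (fun x hx => (hmax x hx).trans_lt hcon) ⟨a, ha⟩
    linarith
  have hlap : 0 ≤ ∑ y ∈ B, c m y * (h m - h y) :=
    Finset.sum_nonneg fun y hy => mul_nonneg (hc _ _) (sub_nonneg.2 (hmax y hy))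
  have hma : h m = h a := by
    by_cases e : m = a
    · rw [e]
    have h1 := H.eq m hm
    have h2 : dipoleCharge a b m ≤ 0 := by
      unfold dipoleCharge; rw [if_neg e]; split_ifs <;> norm_num
    have h3 : h m = 0 := by nlinarith [mul_nonneg hκ.le hm0]
    have h4 : ∀ x ∈ B, h x = 0 := by
      have := (Finset.sum_eq_zero_iff_of_nonpos (s := B) (f := h)
        (fun x hx => (hmax x hx).trans h3.le)).1 hsum
      exact this
    rw [h3, h4 a ha]
  refine ⟨hma ▸ hm0, fun x => ?_⟩
  rw [← hma]
  by_cases hx : x ∈ B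
  · exact hmax x hx
  · rw [H.zero_off x hx]; exact hm0

theorem IsDipole.sink_le {c : V → V → ℝ} (hc : ∀ x y, 0 ≤ c x y) (hs : ∀ x y, c x y = c y x)
    {κ : ℝ} (hκ : 0 < κ) {B : Finset V} {a b : V} (ha : a ∈ B) (hb : b ∈ B)
    {h : V → ℝ} (H : IsDipole c κ B a b h) : h b ≤ 0 ∧ ∀ x, h b ≤ h x := by
  have := H.neg.le_source hc hs hκ hb ha
  exact ⟨by linarith [this.1], fun x => by linarith [this.2 x]⟩

/-- Since `a` maximises the potential, all currents out of `a` are nonnegative. Their total is `1 -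
κ * h a ≤ 1`, so none exceeds one. -/
theorem IsDipole.source_drop {c : V → V → ℝ} (hc : ∀ x y, 0 ≤ c x y) (hs : ∀ x y, c x y = c y x)
    {κ : ℝ} (hκ : 0 < κ) {B : Finset V} {a b : V} (ha : a ∈ B) (hb : b ∈ B) (hab : a ≠ b)
    {h : V → ℝ} (H : IsDipole c κ B a b h) {x : V} (hx : x ∈ B) : c a x * (h a - h x) ≤ 1 := by
  classical
  obtain ⟨h0, hle⟩ := H.le_source hc hs hκ ha hb
  have h1 := H.eq a ha
  have h2 : dipoleCharge a b a = 1 := by simp [dipoleCharge, hab]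
  have h3 : c a x * (h a - h x) ≤ ∑ y ∈ B, c a y * (h a - h y) :=
    Finset.single_le_sum (f := fun y => c a y * (h a - h y))
      (fun y _ => mul_nonneg (hc _ _) (sub_nonneg.2 (hle y))) hx
  nlinarith [mul_nonneg hκ.le h0]

theorem IsDipole.sink_drop {c : V → V → ℝ} (hc : ∀ x y, 0 ≤ c x y) (hs : ∀ x y, c x y = c y x)
    {κ : ℝ} (hκ : 0 < κ) {B : Finset V} {a b : V} (ha : a ∈ B) (hb : b ∈ B) (hab : a ≠ b)
    {h : V → ℝ} (H : IsDipole c κ B a b h) {x : V} (hx : x ∈ B) : c b x * (h x - h b) ≤ 1 := by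
  have := H.neg.source_drop hc hs hκ hb ha hab.symm hx
  linarith

/-- The potential of a dipole at the ends of two consecutive edges `a u`, `u b` is bounded by the
sum of their resistances. -/
theorem IsDipole.abs_le {c : V → V → ℝ} (hc : ∀ x y, 0 ≤ c x y) (hs : ∀ x y, c x y = c y x)
    {κ : ℝ} (hκ : 0 < κ) {B : Finset V} {a b : V} (ha : a ∈ B) (hb : b ∈ B) (hab : a ≠ b)
    {h : V → ℝ} (H : IsDipole c κ B a b h) {u : V} (hu : u ∈ B) {r : ℝ} (hr : 0 < r)
    (hau : r ≤ c a u) (hbu : r ≤ c b u) (x : V) : |h x| ≤ 2 / r := by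
  have h1 := H.source_drop hc hs hκ ha hb hab hu
  have h2 := H.sink_drop hc hs hκ ha hb hab hu
  have h3 := H.le_source hc hs hκ ha hb
  have h4 := H.sink_le hc hs hκ ha hb
  have h5 : r * (h a - h u) ≤ 1 := by nlinarith [h3.2 u]
  have h6 : r * (h u - h b) ≤ 1 := by nlinarith [h4.2 u]
  -- As `h b ≤ 0 ≤ h a`, the bound `2 / r` on the total drop `h a - h b` bounds both extreme values.
  rw [_root_.abs_le, le_div_iff₀ hr, ← neg_div, div_le_iff₀ hr]
  constructor
  · nlinarith [h4.2 x]
  · nlinarith [h3.2 x]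

/-- The potential of a dipole across an edge of the network. -/
theorem IsDipole.abs_le_of_edge {c : V → V → ℝ} (hc : ∀ x y, 0 ≤ c x y)
    (hs : ∀ x y, c x y = c y x) {κ : ℝ} (hκ : 0 < κ) {B : Finset V} {a b : V} (ha : a ∈ B)
    (hb : b ∈ B) (hab : a ≠ b) {h : V → ℝ} (H : IsDipole c κ B a b h) (hcab : 0 < c a b) (x : V) :
    |h x| ≤ 1 / c a b := by
  have h1 := H.source_drop hc hs hκ ha hb hab hb
  have h3 := H.le_source hc hs hκ ha hb
  have h4 := H.sink_le hc hs hκ ha hb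
  rw [_root_.abs_le, le_div_iff₀ hcab, ← neg_div, div_le_iff₀ hcab]
  constructor
  · nlinarith [h4.2 x]
  · nlinarith [h3.2 x]

/-- Increasing the conductance of a single edge `p q` changes a dipole potential by little. -/
theorem IsDipole.abs_sub_le {c c' : V → V → ℝ}
    (hc' : ∀ x y, 0 ≤ c' x y) (hs' : ∀ x y, c' x y = c' y x)
    {κ : ℝ} (hκ : 0 < κ) {B : Finset V} {a b : V} {h h' : V → ℝ}
    (H : IsDipole c κ B a b h) (H' : IsDipole c' κ B a b h') {p q : V} (hp : p ∈ B) (hq : q ∈ B)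
    (hpq : p ≠ q) (hpos : 0 < c' p q) (hle : c p q ≤ c' p q)
    (hcc : ∀ x y, ¬ (x = p ∧ y = q) → ¬ (x = q ∧ y = p) → c' x y = c x y)
    (hcs : c p q = c q p) {M : ℝ} (hM : ∀ x, |h x| ≤ M) (x : V) :
    |h' x - h x| ≤ (c' p q - c p q) / c' p q * (2 * M) := by
  classical
  -- Changing one conductance is a rank-one perturbation: `h' - h` is the multiple `t` of the unit
  -- dipole potential `g` across `p q` in the new network.
  obtain ⟨g, hg0, hg⟩ := exists_network_solution hc' hκ B (dipoleCharge p q)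
  have Hg : IsDipole c' κ B p q g := ⟨hg0, hg⟩
  set t : ℝ := (c' p q - c p q) * (h q - h p) with ht
  have key : ∀ x ∈ B, h' x - h x = t * g x := by
    have := network_unique hc' hκ B (h₁ := fun x => h' x) (h₂ := fun x => h x + t * g x) (by
      intro x hx
      have e1 := H.eq x hx
      have e2 := H'.eq x hx
      have e3 := Hg.eq x hx
      rw [e2]
      have e4 : ∑ y ∈ B, c' x y * (h x + t * g x - (h y + t * g y)) =
          ∑ y ∈ B, c x y * (h x - h y) + ∑ y ∈ B, (c' x y - c x y) * (h x - h y)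
          + t * ∑ y ∈ B, c' x y * (g x - g y) := by
        rw [Finset.mul_sum, ← Finset.sum_add_distrib, ← Finset.sum_add_distrib]
        exact Finset.sum_congr rfl fun y _ => by ring
      have e5 : ∑ y ∈ B, (c' x y - c x y) * (h x - h y) = - t * dipoleCharge p q x := by
        by_cases hxp : x = p
        · subst hxp
          rw [Finset.sum_eq_single_of_mem q hq]
          · simp [dipoleCharge, hpq, ht]; ring
          · intro y _ hyq
            rw [hcc x y (fun h => hyq h.2) (fun h => hpq h.1)]; ring
        · by_cases hxq : x = q
          · subst hxq
            rw [Finset.sum_eq_single_of_mem p hp]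
            · rw [hs' x p, ← hcs]
              simp only [dipoleCharge, hpq.symm, ht, if_true, if_false]; ring
            · intro y _ hyp
              rw [hcc x y (fun h => hxp h.1) (fun h => hyp h.2)]; ring
          · rw [Finset.sum_eq_zero]
            · simp [dipoleCharge, hxp, hxq]
            · intro y _
              rw [hcc x y (fun h => hxp h.1) (fun h => hxq h.1)]; ring
      simp only [e4, e5]
      linear_combination (-1 : ℝ) * e1 - t * e3)
    intro x hx
    have := this x hx
    linarith
  have hM0 : 0 ≤ M := (abs_nonneg _).trans (hM p)
  by_cases hx : x ∈ B
  · rw [key x hx, ht, abs_mul, abs_mul, abs_of_nonneg (sub_nonneg.2 hle)]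
    have g1 := Hg.abs_le_of_edge hc' hs' hκ hp hq hpq hpos x
    have g2 : |h q - h p| ≤ 2 * M := by
      have := abs_sub (h q) (h p)
      linarith [hM q, hM p]
    calc (c' p q - c p q) * |h q - h p| * |g x|
        ≤ (c' p q - c p q) * (2 * M) * (1 / c' p q) := by
          have := sub_nonneg.2 hle
          gcongr
      _ = _ := by ring
  · rw [H.zero_off x hx, H'.zero_off x hx]
    have := sub_nonneg.2 hle
    simp only [sub_self, abs_zero]
    positivity

end Dipole

/-! ### Histories of the walk -/

/-- A nonempty finite trajectory: the current position and the list of past positions, the most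
recent one first. -/
abbrev Hist (V : Type*) := V × List V

section Hist

variable {V : Type*}

/-- The history after a further step to `y`. -/
def push (s : Hist V) (y : V) : Hist V := (y, s.1 :: s.2)

@[simp] theorem push_fst (s : Hist V) (y : V) : (push s y).1 = y := rfl

@[simp] theorem push_snd (s : Hist V) (y : V) : (push s y).2 = s.1 :: s.2 := rfl

open Classical in
/-- Auxiliary recursion for `wt`. -/
def wtAux : V → List V → Sym2 V → ℕ
  | _, [], _ => 1
  | x, z :: l, e => wtAux z l e + if s(z, x) = e then 1 else 0

/-- One plus the number of traversals of `e` in the history `s`. -/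
def wt (s : Hist V) (e : Sym2 V) : ℕ := wtAux s.1 s.2 e

open Classical in
theorem wt_push (s : Hist V) (y : V) (e : Sym2 V) :
    wt (push s y) e = wt s e + if s(s.1, y) = e then 1 else 0 := rfl

theorem wt_push_self (s : Hist V) (y : V) : wt (push s y) s(s.1, y) = wt s s(s.1, y) + 1 := by
  simp [wt_push]

theorem wt_push_of_ne (s : Hist V) {y : V} {e : Sym2 V} (h : s(s.1, y) ≠ e) :
    wt (push s y) e = wt s e := by
  simp [wt_push, h]

theorem wt_le_push (s : Hist V) (y : V) (e : Sym2 V) : wt s e ≤ wt (push s y) e := by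
  rw [wt_push]; exact Nat.le_add_right _ _

theorem wt_push_le (s : Hist V) (y : V) (e : Sym2 V) : wt (push s y) e ≤ wt s e + 1 := by
  rw [wt_push]; split_ifs <;> omega

theorem one_le_wt (s : Hist V) (e : Sym2 V) : 1 ≤ wt s e := by
  obtain ⟨x, l⟩ := s
  induction l generalizing x with
  | nil => exact le_rfl
  | cons z l ih => exact (ih z).trans (wt_le_push (z, l) x e)

theorem wt_le_length (s : Hist V) (e : Sym2 V) : wt s e ≤ s.2.length + 1 := by
  obtain ⟨x, l⟩ := s
  induction l generalizing x with
  | nil => exact le_rfl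
  | cons z l ih => exact (wt_push_le (z, l) x e).trans (by simpa using ih z)

/-- Auxiliary recursion for `harmonicSum`. -/
def harmonicAux : V → List V → ℝ
  | _, [] => 0
  | x, z :: l => harmonicAux z l + 1 / ((wt (z, l) s(z, x) : ℝ) + 1)

/-- The sum over all traversals of `1 / (k + 1)`, where `k` is the weight of the traversed edge. -/
def harmonicSum (s : Hist V) : ℝ := harmonicAux s.1 s.2

theorem harmonicSum_push (s : Hist V) (y : V) :
    harmonicSum (push s y) = harmonicSum s + 1 / ((wt s s(s.1, y) : ℝ) + 1) := rfl

theorem harmonicSum_nonneg (s : Hist V) : 0 ≤ harmonicSum s := by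
  obtain ⟨x, l⟩ := s
  induction l generalizing x with
  | nil => exact le_rfl
  | cons z l ih =>
    have := harmonicSum_push (z, l) x
    change harmonicSum (push (z, l) x) ≥ 0
    rw [this]
    have := ih z
    positivity

end Hist

/-! ### Transition kernels and hitting expectations -/

section Hit

variable {V : Type*} (G : SimpleGraph V) [G.LocallyFinite]

/-- The sum of the reinforced weights of the edges at `x`. -/
def totalWeight (ρ : ℝ) (s : Hist V) (x : V) : ℝ :=
  ∑ y ∈ G.neighborFinset x, (wt s s(x, y) : ℝ) ^ ρ

/-- The transition probability of the reinforced walk with history `s` to the neighbour `y`. -/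
def stepKernel (ρ : ℝ) (s : Hist V) (y : V) : ℝ :=
  (wt s s(s.1, y) : ℝ) ^ ρ / totalWeight G ρ s s.1

theorem wt_rpow_pos (ρ : ℝ) (s : Hist V) (e : Sym2 V) : 0 < (wt s e : ℝ) ^ ρ :=
  Real.rpow_pos_of_pos (by exact_mod_cast one_le_wt s e) _

theorem one_le_wt_rpow {ρ : ℝ} (hρ : 0 ≤ ρ) (s : Hist V) (e : Sym2 V) : 1 ≤ (wt s e : ℝ) ^ ρ :=
  Real.one_le_rpow (by exact_mod_cast one_le_wt s e) hρ

theorem totalWeight_nonneg (ρ : ℝ) (s : Hist V) (x : V) : 0 ≤ totalWeight G ρ s x :=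
  Finset.sum_nonneg fun _ _ => (wt_rpow_pos ρ s _).le

variable {G} in
theorem wt_rpow_le_totalWeight (ρ : ℝ) (s : Hist V) {x y : V} (h : G.Adj x y) :
    (wt s s(x, y) : ℝ) ^ ρ ≤ totalWeight G ρ s x :=
  Finset.single_le_sum (f := fun y => (wt s s(x, y) : ℝ) ^ ρ)
    (fun _ _ => (wt_rpow_pos ρ s _).le) (by simpa using h)

variable {G} in
theorem totalWeight_pos (ρ : ℝ) (s : Hist V) {x y : V} (h : G.Adj x y) :
    0 < totalWeight G ρ s x :=
  (wt_rpow_pos ρ s _).trans_le (wt_rpow_le_totalWeight ρ s h)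

theorem stepKernel_nonneg (ρ : ℝ) (s : Hist V) (y : V) : 0 ≤ stepKernel G ρ s y :=
  div_nonneg (wt_rpow_pos ρ s _).le (totalWeight_nonneg G ρ s _)

variable {G} in
theorem sum_stepKernel (ρ : ℝ) (s : Hist V) {z : V} (h : G.Adj s.1 z) :
    ∑ y ∈ G.neighborFinset s.1, stepKernel G ρ s y = 1 := by
  unfold stepKernel
  rw [← Finset.sum_div]
  exact div_self (totalWeight_pos ρ s h).ne'

theorem sum_stepKernel_le (ρ : ℝ) (s : Hist V) :
    ∑ y ∈ G.neighborFinset s.1, stepKernel G ρ s y ≤ 1 := by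
  by_cases h : ∃ z, G.Adj s.1 z
  · obtain ⟨z, hz⟩ := h
    exact (sum_stepKernel ρ s hz).le
  · rw [Finset.sum_eq_zero]
    · exact zero_le_one
    · intro y hy
      exact absurd ⟨y, by simpa using hy⟩ h

open Classical in
/-- `hit G p A Q F n s` is the expectation of `F` at the first history in `Q` that is reached from
`s` within `n` steps of kernel `p`, where the walk is killed when it leaves `A`. -/
def hit (p : Hist V → V → ℝ) (A Q : Hist V → Prop) (F : Hist V → ℝ) : ℕ → Hist V → ℝ
  | 0, s => if Q s then F s else 0
  | n + 1, s => if Q s then F s else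
      if A s then ∑ y ∈ G.neighborFinset s.1, p s y * hit p A Q F n (push s y) else 0

variable {p : Hist V → V → ℝ} {A Q : Hist V → Prop} {F : Hist V → ℝ}

theorem hit_of_mem {s : Hist V} (h : Q s) (n : ℕ) : hit G p A Q F n s = F s := by
  cases n <;> simp [hit, h]

theorem hit_zero_of_not {s : Hist V} (h : ¬ Q s) : hit G p A Q F 0 s = 0 := by
  simp [hit, h]

theorem hit_succ_of_not {s : Hist V} (h : ¬ Q s) (hA : A s) (n : ℕ) :
    hit G p A Q F (n + 1) s =
      ∑ y ∈ G.neighborFinset s.1, p s y * hit G p A Q F n (push s y) := by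
  simp [hit, h, hA]

theorem hit_of_not_mem {s : Hist V} (h : ¬ Q s) (hA : ¬ A s) (n : ℕ) :
    hit G p A Q F n s = 0 := by
  cases n <;> simp [hit, h, hA]

/-- Domination of hitting expectations by supermartingales. -/
theorem hit_le_of_super {Inv : Hist V → Prop} {Ψ : Hist V → ℝ} (hp : ∀ s y, 0 ≤ p s y)
    (hinv : ∀ s, Inv s → ¬ Q s → A s → ∀ y, G.Adj s.1 y → Inv (push s y))
    (h0 : ∀ s, Inv s → 0 ≤ Ψ s) (hQ : ∀ s, Inv s → Q s → F s ≤ Ψ s)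
    (hstep : ∀ s, Inv s → ¬ Q s → A s →
      ∑ y ∈ G.neighborFinset s.1, p s y * Ψ (push s y) ≤ Ψ s) :
    ∀ n s, Inv s → hit G p A Q F n s ≤ Ψ s := by
  intro n
  induction n with
  | zero =>
    intro s hs
    by_cases h : Q s
    · rw [hit_of_mem G h]; exact hQ s hs h
    · rw [hit_zero_of_not G h]; exact h0 s hs
  | succ n ih =>
    intro s hs
    by_cases h : Q s
    · rw [hit_of_mem G h]; exact hQ s hs h
    by_cases hA : A s
    · rw [hit_succ_of_not G h hA]
      refine (Finset.sum_le_sum fun y hy => ?_).trans (hstep s hs h hA)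
      exact mul_le_mul_of_nonneg_left
        (ih _ (hinv s hs h hA y (by simpa using hy))) (hp _ _)
    · rw [hit_of_not_mem G h hA]; exact h0 s hs

theorem hit_nonneg (hp : ∀ s y, 0 ≤ p s y) (hF : ∀ s, 0 ≤ F s) (n : ℕ) (s : Hist V) :
    0 ≤ hit G p A Q F n s := by
  induction n generalizing s with
  | zero =>
    by_cases h : Q s
    · rw [hit_of_mem G h]; exact hF s
    · rw [hit_zero_of_not G h]
  | succ n ih =>
    by_cases h : Q s
    · rw [hit_of_mem G h]; exact hF s
    by_cases hA : A s
    · rw [hit_succ_of_not G h hA]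
      exact Finset.sum_nonneg fun y _ => mul_nonneg (hp _ _) (ih _)
    · rw [hit_of_not_mem G h hA]

theorem hit_mono_time (hp : ∀ s y, 0 ≤ p s y) (hF : ∀ s, 0 ≤ F s) (n : ℕ) (s : Hist V) :
    hit G p A Q F n s ≤ hit G p A Q F (n + 1) s := by
  induction n generalizing s with
  | zero =>
    by_cases h : Q s
    · rw [hit_of_mem G h, hit_of_mem G h]
    · rw [hit_zero_of_not G h]; exact hit_nonneg G hp hF _ _
  | succ n ih =>
    by_cases h : Q s
    · rw [hit_of_mem G h, hit_of_mem G h]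
    by_cases hA : A s
    · rw [hit_succ_of_not G h hA, hit_succ_of_not G h hA]
      exact Finset.sum_le_sum fun y _ => mul_le_mul_of_nonneg_left (ih _) (hp _ _)
    · rw [hit_of_not_mem G h hA, hit_of_not_mem G h hA]

/-- Comparison of hitting expectations with different rewards and killing sets. -/
theorem hit_le_hit {Inv : Hist V → Prop} {A' : Hist V → Prop} {F' : Hist V → ℝ}
    (hp : ∀ s y, 0 ≤ p s y)
    (hinv : ∀ s, Inv s → ¬ Q s → A s → ∀ y, G.Adj s.1 y → Inv (push s y))
    (hA : ∀ s, A s → A' s) (hF' : ∀ s, 0 ≤ F' s)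
    (hF : ∀ s, Inv s → Q s → F s ≤ F' s) (n : ℕ) (s : Hist V) (hs : Inv s) :
    hit G p A Q F n s ≤ hit G p A' Q F' n s := by
  induction n generalizing s with
  | zero =>
    by_cases h : Q s
    · rw [hit_of_mem G h, hit_of_mem G h]; exact hF s hs h
    · rw [hit_zero_of_not G h, hit_zero_of_not G h]
  | succ n ih =>
    by_cases h : Q s
    · rw [hit_of_mem G h, hit_of_mem G h]; exact hF s hs h
    by_cases hAs : A s
    · rw [hit_succ_of_not G h hAs, hit_succ_of_not G h (hA s hAs)]
      exact Finset.sum_le_sum fun y hy => mul_le_mul_of_nonneg_left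
        (ih _ (hinv s hs h hAs y (by simpa using hy))) (hp _ _)
    · rw [hit_of_not_mem G h hAs]; exact hit_nonneg G hp hF' _ _

theorem hit_add (F₁ F₂ : Hist V → ℝ) (n : ℕ) (s : Hist V) :
    hit G p A Q (fun t => F₁ t + F₂ t) n s = hit G p A Q F₁ n s + hit G p A Q F₂ n s := by
  induction n generalizing s with
  | zero =>
    by_cases h : Q s
    · simp [hit_of_mem G h]
    · simp [hit_zero_of_not G h]
  | succ n ih =>
    by_cases h : Q s
    · simp [hit_of_mem G h]
    by_cases hAs : A s
    · simp only [hit_succ_of_not G h hAs, ih, mul_add, Finset.sum_add_distrib]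
    · simp [hit_of_not_mem G h hAs]

theorem hit_const_mul (c : ℝ) (F : Hist V → ℝ) (n : ℕ) (s : Hist V) :
    hit G p A Q (fun t => c * F t) n s = c * hit G p A Q F n s := by
  induction n generalizing s with
  | zero =>
    by_cases h : Q s
    · simp [hit_of_mem G h]
    · simp [hit_zero_of_not G h]
  | succ n ih =>
    by_cases h : Q s
    · simp [hit_of_mem G h]
    by_cases hAs : A s
    · simp only [hit_succ_of_not G h hAs, ih, Finset.mul_sum]
      exact Finset.sum_congr rfl fun y _ => by ring
    · simp [hit_of_not_mem G h hAs]

theorem hit_sum {ι : Type*} (I : Finset ι) (F : ι → Hist V → ℝ) (n : ℕ) (s : Hist V) :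
    hit G p A Q (fun t => ∑ i ∈ I, F i t) n s = ∑ i ∈ I, hit G p A Q (F i) n s := by
  classical
  induction I using Finset.induction_on with
  | empty =>
    have := hit_const_mul G (p := p) (A := A) (Q := Q) 0 (fun _ => 0) n s
    simpa using this
  | insert i I hi ih => simp only [Finset.sum_insert hi, hit_add, ih]

theorem hit_le_const {Inv : Hist V → Prop} (hp : ∀ s y, 0 ≤ p s y)
    (hp1 : ∀ s, A s → ∑ y ∈ G.neighborFinset s.1, p s y ≤ 1)
    (hinv : ∀ s, Inv s → ¬ Q s → A s → ∀ y, G.Adj s.1 y → Inv (push s y))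
    {c : ℝ} (hc : 0 ≤ c) (hF : ∀ s, Inv s → Q s → F s ≤ c) (n : ℕ) (s : Hist V) (hs : Inv s) :
    hit G p A Q F n s ≤ c := by
  refine hit_le_of_super G (Ψ := fun _ => c) hp hinv (fun _ _ => hc) hF ?_ n s hs
  intro s _ _ hA
  rw [← Finset.sum_mul]
  nlinarith [hp1 s hA]

/-- The strong Markov property, as an inequality. -/
theorem hit_le_hit_hit {Q₁ : Hist V → Prop} (hp : ∀ s y, 0 ≤ p s y) (hF : ∀ s, 0 ≤ F s)
    (hQ : ∀ s, Q s → Q₁ s) (n : ℕ) (s : Hist V) :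
    hit G p A Q F n s ≤ hit G p A Q₁ (fun t => hit G p A Q F n t) n s := by
  -- Only the outer horizon `m` decreases in the induction. The inner one stays at `n`, which is
  -- enough by monotonicity in time.
  have key : ∀ m ≤ n, ∀ s, hit G p A Q F m s ≤
      hit G p A Q₁ (fun t => hit G p A Q F n t) m s := by
    intro m
    induction m with
    | zero =>
      intro _ s
      by_cases h₁ : Q₁ s
      · rw [hit_of_mem G h₁]
        exact monotone_nat_of_le_succ (f := fun n => hit G p A Q F n s)
          (fun n => hit_mono_time G hp hF n s) (Nat.zero_le _)
      · rw [hit_zero_of_not G h₁, hit_zero_of_not G (fun h => h₁ (hQ s h))]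
    | succ m ih =>
      intro hm s
      by_cases h₁ : Q₁ s
      · rw [hit_of_mem G h₁]
        exact monotone_nat_of_le_succ (f := fun n => hit G p A Q F n s)
          (fun n => hit_mono_time G hp hF n s) hm
      have h : ¬ Q s := fun h => h₁ (hQ s h)
      by_cases hA : A s
      · rw [hit_succ_of_not G h₁ hA, hit_succ_of_not G h hA]
        exact Finset.sum_le_sum fun y _ =>
          mul_le_mul_of_nonneg_left (ih (by omega) _) (hp _ _)
      · rw [hit_of_not_mem G h hA, hit_of_not_mem G h₁ hA]
  exact key n le_rfl s

end Hit

/-! ### Dipole potentials of the reinforced network -/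

section Potential

variable {V : Type*} (G : SimpleGraph V)

open Classical in
/-- The conductances given by the reinforced weights of a history. -/
def conductance (ρ : ℝ) (s : Hist V) (x y : V) : ℝ :=
  if G.Adj x y then (wt s s(x, y) : ℝ) ^ ρ else 0

theorem conductance_nonneg (ρ : ℝ) (s : Hist V) (x y : V) : 0 ≤ conductance G ρ s x y := by
  unfold conductance; split_ifs
  · exact (wt_rpow_pos ρ s _).le
  · exact le_rfl

theorem conductance_comm (ρ : ℝ) (s : Hist V) (x y : V) :
    conductance G ρ s x y = conductance G ρ s y x := by
  unfold conductance; rw [G.adj_comm, Sym2.eq_swap]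

variable {G} in
theorem conductance_of_adj (ρ : ℝ) (s : Hist V) {x y : V} (h : G.Adj x y) :
    conductance G ρ s x y = (wt s s(x, y) : ℝ) ^ ρ := by
  simp [conductance, h]

/-- The dipole potential between `v` and `w` for the current conductances. -/
def pot (ρ κ : ℝ) (hκ : 0 < κ) (B : Finset V) (v w : V) (s : Hist V) : V → ℝ :=
  Classical.choose
    (exists_network_solution (conductance_nonneg G ρ s) hκ B (dipoleCharge v w))

theorem isDipole_pot (ρ κ : ℝ) (hκ : 0 < κ) (B : Finset V) (v w : V) (s : Hist V) :
    IsDipole (conductance G ρ s) κ B v w (pot G ρ κ hκ B v w s) :=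
  let h := Classical.choose_spec
    (exists_network_solution (conductance_nonneg G ρ s) hκ B (dipoleCharge v w))
  ⟨h.1, h.2⟩

variable {G}

theorem abs_pot_le {ρ κ : ℝ} (hρ : 0 ≤ ρ) (hκ : 0 < κ) {B : Finset V} {u v w : V} (hu : u ∈ B)
    (hv : v ∈ B) (hw : w ∈ B) (hvw : v ≠ w) (huv : G.Adj u v) (huw : G.Adj u w) (s : Hist V)
    {y : ℕ} (hy : 1 ≤ y) (hev : y ≤ wt s s(u, v)) (hew : y ≤ wt s s(u, w)) (x : V) :
    |pot G ρ κ hκ B v w s x| ≤ 2 * (y : ℝ) ^ (-ρ) := by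
  have hy0 : (0 : ℝ) < y := by exact_mod_cast hy
  have := (isDipole_pot G ρ κ hκ B v w s).abs_le (conductance_nonneg G ρ s)
    (conductance_comm G ρ s) hκ hv hw hvw hu (r := (y : ℝ) ^ ρ) (by positivity)
    (by
      rw [conductance_comm, conductance_of_adj ρ s huv]
      exact Real.rpow_le_rpow hy0.le (by exact_mod_cast hev) hρ)
    (by
      rw [conductance_comm, conductance_of_adj ρ s huw]
      exact Real.rpow_le_rpow hy0.le (by exact_mod_cast hew) hρ) x
  rwa [Real.rpow_neg hy0.le, ← div_eq_mul_inv]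

/-- Bernoulli's inequality for `(1 - 1 / (j + 1)) ^ ρ`. -/
theorem rpow_increment_ratio_le {ρ : ℝ} (hρ : 1 ≤ ρ) (j : ℕ) :
    (((j + 1 : ℕ) : ℝ) ^ ρ - (j : ℝ) ^ ρ) / ((j + 1 : ℕ) : ℝ) ^ ρ ≤ ρ / ((j : ℝ) + 1) := by
  have h0 : (0 : ℝ) < (j : ℝ) + 1 := by positivity
  push_cast
  rw [sub_div, div_self (by positivity), ← Real.div_rpow (by positivity) h0.le]
  have h1 : (j : ℝ) / (j + 1) = 1 + (-(1 / ((j : ℝ) + 1))) := by field_simp; ring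
  have h2 : (-1 : ℝ) ≤ -(1 / ((j : ℝ) + 1)) := by
    have : 1 / ((j : ℝ) + 1) ≤ 1 := by rw [div_le_one h0]; linarith [(j.cast_nonneg : (0:ℝ) ≤ j)]
    linarith
  have := one_add_mul_self_le_rpow_one_add h2 hρ
  rw [h1]
  have e : ρ / ((j : ℝ) + 1) = ρ * (1 / ((j : ℝ) + 1)) := by ring
  rw [e]; linarith

/-- A step raises a single conductance, so `IsDipole.abs_sub_le` applies. The factor `1 / (wt + 1)`
is exactly the increment of `harmonicSum`, which therefore controls the accumulated change of the
potential. -/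
theorem abs_pot_push_sub_le {ρ κ : ℝ} (hρ : 1 ≤ ρ) (hκ : 0 < κ) {B : Finset V} {v w : V}
    (s : Hist V) {z : V} (hz : G.Adj s.1 z) (hx : s.1 ∈ B) (hzB : z ∈ B) {M : ℝ}
    (hM : ∀ x, |pot G ρ κ hκ B v w s x| ≤ M) (x : V) :
    |pot G ρ κ hκ B v w (push s z) x - pot G ρ κ hκ B v w s x| ≤
      ρ / ((wt s s(s.1, z) : ℝ) + 1) * (2 * M) := by
  have hM0 : 0 ≤ M := (abs_nonneg _).trans (hM x)
  have e1 : conductance G ρ (push s z) s.1 z = ((wt s s(s.1, z) + 1 : ℕ) : ℝ) ^ ρ := by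
    rw [conductance_of_adj ρ _ hz, wt_push_self]
  have e2 : conductance G ρ s s.1 z = (wt s s(s.1, z) : ℝ) ^ ρ := conductance_of_adj ρ s hz
  have h := (isDipole_pot G ρ κ hκ B v w s).abs_sub_le
    (conductance_nonneg G ρ (push s z)) (conductance_comm G ρ (push s z)) hκ
    (isDipole_pot G ρ κ hκ B v w (push s z)) hx hzB hz.ne
    (by rw [conductance_of_adj ρ _ hz]; exact wt_rpow_pos ρ _ _)
    (by
      rw [e1, e2]
      exact Real.rpow_le_rpow (by positivity) (by push_cast; linarith) (by linarith))
    (by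
      intro a b h1 h2
      unfold conductance
      rw [wt_push_of_ne]
      intro h
      rcases Sym2.eq_iff.1 h with ⟨h3, h4⟩ | ⟨h3, h4⟩
      · exact h1 ⟨h3.symm, h4.symm⟩
      · exact h2 ⟨h4.symm, h3.symm⟩)
    (conductance_comm G ρ s _ _) hM x
  refine h.trans (mul_le_mul_of_nonneg_right ?_ (by positivity))
  rw [e1, e2]
  exact rpow_increment_ratio_le hρ _

variable [G.LocallyFinite]

/-- One-step expectation of the dipole potential. -/
theorem sum_stepKernel_pot {ρ κ : ℝ} (hκ : 0 < κ) {B : Finset V} {v w : V} (s : Hist V)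
    (hx : s.1 ∈ B) (hN : ∀ z, G.Adj s.1 z → z ∈ B) {z₀ : V} (hz₀ : G.Adj s.1 z₀) :
    ∑ z ∈ G.neighborFinset s.1, stepKernel G ρ s z * pot G ρ κ hκ B v w s z =
      pot G ρ κ hκ B v w s s.1 -
        (dipoleCharge v w s.1 - κ * pot G ρ κ hκ B v w s s.1) / totalWeight G ρ s s.1 := by
  set h := pot G ρ κ hκ B v w s
  have hW := totalWeight_pos ρ s hz₀
  have H := (isDipole_pot G ρ κ hκ B v w s).eq s.1 hx
  have e : ∑ y ∈ B, conductance G ρ s s.1 y * (h s.1 - h y) =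
      ∑ y ∈ G.neighborFinset s.1, (wt s s(s.1, y) : ℝ) ^ ρ * (h s.1 - h y) := by
    symm
    rw [← Finset.sum_subset (s₁ := G.neighborFinset s.1) (s₂ := B)]
    · refine Finset.sum_congr rfl fun y hy => ?_
      rw [conductance_of_adj ρ s (by simpa using hy)]
    · intro y hy; exact hN y (by simpa using hy)
    · intro y _ hy
      have : ¬ G.Adj s.1 y := by simpa using hy
      simp [conductance, this]
  change κ * h s.1 + ∑ y ∈ B, conductance G ρ s s.1 y * (h s.1 - h y) = _ at H
  rw [e] at H
  have e2 : ∑ y ∈ G.neighborFinset s.1, (wt s s(s.1, y) : ℝ) ^ ρ * (h s.1 - h y) =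
      totalWeight G ρ s s.1 * h s.1 -
        ∑ y ∈ G.neighborFinset s.1, (wt s s(s.1, y) : ℝ) ^ ρ * h y := by
    unfold totalWeight
    rw [Finset.sum_mul, ← Finset.sum_sub_distrib]
    exact Finset.sum_congr rfl fun y _ => by ring
  have e3 : ∑ z ∈ G.neighborFinset s.1, stepKernel G ρ s z * h z =
      (∑ y ∈ G.neighborFinset s.1, (wt s s(s.1, y) : ℝ) ^ ρ * h y) / totalWeight G ρ s s.1 := by
    rw [Finset.sum_div]
    exact Finset.sum_congr rfl fun y _ => by unfold stepKernel; ring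
  rw [e3]
  rw [e2] at H
  field_simp
  linarith

open Classical in
/-- One-step expectation of the decrease of the residual lifetime of an edge. -/
theorem sum_stepKernel_edge {ρ : ℝ} (s : Hist V) {a b : V} (hab : G.Adj a b) :
    ∑ z ∈ G.neighborFinset s.1,
      stepKernel G ρ s z * (if s(s.1, z) = s(a, b) then (wt s s(a, b) : ℝ) ^ (-ρ) else 0) =
      ((if s.1 = a then 1 else 0) + (if s.1 = b then 1 else 0)) / totalWeight G ρ s s.1 := by
  have hmul : ∀ e : Sym2 V, (wt s e : ℝ) ^ ρ * (wt s e : ℝ) ^ (-ρ) = 1 := fun e => by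
    rw [Real.rpow_neg (by positivity)]
    exact mul_inv_cancel₀ (wt_rpow_pos ρ s e).ne'
  by_cases h1 : s.1 = a
  · have h2 : s.1 ≠ b := fun h => hab.ne (h1.symm.trans h)
    rw [Finset.sum_eq_single_of_mem b (by rw [h1]; simpa using hab)]
    · rw [if_pos (by rw [h1]), if_pos h1, if_neg h2]
      unfold stepKernel
      rw [h1, div_mul_eq_mul_div, hmul]; simp
    · intro z _ hz
      rw [if_neg, mul_zero]
      rw [h1]
      intro h
      rcases Sym2.eq_iff.1 h with ⟨_, h4⟩ | ⟨h3, _⟩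
      · exact hz h4
      · exact hab.ne h3
  · by_cases h2 : s.1 = b
    · rw [Finset.sum_eq_single_of_mem a (by rw [h2]; simpa using hab.symm)]
      · rw [if_pos (by rw [h2, Sym2.eq_swap]), if_neg h1, if_pos h2]
        unfold stepKernel
        rw [h2, Sym2.eq_swap, div_mul_eq_mul_div, hmul]; simp
      · intro z _ hz
        rw [if_neg, mul_zero]
        intro h
        rcases Sym2.eq_iff.1 h with ⟨h3, _⟩ | ⟨_, h4⟩
        · exact h1 h3
        · exact hz h4
    · rw [if_neg h1, if_neg h2, Finset.sum_eq_zero]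
      · simp
      · intro z _
        rw [if_neg, mul_zero]
        intro h
        rcases Sym2.eq_iff.1 h with ⟨h3, _⟩ | ⟨h3, _⟩
        · exact h1 h3
        · exact h2 h3

end Potential

/-! ### The exponential supermartingale of a duel between two edges -/

/-- Here `a` stands for the scaled change of `lead`, `β` for the scaled potential at the new vertex,
`t` for the change of that potential caused by the reinforcement, and `q` for a reserve against the
killing. All second-order terms together are at most `σ / 2`. The right side is at least `1 / 2`, so
the factor `exp (-σ) ≤ 1 / (1 + σ)` pays for them. What remains is linear in `a` and `β`, and its
conditional mean can be computed exactly. -/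
theorem exp_step_le {a β q σ t τ : ℝ} (ha : |a| ≤ 1 / 8) (hβ : |β| ≤ 1 / 4) (hq0 : 0 ≤ q)
    (hq : q ≤ 1 / 8) (ht : |t| ≤ τ) (hτ : τ ≤ 1 / 4)
    (hσ : 2 * (|a| * |β| + 2 * |a| ^ 2 + 2 * τ + q) ≤ σ) :
    Real.exp (-σ) * (Real.exp (-a) * (1 - β - t)) ≤ 1 - a - β - q := by
  obtain ⟨ha1, ha2⟩ := abs_le.1 ha
  obtain ⟨hb1, hb2⟩ := abs_le.1 hβ
  obtain ⟨ht1, ht2⟩ := abs_le.1 ht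
  have hexp : Real.exp (-a) ≤ 1 - a + a ^ 2 := by
    have := Real.abs_exp_sub_one_sub_id_le (x := -a) (by rw [abs_neg]; linarith)
    have := (abs_le.1 this).2
    nlinarith
  have hsq : |a| ^ 2 = a ^ 2 := sq_abs a
  have hab : a * β ≤ |a| * |β| := by rw [← abs_mul]; exact le_abs_self _
  have hτ0 : 0 ≤ τ := (abs_nonneg t).trans ht
  set E := |a| * |β| + 2 * |a| ^ 2 + 2 * τ with hE
  have hE0 : 0 ≤ E := by positivity
  have h1 : Real.exp (-a) * (1 - β - t) ≤ (1 - a - β - q) + (q + E) := by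
    have h0 : 0 ≤ 1 - β - t := by linarith
    have h2 := mul_le_mul_of_nonneg_right hexp h0
    have h3 : (1 - a + a ^ 2) * (-t) ≤ 2 * τ := by
      have : 0 ≤ 1 - a + a ^ 2 := by nlinarith
      have : 1 - a + a ^ 2 ≤ 2 := by nlinarith
      nlinarith
    have h4 : (1 - a + a ^ 2) * (1 - β) ≤ 1 - a - β + |a| * |β| + 2 * a ^ 2 := by
      nlinarith [sq_nonneg a]
    rw [hE, hsq]
    nlinarith
  have hσ0 : 0 ≤ σ := by linarith
  have h5 : Real.exp (-σ) ≤ 1 / (1 + σ) := by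
    rw [Real.exp_neg, one_div]
    exact inv_anti₀ (by linarith) (by linarith [Real.add_one_le_exp σ])
  have hT : 1 / 2 ≤ 1 - a - β - q := by linarith
  calc Real.exp (-σ) * (Real.exp (-a) * (1 - β - t))
      ≤ Real.exp (-σ) * ((1 - a - β - q) + (q + E)) :=
        mul_le_mul_of_nonneg_left h1 (Real.exp_pos _).le
    _ ≤ 1 / (1 + σ) * ((1 - a - β - q) + (q + E)) :=
        mul_le_mul_of_nonneg_right h5 (by linarith)
    _ ≤ _ := by
        rw [div_mul_eq_mul_div, div_le_iff₀ (by linarith)]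
        nlinarith

section Duel

variable {V : Type*} (G : SimpleGraph V)

/-- The killing rate used for walks of length at most `k`. -/
def killRate (k : ℕ) : ℝ := 1 / ((k : ℝ) + 3)

theorem killRate_pos (k : ℕ) : 0 < killRate k := by unfold killRate; positivity

open Classical in
/-- The decrease of the residual lifetime of the edge `e` when the walk steps to `z`. -/
def lifeLoss (ρ : ℝ) (s : Hist V) (z : V) (e : Sym2 V) : ℝ :=
  if s(s.1, z) = e then (wt s e : ℝ) ^ (-ρ) else 0

theorem powSum_wt_push (ρ : ℝ) (s : Hist V) (z : V) (e : Sym2 V) :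
    powSum ρ (wt (push s z) e) = powSum ρ (wt s e) + lifeLoss ρ s z e := by
  unfold lifeLoss
  rw [wt_push]
  split_ifs
  · exact powSum_succ ρ _
  · simp

theorem lifeLoss_nonneg (ρ : ℝ) (s : Hist V) (z : V) (e : Sym2 V) : 0 ≤ lifeLoss ρ s z e := by
  unfold lifeLoss; split_ifs <;> positivity

theorem lifeLoss_le {ρ : ℝ} (hρ : 0 ≤ ρ) {s : Hist V} (z : V) {e : Sym2 V} {y : ℕ} (hy : 1 ≤ y)
    (h : y ≤ wt s e) : lifeLoss ρ s z e ≤ (y : ℝ) ^ (-ρ) := by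
  unfold lifeLoss; split_ifs
  · exact Real.rpow_le_rpow_of_nonpos (by exact_mod_cast hy) (by exact_mod_cast h) (by linarith)
  · positivity

/-- The cost process compensating the second order terms. -/
def cost (ρ : ℝ) (u v w : V) (y : ℕ) (s : Hist V) : ℝ :=
  (16 * ρ + 4) * (y : ℝ) ^ (-(1 / 2) : ℝ) * harmonicSum s +
    8 * (y : ℝ) ^ (ρ - 1) * (powSum ρ (wt s s(u, v)) + powSum ρ (max (wt s s(u, w)) y))

theorem cost_le_push {ρ : ℝ} (hρ : 0 ≤ ρ) (u v w : V) (y : ℕ) (s : Hist V) (z : V) :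
    cost ρ u v w y s ≤ cost ρ u v w y (push s z) := by
  unfold cost
  have h1 : harmonicSum s ≤ harmonicSum (push s z) := by
    rw [harmonicSum_push]
    have : (0 : ℝ) ≤ 1 / ((wt s s(s.1, z) : ℝ) + 1) := by positivity
    linarith
  have h2 := powSum_mono ρ (wt_le_push s z s(u, v))
  have h3 : powSum ρ (max (wt s s(u, w)) y) ≤ powSum ρ (max (wt (push s z) s(u, w)) y) :=
    powSum_mono ρ (max_le_max (wt_le_push s z s(u, w)) le_rfl)
  gcongr

open Classical in
/-- The number of traversals of `u w` since it had weight `y`, corrected for the current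
position. -/
def visitCount (u w : V) (y : ℕ) (s : Hist V) : ℝ :=
  (wt s s(u, w) : ℝ) - y - if s.1 = u then 1 else 0

/-- The difference of residual lifetimes of the edges `u w` and `u v`. -/
def lead (ρ : ℝ) (u v w : V) (s : Hist V) : ℝ :=
  powSum ρ (wt s s(u, v)) - powSum ρ (wt s s(u, w))

open Classical in
/-- The exponential supermartingale controlling the lead of `u v` over `u w`. -/
def psi (ρ : ℝ) (k : ℕ) (B : Finset V) (u v w : V) (y : ℕ) (b : ℝ) (s : Hist V) : ℝ :=
  if wt s s(u, w) < y then
    2 * Real.exp (-((y : ℝ) ^ (ρ - 1 / 2) * (powSum ρ (wt s s(u, v)) - powSum ρ y))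
      - cost ρ u v w y s)
  else
    Real.exp (-((y : ℝ) ^ (ρ - 1 / 2) * (lead ρ u v w s - b * visitCount u w y s))
      - cost ρ u v w y s) *
    (1 - (y : ℝ) ^ (ρ - 1 / 2) * pot G ρ (killRate k) (killRate_pos k) B v w s s.1)

open Classical in
/-- The step kernel tilted at `u` in favour of `v`. -/
def tiltKernel [G.LocallyFinite] (ρ ε : ℝ) (u v : V) (s : Hist V) (z : V) : ℝ :=
  if s.1 = u then
    stepKernel G ρ s z * (1 + if z = v then ε else 0) / (1 + ε * stepKernel G ρ s v)
  else stepKernel G ρ s z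

variable {G}

theorem scale_mul {ρ : ℝ} {y : ℕ} (hy : 1 ≤ y) :
    (y : ℝ) ^ (ρ - 1 / 2) * (y : ℝ) ^ (-ρ) = (y : ℝ) ^ (-(1 / 2) : ℝ) := by
  have hy0 : (0 : ℝ) < y := by exact_mod_cast hy
  rw [← Real.rpow_add hy0]; congr 1; ring

theorem scale_mul' {ρ : ℝ} {y : ℕ} (hy : 1 ≤ y) :
    (y : ℝ) ^ (ρ - 1) = (y : ℝ) ^ (ρ - 1 / 2) * (y : ℝ) ^ (-(1 / 2) : ℝ) := by
  have hy0 : (0 : ℝ) < y := by exact_mod_cast hy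
  rw [← Real.rpow_add hy0]; congr 1; ring

theorem rpow_neg_half_le {ρ : ℝ} (hρ : 1 < ρ) {y : ℕ} (hy : 8 * ρ ≤ (y : ℝ) ^ (1 / 2 : ℝ)) :
    8 * ρ * (y : ℝ) ^ (-(1 / 2) : ℝ) ≤ 1 := by
  have hy0 : (0 : ℝ) < (y : ℝ) ^ (1 / 2 : ℝ) := by linarith
  rw [Real.rpow_neg (by positivity), ← div_eq_mul_inv, div_le_one hy0]
  exact hy

section

variable {ρ : ℝ} {k : ℕ} {B : Finset V} {u v w : V} {y : ℕ} {b : ℝ}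

/-- The linearisation of the increment of `psi`. -/
def linStep (G : SimpleGraph V) (ρ : ℝ) (k : ℕ) (B : Finset V) (u v w : V) (y : ℕ) (s : Hist V)
    (z : V) : ℝ :=
  1 - (y : ℝ) ^ (ρ - 1 / 2) * (lifeLoss ρ s z s(u, v) - lifeLoss ρ s z s(u, w))
    - (y : ℝ) ^ (ρ - 1 / 2) * pot G ρ (killRate k) (killRate_pos k) B v w s z
    - (y : ℝ) ^ (ρ - 1 / 2) * (killRate k * (2 * (y : ℝ) ^ (-ρ)))

-- The indicator in `visitCount` postpones the charge for a crossing from `w` to `u` until the walk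
-- next leaves `u`. The count thus grows only in steps out of `u`, where the tilt acts, and then by
-- at most two.
open Classical in
theorem visitCount_push_le (s : Hist V) (z : V) (hz : s.1 ≠ z) :
    visitCount u w y (push s z) ≤ visitCount u w y s + if s.1 = u then 2 else 0 := by
  unfold visitCount
  rw [wt_push]
  simp only [push_fst]
  by_cases h1 : s.1 = u
  · have h2 : z ≠ u := fun h => hz (h1.trans h.symm)
    simp only [h1, h2, if_true, if_false]
    split_ifs <;> push_cast <;> linarith
  · by_cases h2 : z = u
    · simp only [h1, h2, if_true, if_false]
      split_ifs <;> push_cast <;> linarith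
    · have : s(s.1, z) ≠ s(u, w) := by
        intro h
        rcases Sym2.eq_iff.1 h with ⟨h3, _⟩ | ⟨_, h4⟩
        · exact h1 h3
        · exact h2 h4
      simp [h1, h2, this]

theorem abs_scale_pot_le (hρ : 1 < ρ) (hu : u ∈ B) (hv : v ∈ B) (hw : w ∈ B) (hvw : v ≠ w)
    (huv : G.Adj u v) (huw : G.Adj u w) (hy1 : 1 ≤ y)
    {s : Hist V} (hev : y ≤ wt s s(u, v)) (hew : y ≤ wt s s(u, w)) (x : V) :
    |(y : ℝ) ^ (ρ - 1 / 2) * pot G ρ (killRate k) (killRate_pos k) B v w s x| ≤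
      2 * (y : ℝ) ^ (-(1 / 2) : ℝ) := by
  have := abs_pot_le (by linarith) (killRate_pos k) hu hv hw hvw huv huw s hy1 hev hew x
  rw [abs_mul, abs_of_nonneg (by positivity), ← scale_mul (ρ := ρ) hy1]
  calc _ ≤ (y : ℝ) ^ (ρ - 1 / 2) * (2 * (y : ℝ) ^ (-ρ)) := by gcongr
    _ = _ := by ring

-- `exp_step_le` applied to one step of the walk: the growth of `cost` plays the role of `σ`, and
-- the factor `exp (2 μ b)`, present only at `u`, pays for the growth of `visitCount`.
open Classical in
set_option maxHeartbeats 1000000 in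
theorem psi_push_le (hρ : 1 < ρ) (hu : u ∈ B) (hv : v ∈ B) (hw : w ∈ B) (hvw : v ≠ w)
    (huv : G.Adj u v) (huw : G.Adj u w) (hy1 : 1 ≤ y) (hy : 8 * ρ ≤ (y : ℝ) ^ (1 / 2 : ℝ))
    (hb : 0 ≤ b) {s : Hist V} (hev : y ≤ wt s s(u, v)) (hew : y ≤ wt s s(u, w))
    (hx : s.1 ∈ B) (hk : s.2.length ≤ k) {z : V} (hz : G.Adj s.1 z) (hzB : z ∈ B) :
    psi G ρ k B u v w y b (push s z) ≤
      Real.exp (-((y : ℝ) ^ (ρ - 1 / 2) * (lead ρ u v w s - b * visitCount u w y s))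
        - cost ρ u v w y s) *
      ((if s.1 = u then Real.exp (2 * ((y : ℝ) ^ (ρ - 1 / 2) * b)) else 1) *
        linStep G ρ k B u v w y s z) := by
  have hy0 : (0 : ℝ) < y := by exact_mod_cast hy1
  have hev' := hev.trans (wt_le_push s z s(u, v))
  have hew' := hew.trans (wt_le_push s z s(u, w))
  unfold psi
  rw [if_neg (not_lt.2 hew')]
  simp only [push_fst]
  unfold linStep
  set P := pot G ρ (killRate k) (killRate_pos k) B v w s z with hP
  set P' := pot G ρ (killRate k) (killRate_pos k) B v w (push s z) z with hP'
  set μ := (y : ℝ) ^ (ρ - 1 / 2) with hμ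
  set m := (y : ℝ) ^ (-(1 / 2) : ℝ) with hm
  set j : ℝ := (wt s s(s.1, z) : ℝ) + 1 with hj
  set δ := lifeLoss ρ s z s(u, v) - lifeLoss ρ s z s(u, w) with hδ
  have hμ0 : 0 < μ := by positivity
  have hm0 : 0 < m := by positivity
  have hmul : μ * (y : ℝ) ^ (-ρ) = m := scale_mul hy1
  have hmρ : 8 * ρ * m ≤ 1 := rpow_neg_half_le hρ hy
  have hm8 : m ≤ 1 / 8 := by nlinarith
  have hj2 : 2 ≤ j := by
    have : (1 : ℝ) ≤ (wt s s(s.1, z) : ℝ) := by exact_mod_cast one_le_wt s _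
    linarith
  -- A walk of at most `k` steps has weights at most `k + 1`, so `j ≤ k + 2`. The error due to
  -- killing is then absorbed by the harmonic part of `cost`.
  have hκj : killRate k ≤ 1 / j := by
    unfold killRate
    apply one_div_le_one_div_of_le (by linarith)
    have : (wt s s(s.1, z) : ℝ) ≤ k + 1 := by
      exact_mod_cast (wt_le_length s _).trans (by omega)
    linarith
  have hκ0 := killRate_pos k
  have hl1 := lifeLoss_nonneg ρ s z s(u, v)
  have hl2 := lifeLoss_nonneg ρ s z s(u, w)
  have hl3 := lifeLoss_le (by linarith : 0 ≤ ρ) z hy1 hev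
  have hl4 := lifeLoss_le (by linarith : 0 ≤ ρ) z hy1 hew
  have hδ1 : |δ| ≤ (y : ℝ) ^ (-ρ) := abs_le.2 ⟨by linarith, by linarith⟩
  have hδ2 : |δ| ≤ lifeLoss ρ s z s(u, v) + lifeLoss ρ s z s(u, w) :=
    abs_le.2 ⟨by linarith, by linarith⟩
  have ha : |μ * δ| ≤ m := by
    rw [abs_mul, abs_of_pos hμ0, ← hmul]; gcongr
  have hβ : |μ * P| ≤ 2 * m := abs_scale_pot_le hρ hu hv hw hvw huv huw hy1 hev hew z
  have hq : μ * (killRate k * (2 * (y : ℝ) ^ (-ρ))) = 2 * m * killRate k := by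
    rw [← hmul]; ring
  have ht : |μ * (P' - P)| ≤ ρ / j * (4 * m) := by
    have := abs_pot_push_sub_le (v := v) (w := w) hρ.le (killRate_pos k) s hz hx hzB
      (abs_pot_le (by linarith) (killRate_pos k) hu hv hw hvw huv huw s hy1 hev hew) z
    rw [abs_mul, abs_of_pos hμ0]
    calc μ * |P' - P| ≤ μ * (ρ / j * (2 * (2 * (y : ℝ) ^ (-ρ)))) := by gcongr
      _ = _ := by rw [← hmul]; ring
  have hjinv : 1 / j ≤ 1 / 2 := one_div_le_one_div_of_le (by norm_num) hj2
  have hj0 : 0 < 1 / j := by positivity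
  have hτ : ρ / j * (4 * m) ≤ 1 / 4 := by
    have : ρ / j * (4 * m) = (1 / j) * (4 * (ρ * m)) := by ring
    rw [this]
    have : 0 ≤ ρ * m := by positivity
    nlinarith
  -- `σ` is the increment of `cost`. In the requirement of `exp_step_le`, the term `16 * ρ` comes
  -- from `4 * τ` with `τ = 4 * ρ * m / j`, the `4` from `2 * q ≤ 4 * m / j`, and the `8` from `2 *
  -- (2 * m + 2 * m) * |μ * δ|`.
  set σ := (16 * ρ + 4) * m * (1 / j) +
    8 * (μ * m) * (lifeLoss ρ s z s(u, v) + lifeLoss ρ s z s(u, w)) with hσ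
  have hstep := exp_step_le (a := μ * δ) (β := μ * P)
    (q := μ * (killRate k * (2 * (y : ℝ) ^ (-ρ)))) (σ := σ) (t := μ * (P' - P))
    (τ := ρ / j * (4 * m)) (ha.trans hm8) (hβ.trans (by linarith)) (by positivity)
    (by rw [hq]; nlinarith) ht hτ (by
      rw [hq, hσ]
      have e1 : |μ * δ| * |μ * P| ≤ |μ * δ| * (2 * m) :=
        mul_le_mul_of_nonneg_left hβ (abs_nonneg _)
      have e2 : |μ * δ| ^ 2 ≤ |μ * δ| * m := by
        rw [sq]; exact mul_le_mul_of_nonneg_left ha (abs_nonneg _)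
      have e3 : |μ * δ| * m ≤
          μ * m * (lifeLoss ρ s z s(u, v) + lifeLoss ρ s z s(u, w)) := by
        rw [abs_mul, abs_of_pos hμ0]
        have := mul_le_mul_of_nonneg_left hδ2 (mul_nonneg hμ0.le hm0.le)
        linarith
      have e4 : m * killRate k ≤ m * (1 / j) := mul_le_mul_of_nonneg_left hκj hm0.le
      have e5 : ρ / j * (4 * m) = 4 * (ρ * m * (1 / j)) := by ring
      rw [e5]
      nlinarith)
  have hcost : cost ρ u v w y (push s z) = cost ρ u v w y s + σ := by
    unfold cost
    rw [max_eq_left hew', max_eq_left hew, powSum_wt_push, powSum_wt_push, harmonicSum_push,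
      scale_mul' hy1, hσ]
    ring
  have hlead : lead ρ u v w (push s z) = lead ρ u v w s + δ := by
    unfold lead
    rw [powSum_wt_push, powSum_wt_push, hδ]; ring
  have hvis := visitCount_push_le (u := u) (w := w) (y := y) s z hz.ne
  have hpos : 0 ≤ 1 - μ * P' := by
    have := abs_scale_pot_le (k := k) (B := B) hρ hu hv hw hvw huv huw hy1 hev' hew' z
    have := (abs_le.1 this).2
    linarith
  have hexp : Real.exp (-(μ * (lead ρ u v w (push s z) - b * visitCount u w y (push s z)))
      - cost ρ u v w y (push s z)) ≤
      Real.exp (-(μ * (lead ρ u v w s - b * visitCount u w y s)) - cost ρ u v w y s) *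
      ((if s.1 = u then Real.exp (2 * (μ * b)) else 1) *
        (Real.exp (-σ) * Real.exp (-(μ * δ)))) := by
    have e : (if s.1 = u then Real.exp (2 * (μ * b)) else 1) =
        Real.exp (μ * b * if s.1 = u then 2 else 0) := by
      split_ifs
      · congr 1; ring
      · simp
    rw [e, ← Real.exp_add, ← Real.exp_add, ← Real.exp_add, hlead, hcost]
    apply Real.exp_le_exp.2
    have := mul_le_mul_of_nonneg_left hvis (mul_nonneg hμ0.le hb)
    nlinarith
  have hfac : 0 ≤ (if s.1 = u then Real.exp (2 * (μ * b)) else 1) := by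
    split_ifs
    · exact (Real.exp_pos _).le
    · exact zero_le_one
  refine (mul_le_mul_of_nonneg_right hexp hpos).trans ?_
  have e : 1 - μ * P' = 1 - μ * P - μ * (P' - P) := by ring
  rw [e, mul_assoc, mul_assoc, mul_assoc]
  refine mul_le_mul_of_nonneg_left ?_ (Real.exp_pos _).le
  exact mul_le_mul_of_nonneg_left hstep hfac

end

end Duel

/-! ### The supermartingale property under the tilted kernel -/

section Super

variable {V : Type*} {G : SimpleGraph V} [G.LocallyFinite]

theorem tiltKernel_nonneg {ρ ε : ℝ} (hε : 0 ≤ ε) (u v : V) (s : Hist V) (z : V) :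
    0 ≤ tiltKernel G ρ ε u v s z := by
  have h1 := stepKernel_nonneg G ρ s z
  have h2 := stepKernel_nonneg G ρ s v
  unfold tiltKernel
  split_ifs <;> positivity

theorem sum_stepKernel_tilt {ρ ε : ℝ} {u v : V} {s : Hist V} (hs : s.1 = u) (huv : G.Adj u v)
    (f : V → ℝ) :
    ∑ z ∈ G.neighborFinset s.1, tiltKernel G ρ ε u v s z * f z =
      (∑ z ∈ G.neighborFinset s.1, stepKernel G ρ s z * f z + ε * stepKernel G ρ s v * f v) /
        (1 + ε * stepKernel G ρ s v) := by
  classical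
  have hv : v ∈ G.neighborFinset s.1 := by rw [hs]; simpa using huv
  have : ε * stepKernel G ρ s v * f v =
      ∑ z ∈ G.neighborFinset s.1, stepKernel G ρ s z * (if z = v then ε else 0) * f z := by
    rw [Finset.sum_eq_single_of_mem v hv]
    · rw [if_pos rfl]; ring
    · intro z _ hz; simp [hz]
  rw [this, ← Finset.sum_add_distrib, Finset.sum_div]
  refine Finset.sum_congr rfl fun z _ => ?_
  unfold tiltKernel
  rw [if_pos hs]
  ring_nf

theorem sum_tiltKernel {ρ ε : ℝ} (hε : 0 ≤ ε) {u v : V} (huv : G.Adj u v) (s : Hist V)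
    {z₀ : V} (hz₀ : G.Adj s.1 z₀) :
    ∑ z ∈ G.neighborFinset s.1, tiltKernel G ρ ε u v s z = 1 := by
  by_cases hs : s.1 = u
  · have := sum_stepKernel_tilt (ρ := ρ) (ε := ε) hs huv (fun _ => 1)
    simp only [mul_one] at this
    rw [this, sum_stepKernel ρ s hz₀]
    have := stepKernel_nonneg G ρ s v
    exact div_self (by positivity)
  · have : ∀ z, tiltKernel G ρ ε u v s z = stepKernel G ρ s z := fun z => by
      simp [tiltKernel, hs]
    simp only [this]
    exact sum_stepKernel ρ s hz₀

theorem sum_tiltKernel_le {ρ ε : ℝ} (hε : 0 ≤ ε) {u v : V} (huv : G.Adj u v) (s : Hist V) :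
    ∑ z ∈ G.neighborFinset s.1, tiltKernel G ρ ε u v s z ≤ 1 := by
  by_cases h : ∃ z, G.Adj s.1 z
  · obtain ⟨z, hz⟩ := h
    exact (sum_tiltKernel hε huv s hz).le
  · rw [Finset.sum_eq_zero]
    · exact zero_le_one
    · intro y hy
      exact absurd ⟨y, by simpa using hy⟩ h

variable {ρ : ℝ} {k : ℕ} {B : Finset V} {u v w : V} {y : ℕ} {b ε : ℝ}

/-- The central cancellation. At `u` the mean lifetime losses of the two edges coincide. At `v` and
`w` they are compensated by the dipole charges in the mean change of the potential. Only the killing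
term `κ * P / W` is left, and the last summand of `linStep` covers it because `W ≥ 1`. -/
theorem sum_linStep_le (hρ : 1 < ρ) (hu : u ∈ B) (hv : v ∈ B) (hw : w ∈ B) (hvw : v ≠ w)
    (huv : G.Adj u v) (huw : G.Adj u w) (hy1 : 1 ≤ y) {s : Hist V}
    (hev : y ≤ wt s s(u, v)) (hew : y ≤ wt s s(u, w))
    (hx : s.1 ∈ B) (hN : ∀ z, G.Adj s.1 z → z ∈ B) {z₀ : V} (hz₀ : G.Adj s.1 z₀) :
    ∑ z ∈ G.neighborFinset s.1, stepKernel G ρ s z * linStep G ρ k B u v w y s z ≤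
      1 - (y : ℝ) ^ (ρ - 1 / 2) * pot G ρ (killRate k) (killRate_pos k) B v w s s.1 := by
  classical
  have hpot := abs_pot_le (by linarith) (killRate_pos k) hu hv hw hvw huv huw s hy1 hev hew s.1
  have h1 := sum_stepKernel ρ s hz₀
  have h2 : ∑ z ∈ G.neighborFinset s.1, stepKernel G ρ s z * lifeLoss ρ s z s(u, v) = _ :=
    sum_stepKernel_edge s huv
  have h3 : ∑ z ∈ G.neighborFinset s.1, stepKernel G ρ s z * lifeLoss ρ s z s(u, w) = _ :=
    sum_stepKernel_edge s huw
  have h4 := sum_stepKernel_pot (ρ := ρ) (killRate_pos k) (v := v) (w := w) s hx hN hz₀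
  have hW : 1 ≤ totalWeight G ρ s s.1 :=
    (one_le_wt_rpow (by linarith) s _).trans (wt_rpow_le_totalWeight ρ s hz₀)
  set P := pot G ρ (killRate k) (killRate_pos k) B v w s with hP
  set μ := (y : ℝ) ^ (ρ - 1 / 2) with hμ
  set H := 2 * (y : ℝ) ^ (-ρ) with hH
  set W := totalWeight G ρ s s.1
  have hκ := killRate_pos k
  have e : ∑ z ∈ G.neighborFinset s.1, stepKernel G ρ s z * linStep G ρ k B u v w y s z =
      (1 - μ * (killRate k * H)) * ∑ z ∈ G.neighborFinset s.1, stepKernel G ρ s z -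
      μ * ∑ z ∈ G.neighborFinset s.1, stepKernel G ρ s z * lifeLoss ρ s z s(u, v) +
      μ * ∑ z ∈ G.neighborFinset s.1, stepKernel G ρ s z * lifeLoss ρ s z s(u, w) -
      μ * ∑ z ∈ G.neighborFinset s.1, stepKernel G ρ s z * P z := by
    rw [Finset.mul_sum, Finset.mul_sum, Finset.mul_sum, Finset.mul_sum, ← Finset.sum_sub_distrib,
      ← Finset.sum_add_distrib, ← Finset.sum_sub_distrib]
    refine Finset.sum_congr rfl fun z _ => ?_
    unfold linStep
    ring
  rw [e, h1, h2, h3, h4]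
  have hμ0 : 0 ≤ μ := by positivity
  have h5 : -(killRate k * P s.1 / W) ≤ killRate k * H := by
    rw [neg_le_iff_add_nonneg, ← sub_neg_eq_add, sub_nonneg]
    have h6 : -(killRate k * P s.1) ≤ killRate k * H := by
      have := mul_le_mul_of_nonneg_left (neg_le_of_abs_le hpot) hκ.le
      linarith
    rw [← neg_div, div_le_iff₀ (by linarith)]
    have : 0 ≤ killRate k * H := by positivity
    nlinarith
  have h7 := mul_le_mul_of_nonneg_left h5 hμ0
  unfold dipoleCharge
  have e2 : μ * (((if s.1 = u then 1 else 0) + if s.1 = v then 1 else 0) / W) =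
      μ * ((if s.1 = u then 1 else 0) / W) + μ * ((if s.1 = v then 1 else 0) / W) := by ring
  have e3 : μ * (((if s.1 = u then 1 else 0) + if s.1 = w then 1 else 0) / W) =
      μ * ((if s.1 = u then 1 else 0) / W) + μ * ((if s.1 = w then 1 else 0) / W) := by ring
  rw [e2, e3]
  have e4 : μ * (P s.1 - ((if s.1 = v then 1 else 0) - (if s.1 = w then 1 else 0) -
      killRate k * P s.1) / W) = μ * P s.1 - μ * ((if s.1 = v then 1 else 0) / W) +
      μ * ((if s.1 = w then 1 else 0) / W) + μ * (killRate k * P s.1 / W) := by ring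
  rw [e4]
  linarith

-- The extra mass on the step to `v` gains `μ * ε / W` before normalisation, because `v` is where
-- the potential is largest and `stepKernel` at `v` times `wt ^ (-ρ)` is `1 / W`. Normalising keeps
-- at least half of this gain. The factor `exp (2 μ b) ≤ 1 + 4 μ b` costs at most `6 μ b`, which is
-- the reason for the constant `12 = 2 * 6` in `hbε`.
set_option maxHeartbeats 400000 in
theorem exp_mul_sum_tilt_linStep_le (hρ : 1 < ρ) (hu : u ∈ B) (hv : v ∈ B) (hw : w ∈ B)
    (hvw : v ≠ w) (huv : G.Adj u v) (huw : G.Adj u w) (hy1 : 1 ≤ y)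
    (hy : 8 * ρ ≤ (y : ℝ) ^ (1 / 2 : ℝ)) {s : Hist V}
    (hev : y ≤ wt s s(u, v)) (hew : y ≤ wt s s(u, w))
    (hN : ∀ z, G.Adj u z → z ∈ B) (hs : s.1 = u) (hε0 : 0 ≤ ε) (hε1 : ε ≤ 1)
    (hb : 0 ≤ b) (hbε : 12 * b * totalWeight G ρ s u ≤ ε) :
    Real.exp (2 * ((y : ℝ) ^ (ρ - 1 / 2) * b)) *
      ∑ z ∈ G.neighborFinset s.1, tiltKernel G ρ ε u v s z * linStep G ρ k B u v w y s z ≤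
      1 - (y : ℝ) ^ (ρ - 1 / 2) * pot G ρ (killRate k) (killRate_pos k) B v w s u := by
  classical
  have hy0 : (0 : ℝ) < y := by exact_mod_cast hy1
  have hsv : G.Adj s.1 v := by rw [hs]; exact huv
  have hlin := sum_linStep_le (k := k) hρ hu hv hw hvw huv huw hy1 hev hew (by rwa [hs])
    (by rwa [hs]) hsv
  rw [sum_stepKernel_tilt hs huv]
  have hscale := abs_scale_pot_le (k := k) hρ hu hv hw hvw huv huw hy1 hev hew u
  have hsrc := ((isDipole_pot G ρ (killRate k) (killRate_pos k) B v w s).le_source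
    (conductance_nonneg G ρ s) (conductance_comm G ρ s) (killRate_pos k) hv hw).2 u
  have hl1 : lifeLoss ρ s v s(u, v) = (wt s s(u, v) : ℝ) ^ (-ρ) := by simp [lifeLoss, hs]
  have hl2 : lifeLoss ρ s v s(u, w) = 0 := by
    unfold lifeLoss
    rw [if_neg]
    rw [hs]
    intro h
    rcases Sym2.eq_iff.1 h with ⟨_, h4⟩ | ⟨h3, _⟩
    · exact hvw h4
    · exact huw.ne h3
  have hlv : linStep G ρ k B u v w y s v ≤ 1 - (y : ℝ) ^ (ρ - 1 / 2) * (wt s s(u, v) : ℝ) ^ (-ρ)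
      - (y : ℝ) ^ (ρ - 1 / 2) * pot G ρ (killRate k) (killRate_pos k) B v w s u := by
    unfold linStep
    rw [hl1, hl2, sub_zero]
    have h1 : 0 ≤ (y : ℝ) ^ (ρ - 1 / 2) * (killRate k * (2 * (y : ℝ) ^ (-ρ))) := by
      have := killRate_pos k
      positivity
    have h2 := mul_le_mul_of_nonneg_left hsrc
      (by positivity : 0 ≤ (y : ℝ) ^ (ρ - 1 / 2))
    linarith
  have hpv : stepKernel G ρ s v * (wt s s(u, v) : ℝ) ^ (-ρ) = 1 / totalWeight G ρ s u := by
    unfold stepKernel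
    rw [hs, div_mul_eq_mul_div, Real.rpow_neg (by positivity),
      mul_inv_cancel₀ (wt_rpow_pos ρ s _).ne']
  have hp0 := stepKernel_nonneg G ρ s v
  have hp1 : stepKernel G ρ s v ≤ 1 :=
    (Finset.single_le_sum (f := fun z => stepKernel G ρ s z)
      (fun z _ => stepKernel_nonneg G ρ s z) (by simpa using hsv)).trans
      (sum_stepKernel_le G ρ s)
  have hW0 := totalWeight_pos ρ s huv
  have hWy : (y : ℝ) ^ ρ ≤ totalWeight G ρ s u :=
    (Real.rpow_le_rpow hy0.le (by exact_mod_cast hev) (by linarith)).trans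
      (wt_rpow_le_totalWeight ρ s huv)
  have hmρ := rpow_neg_half_le hρ hy
  have hmul : (y : ℝ) ^ (ρ - 1 / 2) * (y : ℝ) ^ (-ρ) = _ := scale_mul (ρ := ρ) hy1
  rw [hs] at hlin ⊢
  set P := pot G ρ (killRate k) (killRate_pos k) B v w s u with hP
  set μ := (y : ℝ) ^ (ρ - 1 / 2) with hμ
  set m := (y : ℝ) ^ (-(1 / 2) : ℝ) with hm
  set pv := stepKernel G ρ s v with hpvdef
  set W := totalWeight G ρ s u with hWdef
  set L := linStep G ρ k B u v w y s v
  set S := ∑ z ∈ G.neighborFinset u, stepKernel G ρ s z * linStep G ρ k B u v w y s z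
  have hμ0 : 0 < μ := by positivity
  have hm0 : 0 < m := by positivity
  have hm8 : m ≤ 1 / 8 := by nlinarith
  have hμP := abs_le.1 hscale
  have hbW : b ≤ 1 / (12 * W) := by
    rw [le_div_iff₀ (by positivity)]; linarith
  have hμb : μ * b ≤ m / 12 := by
    have h1 : b * (y : ℝ) ^ ρ ≤ 1 / 12 := by nlinarith
    have h2 : (y : ℝ) ^ ρ * (y : ℝ) ^ (-ρ) = 1 := by
      rw [← Real.rpow_add hy0]; simp
    have h3 : (0 : ℝ) < (y : ℝ) ^ (-ρ) := by positivity
    have h4 : b ≤ 1 / 12 * (y : ℝ) ^ (-ρ) := by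
      calc b = b * (y : ℝ) ^ ρ * (y : ℝ) ^ (-ρ) := by rw [mul_assoc, h2, mul_one]
        _ ≤ _ := mul_le_mul_of_nonneg_right h1 h3.le
    calc μ * b ≤ μ * (1 / 12 * (y : ℝ) ^ (-ρ)) := by gcongr
      _ = _ := by rw [← hmul]; ring
  have hμb0 : 0 ≤ μ * b := by positivity
  have hexp : Real.exp (2 * (μ * b)) ≤ 1 + 4 * (μ * b) := by
    have := Real.abs_exp_sub_one_sub_id_le (x := 2 * (μ * b))
      (by rw [abs_of_nonneg (by positivity)]; linarith)
    have := (abs_le.1 this).2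
    nlinarith
  have hden : 0 < 1 + ε * pv := by positivity
  have hnum : (S + ε * pv * L) / (1 + ε * pv) ≤ 1 - μ * P - μ * (ε / (2 * W)) := by
    rw [div_le_iff₀ hden]
    have h1 : ε * pv * L ≤ ε * pv * (1 - μ * P) - μ * (ε / W) := by
      have := mul_le_mul_of_nonneg_left hlv (by positivity : 0 ≤ ε * pv)
      calc ε * pv * L ≤ _ := this
        _ = ε * pv * (1 - μ * P) - μ * ε * (pv * (wt s s(u, v) : ℝ) ^ (-ρ)) := by ring
        _ = _ := by rw [hpv]; ring
    have h2 : μ * (ε / (2 * W)) * (1 + ε * pv) ≤ μ * (ε / W) := by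
      have : 1 + ε * pv ≤ 2 := by nlinarith
      calc μ * (ε / (2 * W)) * (1 + ε * pv) ≤ μ * (ε / (2 * W)) * 2 := by gcongr
        _ = μ * (ε / W) := by field_simp
    nlinarith
  have hrhs : 0 ≤ 1 - μ * P - μ * (ε / (2 * W)) := by
    have h1 : μ * (ε / (2 * W)) ≤ m / 2 := by
      have h2 : ε / (2 * W) ≤ (y : ℝ) ^ (-ρ) / 2 := by
        rw [Real.rpow_neg hy0.le, ← one_div, div_div]
        apply div_le_div₀ zero_le_one hε1 (by positivity)
        linarith
      calc μ * (ε / (2 * W)) ≤ μ * ((y : ℝ) ^ (-ρ) / 2) := by gcongr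
        _ = _ := by rw [← hmul]; ring
    linarith
  calc Real.exp (2 * (μ * b)) * ((S + ε * pv * L) / (1 + ε * pv))
      ≤ Real.exp (2 * (μ * b)) * (1 - μ * P - μ * (ε / (2 * W))) :=
        mul_le_mul_of_nonneg_left hnum (Real.exp_pos _).le
    _ ≤ (1 + 4 * (μ * b)) * (1 - μ * P - μ * (ε / (2 * W))) :=
        mul_le_mul_of_nonneg_right hexp hrhs
    _ ≤ 1 - μ * P := by
        have h1 : 4 * (μ * b) * (1 - μ * P) ≤ 4 * (μ * b) * (3 / 2) := by
          gcongr; linarith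
        have h2 : 6 * (μ * b) ≤ μ * (ε / (2 * W)) := by
          have : 6 * b ≤ ε / (2 * W) := by
            rw [le_div_iff₀ (by positivity)]; linarith
          nlinarith
        have h3 : 0 ≤ 4 * (μ * b) * (μ * (ε / (2 * W))) := by positivity
        nlinarith

/-- While `u w` has weight below `y`, no potential is needed: `psi` cannot increase in any step, and
its factor `2` dominates `1 - μ * pot` at the change of regime. Afterwards the step is linearised by
`psi_push_le` and averaged, with the tilt at `u` and without it elsewhere. -/
theorem psi_super (hρ : 1 < ρ) (hu : u ∈ B) (hN : ∀ z, G.Adj u z → z ∈ B) (hvw : v ≠ w)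
    (huv : G.Adj u v) (huw : G.Adj u w) (hy1 : 1 ≤ y)
    (hy : 8 * ρ ≤ (y : ℝ) ^ (1 / 2 : ℝ)) {s : Hist V}
    (hev : y ≤ wt s s(u, v)) (hx : s.1 ∈ B) (hxN : ∀ z, G.Adj s.1 z → z ∈ B)
    (hk : s.2.length ≤ k) (hε0 : 0 ≤ ε) (hε1 : ε ≤ 1)
    (hb : 0 ≤ b) (hbε : 12 * b * totalWeight G ρ s u ≤ ε) :
    ∑ z ∈ G.neighborFinset s.1, tiltKernel G ρ ε u v s z * psi G ρ k B u v w y b (push s z) ≤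
      psi G ρ k B u v w y b s := by
  classical
  have hv := hN v huv
  have hw := hN w huw
  have hmρ := rpow_neg_half_le hρ hy
  have hm0 : (0 : ℝ) < (y : ℝ) ^ (-(1 / 2) : ℝ) := by
    have : (0 : ℝ) < y := by exact_mod_cast hy1
    positivity
  have hm8 : (y : ℝ) ^ (-(1 / 2) : ℝ) ≤ 1 / 8 := by nlinarith
  by_cases hew : wt s s(u, w) < y
  · have hle : ∀ z ∈ G.neighborFinset s.1,
        psi G ρ k B u v w y b (push s z) ≤ psi G ρ k B u v w y b s := by
      intro z hz
      have hcost := cost_le_push (by linarith : 0 ≤ ρ) u v w y s z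
      have hpe := powSum_mono ρ (wt_le_push s z s(u, v))
      conv_rhs => unfold psi
      rw [if_pos hew]
      unfold psi
      have hμ : (0 : ℝ) ≤ (y : ℝ) ^ (ρ - 1 / 2) := by positivity
      split_ifs with h
      · have := mul_le_mul_of_nonneg_left hpe hμ
        gcongr 2 * ?_
        apply Real.exp_le_exp.2
        nlinarith
      -- Weights grow by one at a time, so the change of regime happens at weight exactly `y`. There
      -- `visitCount ≤ 0`, and `lead` agrees with the quantity used before the change.
      · have hgy : wt (push s z) s(u, w) = y := by
          have := wt_push_le s z s(u, w); omega
        have hpot := abs_scale_pot_le (k := k) hρ hu hv hw hvw huv huw hy1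
          (hev.trans (wt_le_push s z s(u, v))) hgy.ge z
        have hpot := abs_le.1 hpot
        have hvis : visitCount u w y (push s z) ≤ 0 := by
          unfold visitCount
          rw [hgy]
          split_ifs <;> simp
        rw [mul_comm (2 : ℝ)]
        apply mul_le_mul _ _ _ (Real.exp_pos _).le
        · apply Real.exp_le_exp.2
          have h1 : 0 ≤ - (b * visitCount u w y (push s z)) := by
            rw [← mul_neg]; exact mul_nonneg hb (by linarith)
          have h2 : powSum ρ (wt s s(u, v)) - powSum ρ y ≤
              lead ρ u v w (push s z) - b * visitCount u w y (push s z) := by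
            unfold lead; rw [hgy]; linarith
          have := mul_le_mul_of_nonneg_left h2 hμ
          linarith
        · simp only [push_fst]; linarith
        · simp only [push_fst]; linarith
    have hpos : 0 ≤ psi G ρ k B u v w y b s := by
      unfold psi; rw [if_pos hew]; positivity
    calc _ ≤ ∑ z ∈ G.neighborFinset s.1, tiltKernel G ρ ε u v s z * psi G ρ k B u v w y b s :=
          Finset.sum_le_sum fun z hz =>
            mul_le_mul_of_nonneg_left (hle z hz) (tiltKernel_nonneg hε0 u v s z)
      _ ≤ _ := by
          rw [← Finset.sum_mul]
          have := sum_tiltKernel_le (ρ := ρ) hε0 huv s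
          nlinarith
  · have hew' := not_lt.1 hew
    have hpsi : psi G ρ k B u v w y b s =
        Real.exp (-((y : ℝ) ^ (ρ - 1 / 2) * (lead ρ u v w s - b * visitCount u w y s))
        - cost ρ u v w y s) *
        (1 - (y : ℝ) ^ (ρ - 1 / 2) * pot G ρ (killRate k) (killRate_pos k) B v w s s.1) := by
      unfold psi; rw [if_neg hew]
    by_cases hne : ∃ z₀, G.Adj s.1 z₀
    · obtain ⟨z₀, hz₀⟩ := hne
      rw [hpsi]
      set E := Real.exp (-((y : ℝ) ^ (ρ - 1 / 2) * (lead ρ u v w s - b * visitCount u w y s))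
        - cost ρ u v w y s)
      set fac := (if s.1 = u then Real.exp (2 * ((y : ℝ) ^ (ρ - 1 / 2) * b)) else 1)
      calc _ ≤ ∑ z ∈ G.neighborFinset s.1, tiltKernel G ρ ε u v s z *
            (E * (fac * linStep G ρ k B u v w y s z)) :=
            Finset.sum_le_sum fun z hz => mul_le_mul_of_nonneg_left
              (psi_push_le hρ hu hv hw hvw huv huw hy1 hy hb hev hew' hx hk (by simpa using hz)
                (hxN z (by simpa using hz))) (tiltKernel_nonneg hε0 u v s z)
        _ = E * (fac * ∑ z ∈ G.neighborFinset s.1,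
            tiltKernel G ρ ε u v s z * linStep G ρ k B u v w y s z) := by
            rw [Finset.mul_sum, Finset.mul_sum]
            exact Finset.sum_congr rfl fun z _ => by ring
        _ ≤ _ := by
            refine mul_le_mul_of_nonneg_left ?_ (Real.exp_pos _).le
            by_cases hs : s.1 = u
            · have := exp_mul_sum_tilt_linStep_le (k := k) hρ hu hv hw hvw huv huw hy1 hy hev
                hew' hN hs hε0 hε1 hb hbε
              simp only [fac, if_pos hs]
              rw [hs] at this ⊢
              exact this
            · have h1 : ∀ z, tiltKernel G ρ ε u v s z = stepKernel G ρ s z := fun z => by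
                simp [tiltKernel, hs]
              simp only [fac, if_neg hs, h1, one_mul]
              exact sum_linStep_le hρ hu hv hw hvw huv huw hy1 hev hew' hx hxN hz₀
    · rw [Finset.sum_eq_zero]
      · rw [hpsi]
        have hpot := abs_scale_pot_le (k := k) hρ hu hv hw hvw huv huw hy1 hev hew' s.1
        have hpot := abs_le.1 hpot
        refine mul_nonneg (Real.exp_pos _).le ?_
        linarith
      · intro z hz
        exact absurd ⟨z, by simpa using hz⟩ hne

end Super

/-! ### Tail bounds for the lead and for the gap at a vertex -/

section Stage

variable {V : Type*} {G : SimpleGraph V} [G.LocallyFinite]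

/-- The bound on the total cost of a duel. -/
def costConst (ρ : ℝ) : ℝ := 32 * ρ + 8 + 16 * tailConst ρ

theorem psi_nonneg {ρ : ℝ} {k : ℕ} {B : Finset V} {u v w : V} {y : ℕ} {b : ℝ}
    (hρ : 1 < ρ) (hu : u ∈ B) (hN : ∀ z, G.Adj u z → z ∈ B) (hvw : v ≠ w)
    (huv : G.Adj u v) (huw : G.Adj u w) (hy1 : 1 ≤ y)
    (hy : 8 * ρ ≤ (y : ℝ) ^ (1 / 2 : ℝ)) {s : Hist V}
    (hev : y ≤ wt s s(u, v)) : 0 ≤ psi G ρ k B u v w y b s := by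
  have hmρ := rpow_neg_half_le hρ hy
  have hm0 : (0 : ℝ) ≤ (y : ℝ) ^ (-(1 / 2) : ℝ) := by positivity
  unfold psi
  split_ifs with h
  · positivity
  · have := abs_le.1 (abs_scale_pot_le (k := k) hρ hu (hN v huv) (hN w huw) hvw huv huw hy1 hev
      (not_lt.1 h) s.1)
    refine mul_nonneg (Real.exp_pos _).le ?_
    nlinarith

open Classical in
/-- In a duel of two edges, the lead of the favoured one rarely drops. -/
theorem hit_lead_le {ρ : ℝ} {k : ℕ} {B : Finset V} {u v w : V} {y : ℕ} {b ε : ℝ}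
    (hρ : 1 < ρ) (hu : u ∈ B) (hN : ∀ z, G.Adj u z → z ∈ B) (hvw : v ≠ w)
    (huv : G.Adj u v) (huw : G.Adj u w) (hy1 : 1 ≤ y)
    (hy : 8 * ρ ≤ (y : ℝ) ^ (1 / 2 : ℝ)) (hε0 : 0 ≤ ε) (hε1 : ε ≤ 1) (hb : 0 ≤ b)
    {A Q : Hist V → Prop} (hAB : ∀ s, A s → s.1 ∈ B ∧ ∀ z, G.Adj s.1 z → z ∈ B)
    (hAk : ∀ s, A s → s.2.length ≤ k) (hAH : ∀ s, A s → harmonicSum s ≤ (y : ℝ) ^ (1 / 2 : ℝ))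
    (hAW : ∀ s, A s → 12 * b * totalWeight G ρ s u ≤ ε) {s₀ : Hist V}
    (hs₀ : harmonicSum s₀ ≤ (y : ℝ) ^ (1 / 2 : ℝ) + 1)
    (hev : y ≤ wt s₀ s(u, v)) (hew : wt s₀ s(u, w) ≤ y) (θ : ℝ) (n : ℕ) :
    hit G (tiltKernel G ρ ε u v) A Q
      (fun s => if y ≤ wt s s(u, w) ∧
        lead ρ u v w s - b * ((wt s s(u, w) : ℝ) - y - 1) ≤ θ then 1 else 0) n s₀ ≤
      4 * Real.exp ((y : ℝ) ^ (ρ - 1 / 2) *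
        (θ - (powSum ρ (wt s₀ s(u, v)) - powSum ρ y)) + costConst ρ) := by
  have hy0 : (0 : ℝ) < y := by exact_mod_cast hy1
  have hmρ := rpow_neg_half_le hρ hy
  have hm0 : (0 : ℝ) < (y : ℝ) ^ (-(1 / 2) : ℝ) := by positivity
  have hm8 : (y : ℝ) ^ (-(1 / 2) : ℝ) ≤ 1 / 8 := by nlinarith
  set μ := (y : ℝ) ^ (ρ - 1 / 2) with hμ
  have hμ0 : 0 < μ := by positivity
  -- `cmin` is the part of the lifetime cost already present when both weights equal `y`. It occurs
  -- in the bound at the start and in the bound at the end, and cancels. Of the remaining cost, `32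
  -- * ρ + 8` is due to `y ^ (-1/2) * (y ^ (1/2) + 1) ≤ 2` and `16 * tailConst ρ` to the two
  -- lifetimes.
  set cmin := 8 * (y : ℝ) ^ (ρ - 1) * (2 * powSum ρ y) with hcmin
  have hcost_le : ∀ s : Hist V, harmonicSum s ≤ (y : ℝ) ^ (1 / 2 : ℝ) + 1 →
      y ≤ wt s s(u, v) → cost ρ u v w y s ≤ cmin + costConst ρ := by
    intro s hs hsv
    have h1 := powSum_sub_le hρ hy1 hsv
    have h2 := powSum_sub_le hρ hy1 (le_max_right (wt s s(u, w)) y)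
    have h3 : (y : ℝ) ^ (ρ - 1) * (y : ℝ) ^ (1 - ρ) = 1 := by
      rw [← Real.rpow_add hy0]; simp
    have h4 : (y : ℝ) ^ (-(1 / 2) : ℝ) * (y : ℝ) ^ (1 / 2 : ℝ) = 1 := by
      rw [← Real.rpow_add hy0]; simp
    have h5 : (0 : ℝ) < (y : ℝ) ^ (ρ - 1) := by positivity
    have h6 : (y : ℝ) ^ (-(1 / 2) : ℝ) * harmonicSum s ≤ 2 := by
      have := mul_le_mul_of_nonneg_left hs hm0.le
      nlinarith
    have h7 : (y : ℝ) ^ (ρ - 1) * (powSum ρ (wt s s(u, v)) + powSum ρ (max (wt s s(u, w)) y)) ≤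
        (y : ℝ) ^ (ρ - 1) * (2 * powSum ρ y) + 2 * tailConst ρ := by
      have : powSum ρ (wt s s(u, v)) + powSum ρ (max (wt s s(u, w)) y) ≤
        2 * powSum ρ y + 2 * tailConst ρ * (y : ℝ) ^ (1 - ρ) := by linarith
      have := mul_le_mul_of_nonneg_left this h5.le
      calc _ ≤ _ := this
        _ = (y : ℝ) ^ (ρ - 1) * (2 * powSum ρ y) +
            2 * tailConst ρ * ((y : ℝ) ^ (ρ - 1) * (y : ℝ) ^ (1 - ρ)) := by ring
        _ = _ := by rw [h3]; ring
    unfold cost costConst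
    rw [hcmin]
    nlinarith
  have hcost_ge : cmin ≤ cost ρ u v w y s₀ := by
    have h1 := powSum_mono ρ hev
    have h2 := powSum_mono ρ (le_max_right (wt s₀ s(u, w)) y)
    have h3 := harmonicSum_nonneg s₀
    unfold cost
    rw [hcmin]
    have h4 : 0 ≤ (16 * ρ + 4) * (y : ℝ) ^ (-(1 / 2) : ℝ) * harmonicSum s₀ := by positivity
    have h5 : (0 : ℝ) < 8 * (y : ℝ) ^ (ρ - 1) := by positivity
    have h6 := mul_le_mul_of_nonneg_left
      (by linarith : 2 * powSum ρ y ≤ powSum ρ (wt s₀ s(u, v)) +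
        powSum ρ (max (wt s₀ s(u, w)) y)) h5.le
    linarith
  have hstart : psi G ρ k B u v w y b s₀ ≤
      2 * Real.exp (-(μ * (powSum ρ (wt s₀ s(u, v)) - powSum ρ y)) - cmin) := by
    unfold psi
    split_ifs with h
    · gcongr
    · have hwy : wt s₀ s(u, w) = y := le_antisymm hew (not_lt.1 h)
      have hpot := abs_le.1 (abs_scale_pot_le (k := k) hρ hu (hN v huv) (hN w huw) hvw huv huw
        hy1 hev hwy.ge s₀.1)
      rw [mul_comm (2 : ℝ)]
      apply mul_le_mul _ _ _ (Real.exp_pos _).le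
      · apply Real.exp_le_exp.2
        have hvis : visitCount u w y s₀ ≤ 0 := by
          unfold visitCount
          rw [hwy]
          split_ifs <;> simp
        have h1 : 0 ≤ μ * (b * - visitCount u w y s₀) :=
          mul_nonneg hμ0.le (mul_nonneg hb (by linarith))
        have h2 : lead ρ u v w s₀ = powSum ρ (wt s₀ s(u, v)) - powSum ρ y := by
          unfold lead; rw [hwy]
        rw [h2]
        linarith
      · linarith
      · linarith
  have key := hit_le_of_super G (p := tiltKernel G ρ ε u v) (A := A) (Q := Q)
    (F := fun s => if y ≤ wt s s(u, w) ∧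
        lead ρ u v w s - b * ((wt s s(u, w) : ℝ) - y - 1) ≤ θ then 1 else 0)
    -- The stopped history may have just left `A`. The last step adds at most one to `harmonicSum`.
    (Inv := fun s => y ≤ wt s s(u, v) ∧ harmonicSum s ≤ (y : ℝ) ^ (1 / 2 : ℝ) + 1)
    (Ψ := fun s => 2 * Real.exp (μ * θ + (cmin + costConst ρ)) * psi G ρ k B u v w y b s)
    (fun s z => tiltKernel_nonneg hε0 u v s z)
    (by
      rintro s ⟨h1, _⟩ _ hA z _
      refine ⟨h1.trans (wt_le_push _ _ _), ?_⟩
      rw [harmonicSum_push]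
      have h2 : 1 / ((wt s s(s.1, z) : ℝ) + 1) ≤ 1 := by
        rw [div_le_one (by positivity)]
        linarith [(Nat.cast_nonneg _ : (0 : ℝ) ≤ (wt s s(s.1, z) : ℝ))]
      linarith [hAH s hA])
    (by
      rintro s ⟨h1, _⟩
      have := psi_nonneg (k := k) (b := b) hρ hu hN hvw huv huw hy1 hy h1
      positivity)
    (by
      rintro s ⟨h1, h2⟩ _
      have h0 := psi_nonneg (k := k) (b := b) hρ hu hN hvw huv huw hy1 hy h1
      split_ifs with h
      · obtain ⟨h3, h4⟩ := h
        have hpot := abs_le.1 (abs_scale_pot_le (k := k) hρ hu (hN v huv) (hN w huw) hvw huv huw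
          hy1 h1 h3 s.1)
        have hvis : (wt s s(u, w) : ℝ) - y - 1 ≤ visitCount u w y s := by
          unfold visitCount
          split_ifs <;> linarith
        have h5 : lead ρ u v w s - b * visitCount u w y s ≤ θ := by
          have := mul_le_mul_of_nonneg_left hvis hb
          linarith
        have h6 := hcost_le s h2 h1
        have h7 : Real.exp (-(μ * θ) - (cmin + costConst ρ)) * (1 / 2) ≤
            psi G ρ k B u v w y b s := by
          unfold psi
          rw [if_neg (not_lt.2 h3)]
          apply mul_le_mul _ _ (by norm_num) (Real.exp_pos _).le
          · apply Real.exp_le_exp.2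
            have := mul_le_mul_of_nonneg_left h5 hμ0.le
            linarith
          · linarith
        calc (1 : ℝ) = 2 * Real.exp (μ * θ + (cmin + costConst ρ)) *
              (Real.exp (-(μ * θ) - (cmin + costConst ρ)) * (1 / 2)) := by
              have : Real.exp (μ * θ + (cmin + costConst ρ)) *
                  Real.exp (-(μ * θ) - (cmin + costConst ρ)) = 1 := by
                rw [← Real.exp_add]; simp
              linear_combination (-1 : ℝ) * this
          _ ≤ _ := mul_le_mul_of_nonneg_left h7 (by positivity)
      · positivity)
    (by
      rintro s ⟨h1, _⟩ _ hA
      obtain ⟨h2, h3⟩ := hAB s hA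
      have := psi_super (k := k) (b := b) hρ hu hN hvw huv huw hy1 hy h1 h2 h3 (hAk s hA) hε0 hε1
        hb (hAW s hA)
      have h4 := mul_le_mul_of_nonneg_left this
        (by positivity : 0 ≤ 2 * Real.exp (μ * θ + (cmin + costConst ρ)))
      rw [Finset.mul_sum] at h4
      refine le_trans (le_of_eq ?_) h4
      exact Finset.sum_congr rfl fun z _ => by ring)
    n s₀ ⟨hev, hs₀⟩
  refine key.trans ?_
  calc 2 * Real.exp (μ * θ + (cmin + costConst ρ)) * psi G ρ k B u v w y b s₀
      ≤ 2 * Real.exp (μ * θ + (cmin + costConst ρ)) *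
        (2 * Real.exp (-(μ * (powSum ρ (wt s₀ s(u, v)) - powSum ρ y)) - cmin)) := by gcongr
    _ = 4 * (Real.exp (μ * θ + (cmin + costConst ρ)) *
        Real.exp (-(μ * (powSum ρ (wt s₀ s(u, v)) - powSum ρ y)) - cmin)) := by ring
    _ = _ := by
        rw [← Real.exp_add]
        congr 2
        ring

/-! ### The two heaviest edges at a vertex -/

/-- At least two edges at `u` have weight at least `y`. -/
def TwoHeavy (G : SimpleGraph V) (u : V) (y : ℕ) (s : Hist V) : Prop :=
  ∃ a b, a ≠ b ∧ G.Adj u a ∧ G.Adj u b ∧ y ≤ wt s s(u, a) ∧ y ≤ wt s s(u, b)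

theorem TwoHeavy.anti {u : V} {y y' : ℕ} (h : y ≤ y') {s : Hist V} (H : TwoHeavy G u y' s) :
    TwoHeavy G u y s := by
  obtain ⟨a, b, hab, ha, hb, h1, h2⟩ := H
  exact ⟨a, b, hab, ha, hb, h.trans h1, h.trans h2⟩

theorem TwoHeavy.push {u : V} {y : ℕ} {s : Hist V} (H : TwoHeavy G u y s) (z : V) :
    TwoHeavy G u y (push s z) := by
  obtain ⟨a, b, hab, ha, hb, h1, h2⟩ := H
  exact ⟨a, b, hab, ha, hb, h1.trans (wt_le_push _ _ _), h2.trans (wt_le_push _ _ _)⟩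

/-- A step raises weights by at most one, so a level is never jumped over. At the first time two
edges have weight `y`, the second heaviest weighs exactly `y`. -/
theorem not_twoHeavy_push {u : V} {y : ℕ} {s : Hist V} (H : ¬ TwoHeavy G u y s) (z : V) :
    ¬ TwoHeavy G u (y + 1) (push s z) := by
  rintro ⟨a, b, hab, ha, hb, h1, h2⟩
  have h3 := wt_push_le s z s(u, a)
  have h4 := wt_push_le s z s(u, b)
  exact H ⟨a, b, hab, ha, hb, by omega, by omega⟩

/-- The largest weight of an edge at `u`. -/
def maxWt (G : SimpleGraph V) [G.LocallyFinite] (u : V) (s : Hist V) : ℕ :=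
  (G.neighborFinset u).sup fun a => wt s s(u, a)

theorem wt_le_maxWt {u a : V} (h : G.Adj u a) (s : Hist V) : wt s s(u, a) ≤ maxWt G u s :=
  Finset.le_sup (f := fun a => wt s s(u, a)) (by simpa using h)

theorem exists_wt_eq_maxWt {u a : V} (h : G.Adj u a) (s : Hist V) :
    ∃ v, G.Adj u v ∧ wt s s(u, v) = maxWt G u s := by
  obtain ⟨v, hv, h⟩ := Finset.exists_mem_eq_sup (G.neighborFinset u) ⟨a, by simpa using h⟩
    (fun a => wt s s(u, a))
  exact ⟨v, by simpa using hv, h.symm⟩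

/-- The gap of residual lifetimes between the two heaviest edges at `u`, when the second one has
weight `y`. -/
def gap (G : SimpleGraph V) [G.LocallyFinite] (ρ : ℝ) (u : V) (y : ℕ) (s : Hist V) : ℝ :=
  powSum ρ (maxWt G u s) - powSum ρ y

theorem TwoHeavy.le_maxWt {u : V} {y : ℕ} {s : Hist V} (H : TwoHeavy G u y s) :
    y ≤ maxWt G u s := by
  obtain ⟨a, b, hab, ha, hb, h1, h2⟩ := H
  exact h1.trans (wt_le_maxWt ha s)

theorem TwoHeavy.gap_nonneg {ρ : ℝ} {u : V} {y : ℕ} {s : Hist V} (H : TwoHeavy G u y s) :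
    0 ≤ gap G ρ u y s := sub_nonneg.2 (powSum_mono ρ H.le_maxWt)

/-- At the first time at which two edges have weight `y`, the second heaviest edge has weight
exactly `y`. -/
theorem exists_top {u : V} {y : ℕ} {s : Hist V} (H : TwoHeavy G u y s)
    (H' : ¬ TwoHeavy G u (y + 1) s) : ∃ v, G.Adj u v ∧ wt s s(u, v) = maxWt G u s ∧
      y ≤ wt s s(u, v) ∧ ∀ w, G.Adj u w → v ≠ w → wt s s(u, w) ≤ y := by
  obtain ⟨a, b, hab, ha, hb, h1, h2⟩ := id H
  obtain ⟨v, hv, hmax⟩ := exists_wt_eq_maxWt ha s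
  refine ⟨v, hv, hmax, hmax ▸ H.le_maxWt, fun w hw hvw => ?_⟩
  by_contra hcon
  push Not at hcon
  exact H' ⟨v, w, hvw, hv, hw, by rw [hmax]; exact (Nat.succ_le_of_lt hcon).trans (wt_le_maxWt hw s), hcon⟩

theorem TwoHeavy.exists_ne {u v : V} {y : ℕ} {s : Hist V} (H : TwoHeavy G u y s) :
    ∃ w, G.Adj u w ∧ v ≠ w ∧ y ≤ wt s s(u, w) := by
  obtain ⟨a, b, hab, ha, hb, h1, h2⟩ := H
  by_cases h : v = a
  · exact ⟨b, hb, by rw [h]; exact hab, h2⟩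
  · exact ⟨a, ha, h, h1⟩

theorem tiltKernel_zero (ρ : ℝ) (u v : V) : tiltKernel G ρ 0 u v = stepKernel G ρ := by
  funext s z
  simp [tiltKernel]

/-- The histories up to which the estimates of a duel hold. -/
structure Alive (G : SimpleGraph V) (B : Finset V) (k : ℕ) (Λ : ℝ) (s : Hist V) : Prop where
  mem : s.1 ∈ B
  nbr : ∀ z, G.Adj s.1 z → z ∈ B
  len : s.2.length ≤ k
  harm : harmonicSum s ≤ Λ

open Classical in
/-- A large gap rarely shrinks. -/
theorem hit_gap_le {ρ : ℝ} {k D : ℕ} {B : Finset V} {u : V} {y y' : ℕ} {Λ : ℝ}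
    (hρ : 1 < ρ) (hD : G.degree u ≤ D) (hu : u ∈ B) (hN : ∀ z, G.Adj u z → z ∈ B)
    (hy1 : 1 ≤ y) (hyy : y ≤ y')
    (hy : 8 * ρ ≤ (y : ℝ) ^ (1 / 2 : ℝ)) (hΛ : Λ ≤ (y : ℝ) ^ (1 / 2 : ℝ)) {s₀ : Hist V}
    (hs₀ : harmonicSum s₀ ≤ Λ + 1) (H : TwoHeavy G u y s₀) (H' : ¬ TwoHeavy G u (y + 1) s₀)
    (a : ℝ) (n : ℕ) :
    hit G (stepKernel G ρ) (Alive G B k Λ) (TwoHeavy G u y')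
      (fun s => if gap G ρ u y' s ≤ gap G ρ u y s₀ - a / (y : ℝ) ^ (ρ - 1 / 2) then 1 else 0)
      n s₀ ≤ D * (4 * Real.exp (costConst ρ - a)) := by
  have hy0 : (0 : ℝ) < y := by exact_mod_cast hy1
  obtain ⟨v, hv, hmax, hyv, hvw⟩ := exists_top H H'
  set θ := gap G ρ u y s₀ - a / (y : ℝ) ^ (ρ - 1 / 2) with hθ
  have h1 := hit_le_hit G (p := stepKernel G ρ) (A := Alive G B k Λ) (A' := Alive G B k Λ)
    (Q := TwoHeavy G u y') (Inv := fun _ => True)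
    (F := fun s => if gap G ρ u y' s ≤ θ then 1 else 0)
    (F' := fun s => ∑ w ∈ (G.neighborFinset u).filter (fun w => v ≠ w),
      if y ≤ wt s s(u, w) ∧ lead ρ u v w s - 0 * ((wt s s(u, w) : ℝ) - y - 1) ≤ θ then 1 else 0)
    (fun s z => stepKernel_nonneg G ρ s z) (fun _ _ _ _ _ _ => trivial) (fun _ h => h)
    (fun s => Finset.sum_nonneg fun w _ => by split_ifs <;> norm_num)
    (by
      intro s _ hs
      split_ifs with hg
      -- The edge to `v` was heaviest at the start and need not be so now, but its weight is still a
      -- lower bound for `maxWt`. A small gap at level `y'` therefore forces a small lead of `v`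
      -- over some competitor `w` of weight at least `y'`, and a union bound over the competitors
      -- finishes.
      · obtain ⟨w, hw, hne, hyw⟩ := hs.exists_ne (v := v)
        refine le_trans ?_ (Finset.single_le_sum (f := fun w => if y ≤ wt s s(u, w) ∧
          lead ρ u v w s - 0 * ((wt s s(u, w) : ℝ) - y - 1) ≤ θ then (1 : ℝ) else 0)
          (fun w _ => by split_ifs <;> norm_num) (a := w) (by simpa using ⟨hw, hne⟩))
        rw [if_pos]
        refine ⟨hyy.trans hyw, ?_⟩
        have h2 := powSum_mono ρ (wt_le_maxWt hv s)
        have h3 := powSum_mono ρ hyw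
        unfold gap at hg
        unfold lead
        linarith
      · exact Finset.sum_nonneg fun w _ => by split_ifs <;> norm_num)
    n s₀ trivial
  refine h1.trans ?_
  rw [hit_sum]
  have h2 : ∀ w ∈ (G.neighborFinset u).filter (fun w => v ≠ w),
      hit G (stepKernel G ρ) (Alive G B k Λ) (TwoHeavy G u y')
      (fun s => if y ≤ wt s s(u, w) ∧
        lead ρ u v w s - 0 * ((wt s s(u, w) : ℝ) - y - 1) ≤ θ then 1 else 0) n s₀ ≤
      4 * Real.exp (costConst ρ - a) := by
    intro w hw
    obtain ⟨hw1, hw2⟩ : G.Adj u w ∧ v ≠ w := by simpa using hw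
    have := hit_lead_le (k := k) (B := B) (b := 0) (ε := 0) hρ hu hN hw2 hv hw1 hy1 hy le_rfl
      zero_le_one le_rfl (A := Alive G B k Λ) (Q := TwoHeavy G u y')
      (fun s hs => ⟨hs.mem, hs.nbr⟩) (fun s hs => hs.len) (fun s hs => hs.harm.trans hΛ)
      (fun s _ => by simp) (by linarith) hyv (hvw w hw1 hw2) θ n
    rw [tiltKernel_zero] at this
    refine this.trans (le_of_eq ?_)
    congr 2
    have : powSum ρ (wt s₀ s(u, v)) - powSum ρ y = gap G ρ u y s₀ := by
      unfold gap; rw [hmax]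
    rw [this, hθ]
    have : (y : ℝ) ^ (ρ - 1 / 2) ≠ 0 := by positivity
    field_simp
    ring
  refine (Finset.sum_le_card_nsmul _ _ _ h2).trans ?_
  rw [nsmul_eq_mul]
  refine mul_le_mul_of_nonneg_right ?_ (by positivity)
  have : ((G.neighborFinset u).filter (fun w => v ≠ w)).card ≤ D :=
    (Finset.card_filter_le _ _).trans hD
  exact_mod_cast this

end Stage

/-! ### Change of measure, and creation of a large gap -/

section Kick

variable {V : Type*} {G : SimpleGraph V} [G.LocallyFinite]

/-- The sum of the weights of the edges at `u`. -/
def degWt (G : SimpleGraph V) [G.LocallyFinite] (u : V) (s : Hist V) : ℕ :=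
  ∑ a ∈ G.neighborFinset u, wt s s(u, a)

theorem degWt_le_push (u : V) (s : Hist V) (z : V) : degWt G u s ≤ degWt G u (push s z) :=
  Finset.sum_le_sum fun _ _ => wt_le_push _ _ _

theorem degWt_lt_push {u : V} {s : Hist V} (hs : s.1 = u) {z : V} (hz : G.Adj s.1 z) :
    degWt G u s < degWt G u (push s z) := by
  refine Finset.sum_lt_sum (fun _ _ => wt_le_push _ _ _) ⟨z, by rw [← hs]; simpa using hz, ?_⟩
  rw [← hs, wt_push_self]
  exact Nat.lt_succ_self _

theorem hit_nonneg_le_one {p : Hist V → V → ℝ} {A Q : Hist V → Prop} {F : Hist V → ℝ}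
    (hp : ∀ s y, 0 ≤ p s y) (hp1 : ∀ s, ∑ y ∈ G.neighborFinset s.1, p s y ≤ 1)
    (hF : ∀ s, F s = 0 ∨ F s = 1) (n : ℕ) (s : Hist V) :
    0 ≤ hit G p A Q F n s ∧ hit G p A Q F n s ≤ 1 :=
  ⟨hit_nonneg G hp (fun s => by rcases hF s with h | h <;> simp [h]) n s,
    hit_le_const G (Inv := fun _ => True) hp (fun s _ => hp1 s) (fun _ _ _ _ _ _ => trivial)
      zero_le_one (fun s _ _ => by rcases hF s with h | h <;> simp [h]) n s trivial⟩

/-- Cauchy–Schwarz with weights `p`. In the application `r` is the likelihood ratio of the tilt in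
one step and `C` bounds its second moment. -/
theorem sq_sum_mul_le {ι : Type*} (S : Finset ι) (p r g : ι → ℝ) (hp : ∀ i ∈ S, 0 ≤ p i) {C : ℝ}
    (hC : ∑ i ∈ S, p i * r i ^ 2 ≤ C) :
    (∑ i ∈ S, p i * r i * g i) ^ 2 ≤ C * ∑ i ∈ S, p i * g i ^ 2 := by
  have h := Finset.sum_mul_sq_le_sq_mul_sq S (fun i => √(p i) * r i) (fun i => √(p i) * g i)
  have e1 : ∑ i ∈ S, √(p i) * r i * (√(p i) * g i) = ∑ i ∈ S, p i * r i * g i :=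
    Finset.sum_congr rfl fun i hi => by
      calc _ = (√(p i) * √(p i)) * r i * g i := by ring
        _ = _ := by rw [Real.mul_self_sqrt (hp i hi)]
  have e2 : ∀ f : ι → ℝ, ∑ i ∈ S, (√(p i) * f i) ^ 2 = ∑ i ∈ S, p i * f i ^ 2 := fun f =>
    Finset.sum_congr rfl fun i hi => by rw [mul_pow, Real.sq_sqrt (hp i hi)]
  rw [e1, e2, e2] at h
  exact h.trans (mul_le_mul_of_nonneg_right hC
    (Finset.sum_nonneg fun i hi => mul_nonneg (hp i hi) (sq_nonneg _)))

/-- Change of measure: an event that is likely for the tilted walk is not too unlikely for the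
original one. -/
theorem one_sub_hit_sq_le {ρ ε : ℝ} (hε : 0 ≤ ε) {u v : V} (huv : G.Adj u v)
    {A Q : Hist V → Prop} {F : Hist V → ℝ} (hF : ∀ s, F s = 0 ∨ F s = 1) {N : ℕ}
    (hN : ∀ s, A s → degWt G u s < N) (n : ℕ) (s : Hist V) :
    (1 - hit G (tiltKernel G ρ ε u v) A Q F n s) ^ 2 ≤
      (1 + ε ^ 2) ^ (N - degWt G u s) * (1 - hit G (stepKernel G ρ) A Q F n s) := by
  classical
  have hstep1 := fun s y => stepKernel_nonneg G ρ s y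
  have hstep2 := fun s => sum_stepKernel_le G ρ s
  have h1C : ∀ m : ℕ, 1 ≤ (1 + ε ^ 2) ^ m := fun m => one_le_pow₀ (by nlinarith [sq_nonneg ε])
  have triv : ∀ (m : ℕ) (x : ℝ), 0 ≤ x → x ≤ 1 → (1 - x) ^ 2 ≤ (1 + ε ^ 2) ^ m * (1 - x) := by
    intro m x h0 h1
    have := h1C m
    nlinarith
  induction n generalizing s with
  | zero =>
    by_cases h : Q s
    · rw [hit_of_mem G h, hit_of_mem G h]
      rcases hF s with h | h <;> rw [h] <;> exact triv _ _ (by norm_num) (by norm_num)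
    · rw [hit_zero_of_not G h, hit_zero_of_not G h]; exact triv _ _ le_rfl zero_le_one
  | succ n ih =>
    by_cases h : Q s
    · rw [hit_of_mem G h, hit_of_mem G h]
      rcases hF s with h | h <;> rw [h] <;> exact triv _ _ (by norm_num) (by norm_num)
    by_cases hA : A s
    swap
    · rw [hit_of_not_mem G h hA, hit_of_not_mem G h hA]; exact triv _ _ le_rfl zero_le_one
    rw [hit_succ_of_not G h hA, hit_succ_of_not G h hA]
    by_cases hne : ∃ z₀, G.Adj s.1 z₀
    swap
    · have : G.neighborFinset s.1 = ∅ := by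
        rw [Finset.eq_empty_iff_forall_notMem]
        exact fun z hz => hne ⟨z, by simpa using hz⟩
      rw [this]
      simpa using triv _ 0 le_rfl zero_le_one
    obtain ⟨z₀, hz₀⟩ := hne
    set f := fun z => hit G (stepKernel G ρ) A Q F n (push s z) with hf
    set f' := fun z => hit G (tiltKernel G ρ ε u v) A Q F n (push s z) with hf'
    have e1 : 1 - ∑ z ∈ G.neighborFinset s.1, stepKernel G ρ s z * f z =
        ∑ z ∈ G.neighborFinset s.1, stepKernel G ρ s z * (1 - f z) := by
      simp only [mul_sub, mul_one, Finset.sum_sub_distrib]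
      rw [sum_stepKernel ρ s hz₀]
    have e2 : 1 - ∑ z ∈ G.neighborFinset s.1, tiltKernel G ρ ε u v s z * f' z =
        ∑ z ∈ G.neighborFinset s.1, tiltKernel G ρ ε u v s z * (1 - f' z) := by
      simp only [mul_sub, mul_one, Finset.sum_sub_distrib]
      rw [sum_tiltKernel hε huv s hz₀]
    rw [e1, e2]
    have hf1 : ∀ z, 0 ≤ 1 - f z := fun z => by
      have := (hit_nonneg_le_one (A := A) (Q := Q) hstep1 hstep2 hF n (push s z)).2
      exact sub_nonneg.2 this
    by_cases hs : s.1 = u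
    · have hv : v ∈ G.neighborFinset s.1 := by rw [hs]; simpa using huv
      set pv := stepKernel G ρ s v
      have hpv := stepKernel_nonneg G ρ s v
      have hpv1 : pv ≤ 1 := (Finset.single_le_sum (f := fun z => stepKernel G ρ s z)
        (fun z _ => stepKernel_nonneg G ρ s z) hv).trans (sum_stepKernel_le G ρ s)
      set r : V → ℝ := fun z => (1 + if z = v then ε else 0) / (1 + ε * pv)
      have hden : 0 < 1 + ε * pv := by positivity
      have e3 : ∀ z, tiltKernel G ρ ε u v s z * (1 - f' z) =
          stepKernel G ρ s z * r z * (1 - f' z) := fun z => by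
        unfold tiltKernel; rw [if_pos hs]; simp only [r, pv]; ring
      simp only [e3]
      -- The second moment exceeds one only by `O(ε ^ 2)`, since the linear terms in `ε` cancel
      -- against the normalisation.
      have hr : ∑ z ∈ G.neighborFinset s.1, stepKernel G ρ s z * r z ^ 2 ≤ 1 + ε ^ 2 := by
        have : ∑ z ∈ G.neighborFinset s.1, stepKernel G ρ s z * r z ^ 2 =
            (1 + (2 * ε + ε ^ 2) * pv) / (1 + ε * pv) ^ 2 := by
          have e4 : ∀ z, stepKernel G ρ s z * r z ^ 2 = (stepKernel G ρ s z +
              (if z = v then (2 * ε + ε ^ 2) * stepKernel G ρ s z else 0)) /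
                (1 + ε * pv) ^ 2 := fun z => by
            simp only [r, div_pow]
            split_ifs <;> ring
          simp only [e4]
          rw [← Finset.sum_div, Finset.sum_add_distrib, sum_stepKernel ρ s hz₀,
            Finset.sum_ite_eq' _ v, if_pos hv]
        rw [this, div_le_iff₀ (by positivity)]
        have h1 : 0 ≤ ε * pv := by positivity
        have h2 : ε ^ 2 * pv ≤ ε ^ 2 := by nlinarith [sq_nonneg ε]
        nlinarith [mul_nonneg (sq_nonneg ε) (sq_nonneg (ε * pv)), mul_nonneg (sq_nonneg ε) h1]
      refine (sq_sum_mul_le _ _ _ _ (fun z _ => stepKernel_nonneg G ρ s z) hr).trans ?_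
      have hlt := hN s hA
      -- Each departure from `u` raises `degWt` and uses up one factor `1 + ε ^ 2`. On `A` at least
      -- one factor is still available.
      obtain ⟨m, hm⟩ : ∃ m, N - degWt G u s = m + 1 := ⟨N - degWt G u s - 1, by omega⟩
      rw [hm, pow_succ' (1 + ε ^ 2) m, mul_assoc]
      refine mul_le_mul_of_nonneg_left ?_ (by positivity)
      rw [Finset.mul_sum]
      refine Finset.sum_le_sum fun z hz => ?_
      have h1 := ih (push s z)
      have h2 := degWt_lt_push hs (by simpa using hz : G.Adj s.1 z)
      have h3 : (1 + ε ^ 2) ^ (N - degWt G u (push s z)) ≤ (1 + ε ^ 2) ^ m :=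
        pow_le_pow_right₀ (by nlinarith [sq_nonneg ε]) (by omega)
      have h4 := h1.trans (mul_le_mul_of_nonneg_right h3 (hf1 z))
      calc _ ≤ stepKernel G ρ s z * ((1 + ε ^ 2) ^ m * (1 - f z)) :=
            mul_le_mul_of_nonneg_left h4 (stepKernel_nonneg G ρ s z)
        _ = _ := by ring
    · have e3 : ∀ z, tiltKernel G ρ ε u v s z * (1 - f' z) =
          stepKernel G ρ s z * 1 * (1 - f' z) := fun z => by simp [tiltKernel, hs]
      simp only [e3]
      refine (sq_sum_mul_le (C := 1) _ _ (fun _ => (1 : ℝ)) _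
        (fun z _ => stepKernel_nonneg G ρ s z)
        (by simpa using (sum_stepKernel ρ s hz₀).le)).trans ?_
      rw [one_mul, Finset.mul_sum]
      refine Finset.sum_le_sum fun z hz => ?_
      have h1 := ih (push s z)
      have h2 := degWt_le_push (G := G) u s z
      have h3 : (1 + ε ^ 2) ^ (N - degWt G u (push s z)) ≤ (1 + ε ^ 2) ^ (N - degWt G u s) :=
        pow_le_pow_right₀ (by nlinarith [sq_nonneg ε]) (by omega)
      have h4 := h1.trans (mul_le_mul_of_nonneg_right h3 (hf1 z))
      calc _ ≤ stepKernel G ρ s z * ((1 + ε ^ 2) ^ (N - degWt G u s) * (1 - f z)) :=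
            mul_le_mul_of_nonneg_left h4 (stepKernel_nonneg G ρ s z)
        _ = _ := by ring

theorem degWt_le {D y : ℕ} {u : V} (hD : G.degree u ≤ D) {s : Hist V} (h : maxWt G u s ≤ y) :
    degWt G u s ≤ D * y := by
  calc degWt G u s ≤ (G.neighborFinset u).card • y :=
        Finset.sum_le_card_nsmul _ _ _ fun a ha => (wt_le_maxWt (by simpa using ha) s).trans h
    _ ≤ D * y := by rw [smul_eq_mul]; exact Nat.mul_le_mul_right _ hD

theorem totalWeight_le {ρ : ℝ} (hρ : 0 ≤ ρ) {D y : ℕ} {u : V} (hD : G.degree u ≤ D) {s : Hist V}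
    (h : maxWt G u s ≤ y) : totalWeight G ρ s u ≤ D * (y : ℝ) ^ ρ := by
  calc totalWeight G ρ s u ≤ (G.neighborFinset u).card • (y : ℝ) ^ ρ :=
        Finset.sum_le_card_nsmul _ _ _ fun a ha =>
          Real.rpow_le_rpow (by positivity)
            (by exact_mod_cast (wt_le_maxWt (by simpa using ha) s).trans h) hρ
    _ ≤ D * (y : ℝ) ^ ρ := by
        rw [nsmul_eq_mul]
        exact mul_le_mul_of_nonneg_right (by exact_mod_cast hD) (by positivity)

/-- Additional killing loses nothing where the expected future reward is already zero. -/
theorem hit_le_hit_of_kill {p : Hist V → V → ℝ} {A A' Q : Hist V → Prop} {F : Hist V → ℝ}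
    (hp : ∀ s y, 0 ≤ p s y) (hF : ∀ s, 0 ≤ F s)
    (h : ∀ s, A s → ¬ A' s → ∀ m, hit G p A Q F m s ≤ 0) (n : ℕ) (s : Hist V) :
    hit G p A Q F n s ≤ hit G p A' Q F n s := by
  induction n generalizing s with
  | zero =>
    by_cases hQ : Q s
    · rw [hit_of_mem G hQ, hit_of_mem G hQ]
    · rw [hit_zero_of_not G hQ, hit_zero_of_not G hQ]
  | succ n ih =>
    by_cases hQ : Q s
    · rw [hit_of_mem G hQ, hit_of_mem G hQ]
    by_cases hA : A s
    · by_cases hA' : A' s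
      · rw [hit_succ_of_not G hQ hA, hit_succ_of_not G hQ hA']
        exact Finset.sum_le_sum fun z _ => mul_le_mul_of_nonneg_left (ih _) (hp _ _)
      · exact (h s hA hA' _).trans (hit_nonneg G hp hF _ _)
    · rw [hit_of_not_mem G hQ hA]
      exact hit_nonneg G hp hF _ _

theorem maxWt_le_push (u : V) (s : Hist V) (z : V) : maxWt G u s ≤ maxWt G u (push s z) :=
  Finset.sup_mono_fun fun _ _ => wt_le_push _ _ _

end Kick

section Kick

variable {V : Type*} {G : SimpleGraph V} [G.LocallyFinite]

theorem costConst_pos {ρ : ℝ} (hρ : 1 < ρ) : 0 < costConst ρ := by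
  have := tailConst_pos hρ
  unfold costConst
  linarith

/-- At a scale at which the largest weight has doubled, the gap is large. -/
theorem lt_gap_of_le_maxWt {ρ : ℝ} (hρ : 1 < ρ) {K : ℝ} {y : ℕ} (hy1 : 1 ≤ y)
    (hK : K * (4 : ℝ) ^ ρ < (y : ℝ) ^ (1 / 2 : ℝ)) {u : V} {s : Hist V}
    (h : 4 * y ≤ maxWt G u s) : K / (y : ℝ) ^ (ρ - 1 / 2) < gap G ρ u (2 * y) s := by
  have hy0 : (0 : ℝ) < y := by exact_mod_cast hy1
  have h1 := le_powSum_sub (ρ := ρ) (by linarith) (a := 2 * y) (b := 4 * y) (by omega) (by omega)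
  have h2 := powSum_mono ρ h
  unfold gap
  refine lt_of_lt_of_le ?_ (h1.trans (sub_le_sub_right h2 _))
  push_cast
  rw [Real.rpow_sub hy0, Real.rpow_neg (by positivity), Real.mul_rpow (by norm_num) hy0.le]
  have hY : (y : ℝ) = (y : ℝ) ^ (1 / 2 : ℝ) * (y : ℝ) ^ (1 / 2 : ℝ) := by
    rw [← Real.rpow_add hy0]; norm_num
  set Y := (y : ℝ) ^ (1 / 2 : ℝ) with hYd
  have hY0 : 0 < Y := by positivity
  set P := (y : ℝ) ^ ρ with hP
  have hP0 : 0 < P := by positivity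
  have h4 : (0 : ℝ) < 4 ^ ρ := by positivity
  have e : (4 * (y : ℝ) - 2 * y) * ((4 : ℝ) ^ ρ * P)⁻¹ = (2 * (Y * Y)) / (4 ^ ρ * P) := by
    rw [← hY]; field_simp; ring
  rw [e, lt_div_iff₀ (by positivity)]
  have : K / (P / Y) * (4 ^ ρ * P) = K * 4 ^ ρ * Y := by field_simp
  rw [this]
  nlinarith

set_option maxHeartbeats 1000000 in
open Classical in
/-- From any configuration, the gap becomes large at the next scale with positive probability. -/
theorem exists_kick {ρ : ℝ} (hρ : 1 < ρ) (D : ℕ) (K : ℝ) : ∃ c : ℝ, 0 < c ∧ ∃ y₀ : ℕ,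
    ∀ (y : ℕ) (_ : y₀ ≤ y) (u : V) (_ : G.degree u ≤ D) (B : Finset V) (k : ℕ) (Λ : ℝ)
      (_ : u ∈ B) (_ : ∀ z, G.Adj u z → z ∈ B) (_ : Λ ≤ (y : ℝ) ^ (1 / 2 : ℝ)) (s₀ : Hist V)
      (_ : harmonicSum s₀ ≤ Λ + 1) (_ : TwoHeavy G u y s₀) (_ : ¬ TwoHeavy G u (y + 1) s₀)
      (n : ℕ),
      hit G (stepKernel G ρ) (Alive G B k Λ) (TwoHeavy G u (2 * y))
        (fun s => if gap G ρ u (2 * y) s ≤ K / (y : ℝ) ^ (ρ - 1 / 2) then 1 else 0) n s₀ ≤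
      1 - c := by
  set D' : ℝ := D + 1 with hD'
  have hD'0 : 0 < D' := by positivity
  have hcc := costConst_pos hρ
  have h4 : (0 : ℝ) < 4 ^ ρ := by positivity
  have hlog : 0 ≤ Real.log (8 * D') := Real.log_nonneg (by
    have : (0 : ℝ) ≤ D := by positivity
    rw [hD']; linarith)
  -- In natural units the tilt gains `lam / (12 * D' * 4 ^ ρ) * (y - 1) / y`, at least half of `2 *
  -- (|K| + costConst ρ + log (8 * D'))`. This beats `K`, the cost of the duel, and the union bound
  -- over at most `D'` competitors.
  set lam : ℝ := 24 * D' * 4 ^ ρ * (|K| + costConst ρ + Real.log (8 * D')) with hlam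
  have hlam0 : 0 ≤ lam := by positivity
  refine ⟨1 / 4 * Real.exp (-(lam ^ 2 * (4 * D + 1))), by positivity,
    ⌈(8 * ρ + lam + |K| * 4 ^ ρ + 2) ^ 2⌉₊, ?_⟩
  intro y hy₀ u hDu B k Λ hu hN hΛ s₀ hs₀ H H' n
  have hX : 8 * ρ + lam + |K| * 4 ^ ρ + 2 ≤ (y : ℝ) ^ (1 / 2 : ℝ) := by
    rw [← Real.sqrt_eq_rpow]
    exact Real.le_sqrt_of_sq_le ((Nat.le_ceil _).trans (by exact_mod_cast hy₀))
  have hKn : 0 ≤ |K| * 4 ^ ρ := by positivity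
  have hY1 : 2 ≤ (y : ℝ) ^ (1 / 2 : ℝ) := by linarith
  have hyn : y ≠ 0 := by
    rintro rfl
    rw [Nat.cast_zero, Real.zero_rpow (by norm_num)] at hY1
    linarith
  have hy1 : 1 ≤ y := Nat.one_le_iff_ne_zero.2 hyn
  have hy0 : (0 : ℝ) < y := by exact_mod_cast hy1
  have hYY : (y : ℝ) = (y : ℝ) ^ (1 / 2 : ℝ) * (y : ℝ) ^ (1 / 2 : ℝ) := by
    rw [← Real.rpow_add hy0]; norm_num
  have hμ : (y : ℝ) ^ (ρ - 1 / 2) = (y : ℝ) ^ ρ / (y : ℝ) ^ (1 / 2 : ℝ) := Real.rpow_sub hy0 _ _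
  set Y := (y : ℝ) ^ (1 / 2 : ℝ) with hYd
  have hY0 : 0 < Y := by positivity
  set P := (y : ℝ) ^ ρ with hP
  have hP0 : 0 < P := by positivity
  -- With `ε` of order `y ^ (-1/2)`, the product of `ε ^ 2` and the `O(D * y)` departures from `u`
  -- is bounded. Then `b` is chosen as large as `12 * b * totalWeight ≤ ε` permits when the weights
  -- at `u` are below `4 * y`.
  set ε := lam / Y with hε
  have hε0 : 0 ≤ ε := by positivity
  have hε1 : ε ≤ 1 := by rw [hε, div_le_one hY0]; linarith
  set b := ε / (12 * D' * (4 ^ ρ * P)) with hb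
  have hb0 : 0 ≤ b := by positivity
  set F : Hist V → ℝ := fun s =>
    if gap G ρ u (2 * y) s ≤ K / (y : ℝ) ^ (ρ - 1 / 2) then 1 else 0 with hF
  have hF01 : ∀ s, F s = 0 ∨ F s = 1 := fun s => by simp only [hF]; split_ifs <;> simp
  have hF0 : ∀ s, 0 ≤ F s := fun s => by rcases hF01 s with h | h <;> simp [h]
  have hKlt : K * (4 : ℝ) ^ ρ < Y := by
    have := mul_le_mul_of_nonneg_right (le_abs_self K) h4.le
    linarith
  -- The change of measure needs bounded weights at `u`. Killing when an edge reaches weight `4 * y`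
  -- is free, because the gap at level `2 * y` is then large in any case.
  set A' : Hist V → Prop := fun s => Alive G B k Λ s ∧ maxWt G u s < 4 * y with hA'
  have hkill : hit G (stepKernel G ρ) (Alive G B k Λ) (TwoHeavy G u (2 * y)) F n s₀ ≤
      hit G (stepKernel G ρ) (fun s => Alive G B k Λ s ∧ maxWt G u s < 4 * y)
        (TwoHeavy G u (2 * y)) F n s₀ := by
    refine hit_le_hit_of_kill (fun s z => stepKernel_nonneg G ρ s z) hF0 ?_ n s₀
    intro s hAs hs m
    have hmax : 4 * y ≤ maxWt G u s := by
      by_contra hcon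
      exact hs ⟨hAs, by omega⟩
    refine hit_le_const G (Inv := fun s => 4 * y ≤ maxWt G u s)
      (fun s z => stepKernel_nonneg G ρ s z) (fun s _ => sum_stepKernel_le G ρ s)
      (fun s h _ _ z _ => h.trans (maxWt_le_push u s z)) le_rfl (fun s h _ => ?_) m s hmax
    simp only [hF]
    rw [if_neg (not_le.2 (lt_gap_of_le_maxWt hρ hy1 hKlt h))]
  obtain ⟨v, hv, hmax, hyv, hvw⟩ := exists_top H H'
  set q := hit G (tiltKernel G ρ ε u v) A' (TwoHeavy G u (2 * y)) F n s₀ with hq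
  have hCS := one_sub_hit_sq_le (G := G) (ρ := ρ) hε0 hv (A := A') (Q := TwoHeavy G u (2 * y))
    hF01 (N := 4 * D * y + 1)
    (fun s hs => by
      have := degWt_le hDu hs.2.le
      have e : D * (4 * y) = 4 * D * y := by ring
      omega) n s₀
  -- When a competitor has risen from `y` to `2 * y`, the accumulated drift is at least `b * (y -
  -- 1)`. Each competitor fails with probability at most `4 * exp (-log (8 * D')) = 1 / (2 * D')`
  -- under the tilt.
  have hq2 : q ≤ 1 / 2 := by
    set θ := K / (y : ℝ) ^ (ρ - 1 / 2) - b * (y - 1) with hθ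
    have h1 := hit_le_hit G (p := tiltKernel G ρ ε u v) (A := A') (A' := A')
      (Q := TwoHeavy G u (2 * y)) (Inv := fun _ => True) (F := F)
      (F' := fun s => ∑ w ∈ (G.neighborFinset u).filter (fun w => v ≠ w),
        if y ≤ wt s s(u, w) ∧ lead ρ u v w s - b * ((wt s s(u, w) : ℝ) - y - 1) ≤ θ
          then 1 else 0)
      (fun s z => tiltKernel_nonneg hε0 u v s z) (fun _ _ _ _ _ _ => trivial) (fun _ h => h)
      (fun s => Finset.sum_nonneg fun w _ => by split_ifs <;> norm_num)
      (by
        intro s _ hs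
        simp only [hF]
        split_ifs with hg
        · obtain ⟨w, hw, hne, hyw⟩ := hs.exists_ne (v := v)
          refine le_trans ?_ (Finset.single_le_sum (f := fun w => if y ≤ wt s s(u, w) ∧
            lead ρ u v w s - b * ((wt s s(u, w) : ℝ) - y - 1) ≤ θ then (1 : ℝ) else 0)
            (fun w _ => by split_ifs <;> norm_num) (a := w) (by simpa using ⟨hw, hne⟩))
          rw [if_pos]
          refine ⟨by omega, ?_⟩
          have h2 := powSum_mono ρ (wt_le_maxWt hv s)
          have h3 := powSum_mono ρ hyw
          have h4 : (2 * y : ℝ) ≤ wt s s(u, w) := by exact_mod_cast hyw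
          have h5 : b * (y - 1) ≤ b * ((wt s s(u, w) : ℝ) - y - 1) :=
            mul_le_mul_of_nonneg_left (by linarith) hb0
          unfold gap at hg
          unfold lead
          rw [hθ]
          linarith
        · exact Finset.sum_nonneg fun w _ => by split_ifs <;> norm_num)
      n s₀ trivial
    refine h1.trans ?_
    rw [hit_sum]
    have h2 : ∀ w ∈ (G.neighborFinset u).filter (fun w => v ≠ w),
        hit G (tiltKernel G ρ ε u v) A' (TwoHeavy G u (2 * y))
        (fun s => if y ≤ wt s s(u, w) ∧
          lead ρ u v w s - b * ((wt s s(u, w) : ℝ) - y - 1) ≤ θ then 1 else 0) n s₀ ≤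
        1 / (2 * D') := by
      intro w hw
      obtain ⟨hw1, hw2⟩ : G.Adj u w ∧ v ≠ w := by simpa using hw
      have hle := hit_lead_le (k := k) (B := B) (b := b) (ε := ε) hρ hu hN hw2 hv hw1 hy1
        (by linarith) hε0 hε1 hb0 (A := A') (Q := TwoHeavy G u (2 * y))
        (fun s hs => ⟨hs.1.mem, hs.1.nbr⟩) (fun s hs => hs.1.len)
        (fun s hs => hs.1.harm.trans hΛ)
        (fun s hs => by
          have h := totalWeight_le (ρ := ρ) (by linarith) hDu hs.2.le
          push_cast at h
          rw [Real.mul_rpow (by norm_num) hy0.le] at h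
          have hD1 : (D : ℝ) * (4 ^ ρ * P) ≤ D' * (4 ^ ρ * P) :=
            mul_le_mul_of_nonneg_right (by rw [hD']; linarith) (by positivity)
          calc 12 * b * totalWeight G ρ s u ≤ 12 * b * (D' * (4 ^ ρ * P)) :=
                mul_le_mul_of_nonneg_left (h.trans hD1) (by positivity)
            _ = ε := by rw [hb]; field_simp) (by linarith) hyv (hvw w hw1 hw2) θ n
      refine hle.trans ?_
      have hd := sub_nonneg.2 (powSum_mono ρ hyv)
      have hexp : (y : ℝ) ^ (ρ - 1 / 2) * (θ - (powSum ρ (wt s₀ s(u, v)) - powSum ρ y)) +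
          costConst ρ ≤ -Real.log (8 * D') := by
        rw [hθ, hμ]
        have e1 : P / Y * (K / (P / Y) - b * (y - 1) - (powSum ρ (wt s₀ s(u, v)) - powSum ρ y)) =
          K - lam / (12 * D' * 4 ^ ρ) * ((y - 1) / (Y * Y)) -
            P / Y * (powSum ρ (wt s₀ s(u, v)) - powSum ρ y) := by
          rw [hb, hε]; field_simp
        rw [e1, ← hYY]
        have e2 : lam / (12 * D' * 4 ^ ρ) = 2 * (|K| + costConst ρ + Real.log (8 * D')) := by
          rw [hlam]; field_simp; ring
        rw [e2]
        have h6 : 0 ≤ P / Y * (powSum ρ (wt s₀ s(u, v)) - powSum ρ y) := by positivity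
        have h7 : (1 : ℝ) / 2 ≤ (y - 1) / y := by
          rw [div_le_div_iff₀ (by norm_num) hy0]
          nlinarith
        have h8 := le_abs_self K
        have h9 : (|K| + costConst ρ + Real.log (8 * D')) * 1 ≤
            (|K| + costConst ρ + Real.log (8 * D')) * (2 * ((y - 1) / y)) :=
          mul_le_mul_of_nonneg_left (by linarith) (by positivity)
        linarith
      calc _ ≤ 4 * Real.exp (-Real.log (8 * D')) := by gcongr
        _ = _ := by
          rw [Real.exp_neg, Real.exp_log (by positivity)]; field_simp; norm_num
    refine (Finset.sum_le_card_nsmul _ _ _ h2).trans ?_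
    rw [nsmul_eq_mul]
    have h10 : (((G.neighborFinset u).filter (fun w => v ≠ w)).card : ℝ) ≤ D' := by
      have : ((G.neighborFinset u).filter (fun w => v ≠ w)).card ≤ D :=
        (Finset.card_filter_le _ _).trans hDu
      have : (((G.neighborFinset u).filter (fun w => v ≠ w)).card : ℝ) ≤ D := by exact_mod_cast this
      rw [hD']; linarith
    calc _ ≤ D' * (1 / (2 * D')) := mul_le_mul_of_nonneg_right h10 (by positivity)
      _ = 1 / 2 := by field_simp
  have h01 := hit_nonneg_le_one (A := A') (Q := TwoHeavy G u (2 * y))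
    (fun s z => stepKernel_nonneg G ρ s z) (fun s => sum_stepKernel_le G ρ s) hF01 n s₀
  have hpow : (1 + ε ^ 2) ^ (4 * D * y + 1 - degWt G u s₀) ≤ Real.exp (lam ^ 2 * (4 * D + 1)) := by
    calc (1 + ε ^ 2) ^ (4 * D * y + 1 - degWt G u s₀) ≤ (1 + ε ^ 2) ^ (4 * D * y + 1) :=
          pow_le_pow_right₀ (by nlinarith [sq_nonneg ε]) (Nat.sub_le _ _)
      _ ≤ Real.exp (ε ^ 2) ^ (4 * D * y + 1) := by
          gcongr
          rw [add_comm]; exact Real.add_one_le_exp _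
      _ = Real.exp (ε ^ 2 * (4 * D * y + 1)) := by
          rw [← Real.exp_nat_mul]; push_cast; ring_nf
      _ ≤ _ := by
          refine Real.exp_le_exp.2 ?_
          have e : ε ^ 2 * (4 * D * y + 1) = lam ^ 2 * (4 * D * (y / (Y * Y)) + 1 / (Y * Y)) := by
            rw [hε]; field_simp
          rw [e, ← hYY, div_self hy0.ne']
          have : 1 / (y : ℝ) ≤ 1 := by rw [div_le_one hy0]; exact_mod_cast hy1
          exact mul_le_mul_of_nonneg_left (by linarith) (sq_nonneg _)
  have hfin := hCS.trans (mul_le_mul_of_nonneg_right hpow (sub_nonneg.2 h01.2))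
  have h14 : (1 : ℝ) / 4 ≤ (1 - q) ^ 2 := by nlinarith
  have h15 := mul_le_mul_of_nonneg_left (h14.trans hfin)
    (Real.exp_pos (-(lam ^ 2 * (4 * D + 1)))).le
  rw [← mul_assoc, ← Real.exp_add, neg_add_cancel, Real.exp_zero, one_mul] at h15
  linarith

end Kick

/-! ### Contraction along dyadic levels -/

section Phases

variable {V : Type*} {G : SimpleGraph V} [G.LocallyFinite]

/-- The second largest weight at `u` is exactly `y`. -/
structure AtLevel (G : SimpleGraph V) (u : V) (y : ℕ) (Λ : ℝ) (s : Hist V) : Prop where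
  two : TwoHeavy G u y s
  not_two : ¬ TwoHeavy G u (y + 1) s
  harm : harmonicSum s ≤ Λ + 1

theorem Alive.harmonicSum_push_le {B : Finset V} {k : ℕ} {Λ : ℝ} {s : Hist V}
    (h : Alive G B k Λ s) (z : V) : harmonicSum (push s z) ≤ Λ + 1 := by
  rw [harmonicSum_push]
  have h1 := h.harm
  have h2 : 1 / ((wt s s(s.1, z) : ℝ) + 1) ≤ 1 := by
    rw [div_le_one (by positivity)]
    have : (0 : ℝ) ≤ wt s s(s.1, z) := by positivity
    linarith
  linarith

/-- The strong Markov property at the first time at which a level is reached. -/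
theorem hit_le_hit_atLevel {ρ Λ : ℝ} {B : Finset V} {k : ℕ} {u : V} {y' : ℕ}
    {Q : Hist V → Prop} {F g : Hist V → ℝ} (hF : ∀ s, 0 ≤ F s) (hg : ∀ s, 0 ≤ g s)
    (hQ : ∀ s, Q s → TwoHeavy G u y' s) (n : ℕ) {s : Hist V}
    (hs : ¬ TwoHeavy G u (y' + 1) s) (hs' : harmonicSum s ≤ Λ + 1)
    (h : ∀ t, AtLevel G u y' Λ t → hit G (stepKernel G ρ) (Alive G B k Λ) Q F n t ≤ g t) :
    hit G (stepKernel G ρ) (Alive G B k Λ) Q F n s ≤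
      hit G (stepKernel G ρ) (Alive G B k Λ) (TwoHeavy G u y') g n s := by
  have hp := fun s z => stepKernel_nonneg G ρ s z
  refine (hit_le_hit_hit G hp hF hQ n s).trans ?_
  exact hit_le_hit G (Inv := fun t => ¬ TwoHeavy G u (y' + 1) t ∧ harmonicSum t ≤ Λ + 1) hp
    (fun t _ h1 h2 z _ => ⟨not_twoHeavy_push h1 z, h2.harmonicSum_push_le z⟩) (fun _ h => h) hg
    (fun t h1 h2 => h t ⟨h2, h1.1, h1.2⟩) n s ⟨hs, hs'⟩

/-- The gap in its natural unit. -/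
def relGap (G : SimpleGraph V) [G.LocallyFinite] (ρ : ℝ) (u : V) (y : ℕ) (s : Hist V) : ℝ :=
  (y : ℝ) ^ (ρ - 1 / 2) * gap G ρ u y s

open Classical in
/-- The Lyapunov function of the evolution of the relative gap along dyadic levels. -/
def gapLyap (G : SimpleGraph V) [G.LocallyFinite] (ρ K : ℝ) (u : V) (y : ℕ) (s : Hist V) : ℝ :=
  if relGap G ρ u y s ≤ K then 1 else K / (2 * relGap G ρ u y s)

theorem gapLyap_nonneg {ρ K : ℝ} (hK : 0 < K) (u : V) (y : ℕ) (s : Hist V) :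
    0 ≤ gapLyap G ρ K u y s := by
  unfold gapLyap
  split_ifs with h
  · exact zero_le_one
  · exact div_nonneg hK.le (by linarith)

theorem gapLyap_le_half {ρ K : ℝ} (hK : 0 < K) {u : V} {y : ℕ} {s : Hist V}
    (h : K < relGap G ρ u y s) : gapLyap G ρ K u y s ≤ 1 / 2 := by
  unfold gapLyap
  rw [if_neg (not_le.2 h), div_le_div_iff₀ (by linarith) (by norm_num)]
  linarith

theorem gapLyap_le_one {ρ K : ℝ} (hK : 0 < K) (u : V) (y : ℕ) (s : Hist V) :
    gapLyap G ρ K u y s ≤ 1 := by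
  by_cases h : relGap G ρ u y s ≤ K
  · unfold gapLyap; rw [if_pos h]
  · linarith [gapLyap_le_half hK (not_le.1 h)]

theorem gapLyap_le_of_lt {ρ K r : ℝ} (hK : 0 < K) {u : V} {y : ℕ} {s : Hist V} (hKr : K ≤ r)
    (h : r < relGap G ρ u y s) : gapLyap G ρ K u y s ≤ K / (2 * r) := by
  unfold gapLyap
  rw [if_neg (not_le.2 (hKr.trans_lt h))]
  gcongr
  linarith

theorem hit_le_add {p : Hist V → V → ℝ} {A Q : Hist V → Prop} {F F' : Hist V → ℝ} {c d : ℝ}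
    (hp : ∀ s y, 0 ≤ p s y) (hp1 : ∀ s, ∑ y ∈ G.neighborFinset s.1, p s y ≤ 1) (hc : 0 ≤ c)
    (hd : 0 ≤ d) (hF' : ∀ s, 0 ≤ F' s) (h : ∀ s, F s ≤ c + d * F' s) (n : ℕ) (s : Hist V) :
    hit G p A Q F n s ≤ c + d * hit G p A Q F' n s := by
  have h1 := hit_le_hit G (p := p) (A := A) (A' := A) (Q := Q) (Inv := fun _ => True) (F := F)
    (F' := fun s => c + d * F' s) hp (fun _ _ _ _ _ _ => trivial) (fun _ h => h)
    (fun s => add_nonneg hc (mul_nonneg hd (hF' s))) (fun s _ _ => h s) n s trivial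
  refine h1.trans ?_
  rw [hit_add, hit_const_mul]
  refine add_le_add_left ?_ _
  exact hit_le_const G (Inv := fun _ => True) hp (fun s _ => hp1 s)
    (fun _ _ _ _ _ _ => trivial) hc (fun _ _ _ => le_rfl) n s trivial

-- If the relative gap is at most `K`, the kick lowers the Lyapunov function from `1` to at most `1
-- / 2` with probability at least `c`. If it is `r > K`, then unless the gap loses the fraction `η =
-- 1 - 2 ^ (1 - ρ)`, the change of unit multiplies it by at least `2 ^ (ρ - 1/2) * 2 ^ (1 - ρ) = √2
-- ≥ 7/5`. The exceptional event has probability at most `1/5` of the current value, and `5/7 + 1/5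
-- < 19/20`.
open Classical in
theorem exists_hit_gapLyap_le {ρ : ℝ} (hρ : 1 < ρ) (D : ℕ) : ∃ K : ℝ, 1 ≤ K ∧ ∃ θ : ℝ, 0 < θ ∧
    θ < 1 ∧ ∃ y₀ : ℕ, ∀ (y : ℕ) (_ : y₀ ≤ y) (u : V) (_ : G.degree u ≤ D) (B : Finset V) (k : ℕ)
      (Λ : ℝ) (_ : u ∈ B) (_ : ∀ z, G.Adj u z → z ∈ B) (_ : Λ ≤ (y : ℝ) ^ (1 / 2 : ℝ))
      (s₀ : Hist V) (_ : AtLevel G u y Λ s₀) (n : ℕ),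
      hit G (stepKernel G ρ) (Alive G B k Λ) (TwoHeavy G u (2 * y)) (gapLyap G ρ K u (2 * y)) n s₀
        ≤ θ * gapLyap G ρ K u y s₀ := by
  set η : ℝ := 1 - 2 ^ (1 - ρ) with hη
  have hη0 : 0 < η := by
    rw [hη, sub_pos]
    exact Real.rpow_lt_one_of_one_lt_of_neg (by norm_num) (by linarith)
  -- Chosen so that `4 * (D + 1) * exp (costConst ρ) * 2 / (η * r) ^ 2` equals `(1/5) * (C / (2 *
  -- r)) * (1 / r)`.
  set C : ℝ := 80 * (D + 1) * Real.exp (costConst ρ) / η ^ 2 with hC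
  have hC0 : 0 < C := by positivity
  set K : ℝ := C + 1 with hK
  have hK1 : 1 ≤ K := by linarith
  obtain ⟨c, hc, y₁, hkick⟩ := exists_kick (V := V) (G := G) hρ D K
  refine ⟨K, hK1, max (1 - c / 2) (19 / 20), lt_max_of_lt_right (by norm_num),
    max_lt (by linarith) (by norm_num), max y₁ ⌈(8 * ρ + 1) ^ 2⌉₊, ?_⟩
  intro y hy u hDu B k Λ hu hN hΛ s₀ hs₀ n
  have hX : 8 * ρ + 1 ≤ (y : ℝ) ^ (1 / 2 : ℝ) := by
    rw [← Real.sqrt_eq_rpow]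
    exact Real.le_sqrt_of_sq_le ((Nat.le_ceil _).trans
      (by exact_mod_cast (le_max_right _ _).trans hy))
  have hyn : y ≠ 0 := by
    rintro rfl
    rw [Nat.cast_zero, Real.zero_rpow (by norm_num)] at hX
    linarith
  have hy1 : 1 ≤ y := Nat.one_le_iff_ne_zero.2 hyn
  have hy0 : (0 : ℝ) < y := by exact_mod_cast hy1
  have hK0 : 0 < K := by linarith
  have hp := fun (s : Hist V) z => stepKernel_nonneg G ρ s z
  have hp1 := fun (s : Hist V) => sum_stepKernel_le G ρ s
  set μ := (y : ℝ) ^ (ρ - 1 / 2) with hμ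
  have hμ0 : 0 < μ := by positivity
  have hrel : ∀ s, relGap G ρ u (2 * y) s = 2 ^ (ρ - 1 / 2) * (μ * gap G ρ u (2 * y) s) := by
    intro s
    unfold relGap
    push_cast
    rw [Real.mul_rpow (by norm_num) hy0.le, mul_assoc]
  have h2ρ : (1 : ℝ) ≤ 2 ^ (ρ - 1 / 2) := Real.one_le_rpow (by norm_num) (by linarith)
  have hpos := hs₀.two.gap_nonneg (ρ := ρ)
  by_cases hr : relGap G ρ u y s₀ ≤ K
  · have e : gapLyap G ρ K u y s₀ = 1 := by unfold gapLyap; rw [if_pos hr]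
    rw [e, mul_one]
    refine le_trans ?_ (le_max_left _ _)
    have h1 := hkick y ((le_max_left _ _).trans hy) u hDu B k Λ hu hN hΛ s₀ hs₀.harm hs₀.two
      hs₀.not_two n
    have h2 := hit_le_add (G := G) (A := Alive G B k Λ) (Q := TwoHeavy G u (2 * y))
      (F := gapLyap G ρ K u (2 * y)) (F' := fun s =>
        if gap G ρ u (2 * y) s ≤ K / (y : ℝ) ^ (ρ - 1 / 2) then 1 else 0) (c := 1 / 2)
      (d := 1 / 2) hp hp1 (by norm_num) (by norm_num) (fun s => by split_ifs <;> norm_num)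
      (fun s => by
        split_ifs with h
        · have := gapLyap_le_one (G := G) (ρ := ρ) hK0 u (2 * y) s
          linarith
        · have h3 : K < relGap G ρ u (2 * y) s := by
            rw [not_le, div_lt_iff₀ hμ0] at h
            rw [hrel]
            nlinarith
          have := gapLyap_le_half hK0 h3
          linarith) n s₀
    linarith
  · push Not at hr
    set r := relGap G ρ u y s₀ with hrd
    have hr0 : 0 < r := by linarith
    have e : gapLyap G ρ K u y s₀ = K / (2 * r) := by unfold gapLyap; rw [if_neg (not_le.2 hr)]
    rw [e]
    have h1 := hit_gap_le (k := k) (B := B) (y' := 2 * y) hρ hDu hu hN hy1 (by omega)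
      (by linarith) hΛ hs₀.harm hs₀.two hs₀.not_two (η * r) n
    have hsq : (7 : ℝ) / 5 ≤ 2 ^ (1 / 2 : ℝ) := by
      rw [← Real.sqrt_eq_rpow]
      exact Real.le_sqrt_of_sq_le (by norm_num)
    have h2 := hit_le_add (G := G) (A := Alive G B k Λ) (Q := TwoHeavy G u (2 * y))
      (F := gapLyap G ρ K u (2 * y)) (F' := fun s =>
        if gap G ρ u (2 * y) s ≤ gap G ρ u y s₀ - η * r / (y : ℝ) ^ (ρ - 1 / 2) then 1 else 0)
      (c := K / (2 * (7 / 5 * r))) (d := 1) hp hp1 (by positivity) (by norm_num)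
      (fun s => by split_ifs <;> norm_num)
      (fun s => by
        split_ifs with h
        · have := gapLyap_le_one (G := G) (ρ := ρ) hK0 u (2 * y) s
          have h3 : 0 ≤ K / (2 * (7 / 5 * r)) := by positivity
          linarith
        · have h3 : 7 / 5 * r < relGap G ρ u (2 * y) s := by
            push Not at h
            have e1 : gap G ρ u y s₀ = r / μ := by
              rw [eq_div_iff hμ0.ne', hrd]; exact mul_comm _ _
            rw [e1, ← hμ, ← sub_div, div_lt_iff₀ hμ0] at h
            have e2 : r - η * r = 2 ^ (1 - ρ) * r := by rw [hη]; ring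
            rw [hrel]
            rw [e2, mul_comm (gap _ _ _ _ _)] at h
            calc 7 / 5 * r ≤ 2 ^ (1 / 2 : ℝ) * r := by gcongr
              _ = 2 ^ (ρ - 1 / 2) * (2 ^ (1 - ρ) * r) := by
                rw [← mul_assoc, ← Real.rpow_add (by norm_num)]; congr 2; ring
              _ < _ := by gcongr
          have := gapLyap_le_of_lt hK0 (by linarith) h3
          simpa using this) n s₀
    refine h2.trans ?_
    rw [one_mul]
    refine (add_le_add_right h1 _).trans ?_
    have hexp : Real.exp (-(η * r)) ≤ 2 / (η * r) ^ 2 := by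
      have hx : 0 < η * r := by positivity
      have := Real.quadratic_le_exp_of_nonneg hx.le
      rw [Real.exp_neg, inv_eq_one_div, div_le_div_iff₀ (Real.exp_pos _) (by positivity)]
      nlinarith
    have h4 : D * (4 * Real.exp (costConst ρ - η * r)) ≤ (1 / 5) * (K / (2 * r)) := by
      have hD1 : (D : ℝ) ≤ D + 1 := by linarith
      calc D * (4 * Real.exp (costConst ρ - η * r))
          = D * (4 * (Real.exp (costConst ρ) * Real.exp (-(η * r)))) := by
            rw [← Real.exp_add]; ring_nf
        _ ≤ (D + 1) * (4 * (Real.exp (costConst ρ) * (2 / (η * r) ^ 2))) := by gcongr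
        _ = (1 / 5) * (C / (2 * r)) * (1 / r) := by rw [hC]; field_simp; norm_num
        _ ≤ (1 / 5) * (K / (2 * r)) * 1 := by
            gcongr
            · linarith
            · rw [div_le_one hr0]; linarith
        _ = _ := mul_one _
    have h5 : 19 / 20 * (K / (2 * r)) ≤ max (1 - c / 2) (19 / 20) * (K / (2 * r)) :=
      mul_le_mul_of_nonneg_right (le_max_right _ _) (by positivity)
    have h6 : K / (2 * (7 / 5 * r)) = 5 / 7 * (K / (2 * r)) := by field_simp
    have h7 : 0 ≤ K / (2 * r) := by positivity
    linarith

open Classical in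
/-- Two edges at `u` that have reached a large level rarely reach a much larger one. -/
theorem exists_hit_twoHeavy_le {ρ : ℝ} (hρ : 1 < ρ) (D : ℕ) : ∃ C : ℝ, 0 < C ∧ ∃ θ : ℝ, 0 < θ ∧
    θ < 1 ∧ ∃ i₀ : ℕ, ∀ (i m M : ℕ) (_ : i₀ ≤ i) (_ : 2 ^ (i + m) ≤ M)
      (_ : 2 * tailConst ρ * ((2 ^ (i + m) : ℕ) : ℝ) ^ (ρ - 1 / 2) ≤ (M : ℝ) ^ (ρ - 1))
      (u : V) (_ : G.degree u ≤ D) (B : Finset V) (k : ℕ)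
      (Λ : ℝ) (_ : u ∈ B) (_ : ∀ z, G.Adj u z → z ∈ B)
      (_ : Λ ≤ ((2 ^ i : ℕ) : ℝ) ^ (1 / 2 : ℝ))
      (s₀ : Hist V) (_ : AtLevel G u (2 ^ i) Λ s₀) (n : ℕ),
      hit G (stepKernel G ρ) (Alive G B k Λ) (TwoHeavy G u M) (fun _ => 1) n s₀ ≤ C * θ ^ m := by
  obtain ⟨K, hK1, θ, hθ0, hθ1, y₀, hstep⟩ := exists_hit_gapLyap_le (V := V) (G := G) hρ D
  have hK0 : 0 < K := by linarith
  set C : ℝ := 16 * (D + 1) * Real.exp (costConst ρ) + 1 with hC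
  have hC1 : 1 ≤ C := by
    have : 0 ≤ 16 * ((D : ℝ) + 1) * Real.exp (costConst ρ) := by positivity
    linarith
  have hp := fun (s : Hist V) z => stepKernel_nonneg G ρ s z
  have hp1 := fun (s : Hist V) => sum_stepKernel_le G ρ s
  refine ⟨C, by linarith, θ, hθ0, hθ1, max y₀ ⌈(8 * ρ + 1) ^ 2⌉₊, ?_⟩
  intro i m M hi hM hM' u hDu B k Λ hu hN hΛ s₀ hs₀ n
  -- Keeping the Lyapunov value of the starting history in the bound is what allows one contraction
  -- per level in the induction.
  suffices h : hit G (stepKernel G ρ) (Alive G B k Λ) (TwoHeavy G u M) (fun _ => 1) n s₀ ≤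
      C * θ ^ m * gapLyap G ρ K u (2 ^ i) s₀ by
    refine h.trans ?_
    have := gapLyap_le_one (G := G) (ρ := ρ) hK0 u (2 ^ i) s₀
    have h0 : 0 ≤ C * θ ^ m := by positivity
    nlinarith
  induction m generalizing i s₀ with
  | zero =>
    rw [add_zero] at hM hM'
    set y := 2 ^ i with hy
    have hiy : i ≤ y := (Nat.lt_two_pow_self).le
    have hX : 8 * ρ + 1 ≤ (y : ℝ) ^ (1 / 2 : ℝ) := by
      rw [← Real.sqrt_eq_rpow]
      exact Real.le_sqrt_of_sq_le ((Nat.le_ceil _).trans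
        (by exact_mod_cast ((le_max_right _ _).trans hi).trans hiy))
    have hy1 : 1 ≤ y := Nat.one_le_two_pow
    have hy0 : (0 : ℝ) < y := by exact_mod_cast hy1
    rw [pow_zero, mul_one]
    by_cases hr : relGap G ρ u y s₀ ≤ K
    · have e : gapLyap G ρ K u y s₀ = 1 := by unfold gapLyap; rw [if_pos hr]
      rw [e, mul_one]
      exact hit_le_const G (Inv := fun _ => True) hp (fun s _ => hp1 s)
        (fun _ _ _ _ _ _ => trivial) (by linarith) (fun _ _ _ => hC1) n s₀ trivial
    · push Not at hr
      set r := relGap G ρ u y s₀ with hrd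
      have hr0 : 0 < r := by linarith
      have e : gapLyap G ρ K u y s₀ = K / (2 * r) := by unfold gapLyap; rw [if_neg (not_le.2 hr)]
      rw [e]
      have h1 := hit_gap_le (k := k) (B := B) (y' := M) hρ hDu hu hN hy1 hM
        (by linarith) hΛ hs₀.harm hs₀.two hs₀.not_two (r / 2) n
      have hμ0 : 0 < (y : ℝ) ^ (ρ - 1 / 2) := by positivity
      have hMpos : (0 : ℝ) < M := by exact_mod_cast lt_of_lt_of_le hy1 hM
      have h2 := hit_le_hit G (p := stepKernel G ρ) (A := Alive G B k Λ) (A' := Alive G B k Λ)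
        (Q := TwoHeavy G u M) (Inv := fun _ => True) (F := fun _ => 1)
        (F' := fun s => if gap G ρ u M s ≤ gap G ρ u y s₀ - r / 2 / (y : ℝ) ^ (ρ - 1 / 2)
          then 1 else 0) hp (fun _ _ _ _ _ _ => trivial) (fun _ h => h)
        (fun s => by split_ifs <;> norm_num)
        (fun s _ hs => by
          rw [if_pos]
          have e1 : gap G ρ u y s₀ = r / (y : ℝ) ^ (ρ - 1 / 2) := by
            rw [eq_div_iff hμ0.ne', hrd]; exact mul_comm _ _
          -- At level `M` no gap exceeds `tailConst ρ * M ^ (1 - ρ)`, which by `hM'` is at most half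
          -- of the present gap. Reaching `M` thus requires the gap to halve.
          have h3 := powSum_sub_le hρ (hy1.trans hM) hs.le_maxWt
          have h4 : (M : ℝ) ^ (1 - ρ) = 1 / (M : ℝ) ^ (ρ - 1) := by
            rw [eq_div_iff (by positivity), ← Real.rpow_add hMpos]
            simp
          have h5 : r / (y : ℝ) ^ (ρ - 1 / 2) - r / 2 / (y : ℝ) ^ (ρ - 1 / 2) =
              r / (2 * (y : ℝ) ^ (ρ - 1 / 2)) := by field_simp; ring
          rw [e1, h5]
          refine h3.trans ?_
          rw [h4, mul_one_div, div_le_div_iff₀ (by positivity) (by positivity)]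
          have h6 : (M : ℝ) ^ (ρ - 1) ≤ r * (M : ℝ) ^ (ρ - 1) :=
            le_mul_of_one_le_left (by positivity) (by linarith)
          linarith) n s₀ trivial
      refine (h2.trans h1).trans ?_
      have hexp : Real.exp (-(r / 2)) ≤ 2 / r := by
        have := Real.add_one_le_exp (r / 2)
        rw [Real.exp_neg, inv_eq_one_div, div_le_div_iff₀ (Real.exp_pos _) (by positivity)]
        linarith
      calc D * (4 * Real.exp (costConst ρ - r / 2))
          = D * (4 * (Real.exp (costConst ρ) * Real.exp (-(r / 2)))) := by
            rw [← Real.exp_add]; ring_nf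
        _ ≤ (D + 1) * (4 * (Real.exp (costConst ρ) * (2 / r))) := by gcongr; linarith
        _ = 16 * (D + 1) * Real.exp (costConst ρ) * (1 / (2 * r)) := by field_simp; norm_num
        _ ≤ C * (K / (2 * r)) := by
            gcongr
            linarith
  | succ m ih =>
    have e1 : i + (m + 1) = i + 1 + m := by ring
    rw [e1] at hM hM'
    have h2 : 2 ^ (i + 1) = 2 * 2 ^ i := by ring
    have hlt : 2 ^ (i + 1) ≤ M := (Nat.pow_le_pow_right (by norm_num) (by omega)).trans hM
    have h1i : 1 ≤ 2 ^ i := Nat.one_le_two_pow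
    have h := hit_le_hit_atLevel (G := G) (ρ := ρ) (Λ := Λ) (B := B) (k := k) (u := u)
      (y' := 2 ^ (i + 1)) (Q := TwoHeavy G u M) (F := fun _ => 1)
      (g := fun t => C * θ ^ m * gapLyap G ρ K u (2 ^ (i + 1)) t) (fun _ => zero_le_one)
      (fun t => mul_nonneg (by positivity) (gapLyap_nonneg hK0 _ _ _)) (fun s hs => hs.anti hlt)
      n (s := s₀) (fun hcon => hs₀.not_two (hcon.anti (by omega))) hs₀.harm
      (fun t ht => ih (i + 1) (by omega) hM hM'
        (hΛ.trans (Real.rpow_le_rpow (by positivity) (by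
          exact_mod_cast Nat.pow_le_pow_right (by norm_num) (by omega)) (by norm_num))) t ht)
    refine h.trans ?_
    rw [hit_const_mul]
    have h3 := hstep (2 ^ i) (((le_max_left _ _).trans hi).trans Nat.lt_two_pow_self.le) u hDu B k
      Λ hu hN hΛ s₀ hs₀ n
    rw [← h2] at h3
    calc _ ≤ C * θ ^ m * (θ * gapLyap G ρ K u (2 ^ i) s₀) :=
          mul_le_mul_of_nonneg_left h3 (by positivity)
      _ = _ := by ring

end Phases

/-! ### Visited vertices and the bounce estimate -/

section Reach

variable {V : Type*}

/-- The histories of paths of `G` that start at `v₀`. -/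
inductive Reach (G : SimpleGraph V) (v₀ : V) : Hist V → Prop
  | init : Reach G v₀ (v₀, [])
  | step {s : Hist V} {y : V} : Reach G v₀ s → G.Adj s.1 y → Reach G v₀ (push s y)

open Classical in
/-- The set of visited vertices. -/
def visited (s : Hist V) : Finset V := (s.1 :: s.2).toFinset

open Classical in
theorem visited_push (s : Hist V) (y : V) : visited (push s y) = insert y (visited s) := by
  simp [visited]

theorem fst_mem_visited (s : Hist V) : s.1 ∈ visited s := by simp [visited]

theorem visited_subset_push (s : Hist V) (y : V) : visited s ⊆ visited (push s y) := by
  classical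
  rw [visited_push]
  exact Finset.subset_insert _ _

theorem card_visited_push_le (s : Hist V) (y : V) :
    (visited (push s y)).card ≤ (visited s).card + 1 := by
  classical
  rw [visited_push]
  exact Finset.card_insert_le _ _

/-- Edges at unvisited vertices have not been traversed. -/
theorem wt_eq_one_of_notMem (s : Hist V) {x : V} (h : x ∉ visited s) (z : V) :
    wt s s(x, z) = 1 := by
  obtain ⟨a, l⟩ := s
  induction l generalizing a with
  | nil => rfl
  | cons b l ih =>
    change x ∉ visited (push (b, l) a) at h
    change wt (push (b, l) a) s(x, z) = 1
    have h1 : x ∉ visited ((b, l) : Hist V) := fun hx => h (visited_subset_push _ _ hx)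
    rw [wt_push_of_ne, ih b h1]
    intro he
    rcases Sym2.eq_iff.1 he with ⟨h2, _⟩ | ⟨_, h2⟩
    · exact h1 (h2 ▸ fst_mem_visited ((b, l) : Hist V))
    · exact h (h2 ▸ fst_mem_visited (push ((b, l) : Hist V) a))

variable {G : SimpleGraph V}

theorem TwoHeavy.mem_visited {u : V} {y : ℕ} (hy : 2 ≤ y) {s : Hist V} (h : TwoHeavy G u y s) :
    u ∈ visited s := by
  obtain ⟨a, b, _, _, _, h1, _⟩ := h
  by_contra hu
  rw [wt_eq_one_of_notMem s hu] at h1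
  omega

variable [G.LocallyFinite]

open Classical in
/-- The ball of radius `n` about `v₀`. -/
def ballFinset (G : SimpleGraph V) [G.LocallyFinite] (v₀ : V) : ℕ → Finset V
  | 0 => {v₀}
  | n + 1 => ballFinset G v₀ n ∪ (ballFinset G v₀ n).biUnion fun x => G.neighborFinset x

theorem ballFinset_mono (v₀ : V) : Monotone (ballFinset G v₀) :=
  monotone_nat_of_le_succ fun n => by
    classical
    rw [ballFinset]; exact Finset.subset_union_left

theorem mem_ballFinset_succ {v₀ x z : V} {n : ℕ} (hx : x ∈ ballFinset G v₀ n) (h : G.Adj x z) :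
    z ∈ ballFinset G v₀ (n + 1) := by
  classical
  rw [ballFinset]
  exact Finset.mem_union_right _ (Finset.mem_biUnion.2 ⟨x, hx, by simpa using h⟩)

theorem Reach.visited_subset {v₀ : V} {s : Hist V} (h : Reach G v₀ s) :
    visited s ⊆ ballFinset G v₀ s.2.length := by
  classical
  induction h with
  | init => simp [visited, ballFinset]
  | @step s y _ hy ih =>
    rw [visited_push]
    refine Finset.insert_subset ?_ (ih.trans (ballFinset_mono v₀ (by simp)))
    exact mem_ballFinset_succ (ih (fst_mem_visited s)) hy

/-- Each step raises `degWt` at the vertex it leaves. -/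
theorem Reach.length_le {v₀ : V} {s : Hist V} (h : Reach G v₀ s) :
    s.2.length ≤ ∑ u ∈ visited s, degWt G u s := by
  induction h with
  | init => simp
  | @step s y _ hy ih =>
    have h1 : ∑ u ∈ visited s, degWt G u s < ∑ u ∈ visited s, degWt G u (push s y) :=
      Finset.sum_lt_sum (fun u _ => degWt_le_push u s y)
        ⟨s.1, fst_mem_visited s, degWt_lt_push rfl hy⟩
    have h2 : ∑ u ∈ visited s, degWt G u (push s y) ≤
        ∑ u ∈ visited (push s y), degWt G u (push s y) :=
      Finset.sum_le_sum_of_subset (visited_subset_push s y)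
    simp only [push_snd, List.length_cons]
    omega

/-- A traversal at weight `j` contributes `1 / (j + 1) ≤ log (j + 1) - log j`, charged to the vertex
being left. -/
theorem Reach.harmonicSum_le {v₀ : V} {s : Hist V} (h : Reach G v₀ s) :
    harmonicSum s ≤ ∑ u ∈ visited s, ∑ z ∈ G.neighborFinset u, Real.log (wt s s(u, z)) := by
  have hlog : ∀ (s : Hist V) (e : Sym2 V), 0 ≤ Real.log (wt s e) := fun s e =>
    Real.log_nonneg (by exact_mod_cast one_le_wt s e)
  have hmono : ∀ (s : Hist V) (y : V) (e : Sym2 V),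
      Real.log (wt s e) ≤ Real.log (wt (push s y) e) := fun s y e =>
    Real.log_le_log (by exact_mod_cast one_le_wt s e) (by exact_mod_cast wt_le_push s y e)
  induction h with
  | init => exact Finset.sum_nonneg fun _ _ => Finset.sum_nonneg fun _ _ => hlog _ _
  | @step s y _ hy ih =>
    rw [harmonicSum_push]
    have h1 : 1 / ((wt s s(s.1, y) : ℝ) + 1) ≤
        Real.log (wt (push s y) s(s.1, y)) - Real.log (wt s s(s.1, y)) := by
      have hj : (0 : ℝ) < wt s s(s.1, y) := by exact_mod_cast one_le_wt s s(s.1, y)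
      rw [wt_push_self, ← Real.log_div (by positivity) hj.ne']
      have := Real.one_sub_inv_le_log_of_pos
        (x := ((wt s s(s.1, y) + 1 : ℕ) : ℝ) / wt s s(s.1, y)) (by positivity)
      refine le_trans (le_of_eq ?_) this
      push_cast
      field_simp
      ring
    have h2 : ∑ u ∈ visited s, ∑ z ∈ G.neighborFinset u,
        (Real.log (wt (push s y) s(u, z)) - Real.log (wt s s(u, z))) ≤
        ∑ u ∈ visited (push s y), ∑ z ∈ G.neighborFinset u, Real.log (wt (push s y) s(u, z)) -
        ∑ u ∈ visited s, ∑ z ∈ G.neighborFinset u, Real.log (wt s s(u, z)) := by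
      simp only [Finset.sum_sub_distrib]
      exact sub_le_sub_right (Finset.sum_le_sum_of_subset_of_nonneg (visited_subset_push s y)
        fun _ _ _ => Finset.sum_nonneg fun _ _ => hlog _ _) _
    have h3 : Real.log (wt (push s y) s(s.1, y)) - Real.log (wt s s(s.1, y)) ≤
        ∑ u ∈ visited s, ∑ z ∈ G.neighborFinset u,
        (Real.log (wt (push s y) s(u, z)) - Real.log (wt s s(u, z))) := by
      refine le_trans ?_ (Finset.single_le_sum (f := fun u => ∑ z ∈ G.neighborFinset u,
        (Real.log (wt (push s y) s(u, z)) - Real.log (wt s s(u, z))))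
        (fun u _ => Finset.sum_nonneg fun z _ => sub_nonneg.2 (hmono _ _ _)) (fst_mem_visited s))
      exact Finset.single_le_sum (f := fun z =>
        Real.log (wt (push s y) s(s.1, z)) - Real.log (wt s s(s.1, z)))
        (fun z _ => sub_nonneg.2 (hmono _ _ _)) (by simpa using hy)
    linarith

theorem Reach.harmonicSum_le_log {v₀ : V} {s : Hist V} (h : Reach G v₀ s) {D r k : ℕ}
    (hD : ∀ u, G.degree u ≤ D) (hr : (visited s).card ≤ r) (hk : s.2.length ≤ k) :
    harmonicSum s ≤ r * (D * Real.log (k + 1)) := by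
  have hlog : 0 ≤ Real.log ((k : ℝ) + 1) := Real.log_nonneg (by
    have : (0 : ℝ) ≤ k := by positivity
    linarith)
  calc harmonicSum s ≤ _ := h.harmonicSum_le
    _ ≤ ∑ u ∈ visited s, (D * Real.log (k + 1)) := by
        refine Finset.sum_le_sum fun u _ => ?_
        calc _ ≤ ∑ z ∈ G.neighborFinset u, Real.log ((k : ℝ) + 1) := by
              refine Finset.sum_le_sum fun z _ => ?_
              refine Real.log_le_log (by exact_mod_cast one_le_wt s _) ?_
              exact_mod_cast (wt_le_length s _).trans (by omega)
          _ ≤ _ := by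
              rw [Finset.sum_const, nsmul_eq_mul]
              exact mul_le_mul_of_nonneg_right (by exact_mod_cast hD u) hlog
    _ ≤ _ := by
        rw [Finset.sum_const, nsmul_eq_mul]
        exact mul_le_mul_of_nonneg_right (by exact_mod_cast hr) (by positivity)

open Classical in
/-- The vertices that had an unvisited neighbour at their first visit. -/
def openAux (G : SimpleGraph V) : V → List V → Finset V
  | x, [] => {x}
  | x, z :: l => if x ∉ visited (z, l) ∧ ∃ w, G.Adj x w ∧ w ∉ visited (z, l) then
      insert x (openAux G z l) else openAux G z l

/-- The vertices that had an unvisited neighbour at their first visit, and the origin. -/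
def openSet (G : SimpleGraph V) (s : Hist V) : Finset V := openAux G s.1 s.2

open Classical in
theorem openSet_push (s : Hist V) (y : V) : openSet G (push s y) =
    if y ∉ visited s ∧ ∃ w, G.Adj y w ∧ w ∉ visited s then insert y (openSet G s)
    else openSet G s := rfl

theorem openSet_push_of_mem {s : Hist V} {y : V} (h : y ∈ visited s) :
    openSet G (push s y) = openSet G s := by
  rw [openSet_push, if_neg (fun h' => h'.1 h)]

theorem card_openSet_push_le (s : Hist V) (y : V) :
    (openSet G (push s y)).card ≤ (openSet G s).card + 1 := by
  classical
  rw [openSet_push]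
  split_ifs
  · exact Finset.card_insert_le _ _
  · exact Nat.le_succ _

/-- A neighbour that is unvisited now was also unvisited when `x` was first visited. -/
theorem Reach.mem_openSet {v₀ : V} {s : Hist V} (h : Reach G v₀ s) {x z : V}
    (hx : x ∈ visited s) (hxz : G.Adj x z) (hz : z ∉ visited s) : x ∈ openSet G s := by
  classical
  induction h with
  | init =>
    have : x = v₀ := by simpa [visited] using hx
    simp [openSet, openAux, this]
  | @step s y _ hy ih =>
    have hz' : z ∉ visited s := fun h => hz (visited_subset_push s y h)
    rw [openSet_push]
    by_cases hxs : x ∈ visited s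
    · have := ih hxs hz'
      split_ifs
      · exact Finset.mem_insert_of_mem this
      · exact this
    · rw [visited_push, Finset.mem_insert] at hx
      obtain rfl : x = y := hx.resolve_right hxs
      rw [if_pos ⟨hxs, z, hxz, hz'⟩]
      exact Finset.mem_insert_self _ _

/-- A new vertex is always entered from a vertex with an unvisited neighbour, hence from `openSet`.
-/
theorem Reach.card_visited_le {v₀ : V} {s : Hist V} (h : Reach G v₀ s) {D : ℕ}
    (hD : ∀ u, G.degree u ≤ D) : (visited s).card ≤ 1 + (openSet G s).card * D := by
  classical
  have key : visited s ⊆ {v₀} ∪ (openSet G s).biUnion fun x => G.neighborFinset x := by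
    induction h with
    | init => simp [visited]
    | @step s y hs hy ih =>
      have hsub : openSet G s ⊆ openSet G (push s y) := by
        rw [openSet_push]; split_ifs
        · exact Finset.subset_insert _ _
        · exact subset_rfl
      have ih' := ih.trans (Finset.union_subset_union_right
        (Finset.biUnion_subset_biUnion_of_subset_left (fun x => G.neighborFinset x) hsub))
      rw [visited_push]
      refine Finset.insert_subset ?_ ih'
      by_cases hys : y ∈ visited s
      · exact ih' hys
      · exact Finset.mem_union_right _ (Finset.mem_biUnion.2
          ⟨s.1, hsub (hs.mem_openSet (fst_mem_visited s) hy hys), by simpa using hy⟩)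
  refine (Finset.card_le_card key).trans ((Finset.card_union_le _ _).trans ?_)
  rw [Finset.card_singleton]
  exact Nat.add_le_add_left (Finset.card_biUnion_le_card_mul _ _ _ fun x _ => hD x) _

-- The sum is the expected number of `u ∈ B` whose event is met before killing. Since `Q u` persists
-- under `push`, this number can be read off the last history, where it is at most `c`. Applied to a
-- ball that may be exponentially large, it replaces the size of the ball by the number of visited
-- vertices.
open Classical in
theorem sum_hit_le {ρ : ℝ} (hnb : ∀ x, ∃ z, G.Adj x z) {A : Hist V → Prop} (B : Finset V)
    {Q : V → Hist V → Prop} (hQ : ∀ u s z, Q u s → Q u (push s z)) {c : ℕ}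
    (hA : ∀ s, A s → ∀ z, G.Adj s.1 z → (B.filter fun u => Q u (push s z)).card ≤ c) (n : ℕ)
    (s : Hist V) (hs : (B.filter fun u => Q u s).card ≤ c) :
    ∑ u ∈ B, hit G (stepKernel G ρ) A (Q u) (fun _ => 1) n s ≤ c := by
  have base : ∑ u ∈ B, (if Q u s then (1 : ℝ) else 0) ≤ c := by
    rw [Finset.sum_boole]; exact_mod_cast hs
  induction n generalizing s with
  | zero => exact base
  | succ n ih =>
    by_cases hAs : A s
    swap
    · refine le_trans (le_of_eq (Finset.sum_congr rfl fun u _ => ?_)) base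
      split_ifs with h
      · exact hit_of_mem G h _
      · exact hit_of_not_mem G h hAs _
    obtain ⟨z₀, hz₀⟩ := hnb s.1
    have h1 : ∀ u ∈ B, hit G (stepKernel G ρ) A (Q u) (fun _ => 1) (n + 1) s ≤
        ∑ z ∈ G.neighborFinset s.1, stepKernel G ρ s z *
          hit G (stepKernel G ρ) A (Q u) (fun _ => 1) n (push s z) := by
      intro u _
      by_cases h : Q u s
      · rw [hit_of_mem G h]
        refine (sum_stepKernel ρ s hz₀).ge.trans (Finset.sum_le_sum fun z _ => ?_)
        rw [hit_of_mem G (hQ u s z h), mul_one]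
      · rw [hit_succ_of_not G h hAs]
    refine (Finset.sum_le_sum h1).trans ?_
    rw [Finset.sum_comm]
    calc _ ≤ ∑ z ∈ G.neighborFinset s.1, stepKernel G ρ s z * (c : ℝ) := by
          refine Finset.sum_le_sum fun z hz => ?_
          rw [← Finset.mul_sum]
          refine mul_le_mul_of_nonneg_left ?_ (stepKernel_nonneg G ρ s z)
          have hc := hA s hAs z (by simpa using hz)
          exact ih _ hc (by rw [Finset.sum_boole]; exact_mod_cast hc)
      _ = c := by rw [← Finset.sum_mul, sum_stepKernel ρ s hz₀, one_mul]

/-- A walk that sits at a heavy edge whose adjacent edges are light rarely leaves it. -/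
theorem hit_le_of_bounce {ρ : ℝ} (hρ : 1 < ρ) {D m j : ℕ} (hD : ∀ u, G.degree u ≤ D)
    {e : Sym2 V} {A Q P : Hist V → Prop}
    (hP : ∀ t, P t → ∃ y, s(t.1, y) = e ∧ G.Adj t.1 y ∧
      (∀ z, G.Adj t.1 z → z ≠ y → wt t s(t.1, z) ≤ m) ∧ P (push t y))
    (hPQ : ∀ t, P t → ¬ Q t) {F : Hist V → ℝ} (hF : ∀ t, F t ≤ 1) (hj : 1 ≤ j) {s : Hist V}
    (hs : P s) (hjs : j ≤ wt s e) (n : ℕ) :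
    hit G (stepKernel G ρ) A Q F n s ≤
      1 - Real.exp (-(D * (m : ℝ) ^ ρ * (tailConst ρ * (j : ℝ) ^ (1 - ρ)))) := by
  classical
  set c : ℝ := D * (m : ℝ) ^ ρ with hc
  have hc0 : 0 ≤ c := by positivity
  set U : ℝ := powSum ρ j + tailConst ρ * (j : ℝ) ^ (1 - ρ) with hU
  -- `g` is a lower bound for the probability of never leaving `e`: each crossing at weight `w`
  -- multiplies it by `exp (c * w ^ (-ρ))`, and the bound `U` for all values of `powSum` keeps it at
  -- most one.
  set g : Hist V → ℝ := fun t => Real.exp (-(c * (U - powSum ρ (wt t e)))) with hg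
  have hg1 : ∀ t, j ≤ wt t e → g t ≤ 1 := fun t ht => by
    refine Real.exp_le_one_iff.2 (neg_nonpos.2 (mul_nonneg hc0 ?_))
    have := powSum_sub_le hρ hj ht
    rw [hU]; linarith
  have hg0 : ∀ t, 0 < g t := fun t => Real.exp_pos _
  set Ψ : Hist V → ℝ := fun t => if P t then 1 - g t else 1 with hΨ
  have hΨ1 : ∀ t, Ψ t ≤ 1 := fun t => by
    simp only [hΨ]; split_ifs
    · linarith [hg0 t]
    · exact le_rfl
  have h := hit_le_of_super G (p := stepKernel G ρ) (A := A) (Q := Q) (F := F)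
    (Inv := fun t => j ≤ wt t e) (Ψ := Ψ) (fun t z => stepKernel_nonneg G ρ t z)
    (fun t h _ _ z _ => h.trans (wt_le_push t z e))
    (fun t ht => by
      simp only [hΨ]; split_ifs
      · linarith [hg1 t ht]
      · exact zero_le_one)
    (fun t ht hQ => by
      simp only [hΨ]
      rw [if_neg (fun hPt => hPQ t hPt hQ)]; exact hF t)
    (fun t ht _ _ => by
      by_cases hPt : P t
      swap
      · simp only [hΨ] at hΨ1 ⊢
        rw [if_neg hPt]
        calc _ ≤ ∑ z ∈ G.neighborFinset t.1, stepKernel G ρ t z * 1 :=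
              Finset.sum_le_sum fun z _ =>
                mul_le_mul_of_nonneg_left (hΨ1 _) (stepKernel_nonneg G ρ t z)
          _ ≤ 1 := by simpa using sum_stepKernel_le G ρ t
      obtain ⟨y, hye, hy, hlight, hP'⟩ := hP t hPt
      have hyN : y ∈ G.neighborFinset t.1 := by simpa using hy
      have hsum := sum_stepKernel ρ t hy
      have e1 : ∑ z ∈ G.neighborFinset t.1, stepKernel G ρ t z * Ψ (push t z) ≤
          1 - stepKernel G ρ t y * g (push t y) := by
        rw [← Finset.add_sum_erase _ _ hyN]
        rw [← Finset.add_sum_erase _ _ hyN] at hsum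
        have h1 : ∑ z ∈ (G.neighborFinset t.1).erase y, stepKernel G ρ t z * Ψ (push t z) ≤
            ∑ z ∈ (G.neighborFinset t.1).erase y, stepKernel G ρ t z :=
          Finset.sum_le_sum fun z _ => mul_le_of_le_one_right (stepKernel_nonneg G ρ t z) (hΨ1 _)
        have h2 : Ψ (push t y) = 1 - g (push t y) := by simp only [hΨ]; rw [if_pos hP']
        rw [h2]
        linarith
      have h3 : Ψ t = 1 - g t := by simp only [hΨ]; rw [if_pos hPt]
      refine e1.trans ?_
      rw [h3]
      refine sub_le_sub_left ?_ _
      set w := wt t e with hw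
      have hw0 : (0 : ℝ) < w := by exact_mod_cast hj.trans ht
      have h4 : g (push t y) = g t * Real.exp (c * (w : ℝ) ^ (-ρ)) := by
        simp only [hg]
        rw [← hye, wt_push_self, hye, powSum_succ, ← Real.exp_add, ← hw]
        congr 1; ring
      have h5 : totalWeight G ρ t t.1 ≤ (w : ℝ) ^ ρ + c := by
        unfold totalWeight
        rw [← Finset.add_sum_erase _ _ hyN, hye]
        refine add_le_add_right ?_ _
        calc _ ≤ ((G.neighborFinset t.1).erase y).card • (m : ℝ) ^ ρ :=
              Finset.sum_le_card_nsmul _ _ _ fun z hz => by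
                rw [Finset.mem_erase] at hz
                refine Real.rpow_le_rpow (by positivity) ?_ (by linarith)
                exact_mod_cast hlight z (by simpa using hz.2) hz.1
          _ ≤ c := by
              rw [nsmul_eq_mul, hc]
              refine mul_le_mul_of_nonneg_right ?_ (by positivity)
              exact_mod_cast (Finset.card_erase_le).trans (hD t.1)
      -- The crossing probability is at least `w ^ ρ / (w ^ ρ + c) = 1 / (1 + c * w ^ (-ρ))`.
      have h6 : stepKernel G ρ t y * Real.exp (c * (w : ℝ) ^ (-ρ)) ≥ 1 := by
        unfold stepKernel
        rw [hye, ← hw, ge_iff_le, div_mul_eq_mul_div, le_div_iff₀ (totalWeight_pos ρ t hy), one_mul]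
        refine h5.trans ?_
        have h7 := Real.add_one_le_exp (c * (w : ℝ) ^ (-ρ))
        have h8 : (w : ℝ) ^ ρ * (w : ℝ) ^ (-ρ) = 1 := by
          rw [← Real.rpow_add hw0]; simp
        have h9 : 0 < (w : ℝ) ^ ρ := by positivity
        nlinarith [mul_le_mul_of_nonneg_left h7 h9.le]
      rw [h4]
      nlinarith [hg0 t]) n s hjs
  refine h.trans ?_
  simp only [hΨ]
  rw [if_pos hs]
  refine sub_le_sub_left (Real.exp_le_exp.2 (neg_le_neg (mul_le_mul_of_nonneg_left ?_ hc0))) _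
  have := powSum_mono ρ hjs
  rw [hU]; linarith

end Reach

/-! ### Tail of the number of visited vertices, and heavy pairs at all vertices -/

section Spread

variable {V : Type*} {G : SimpleGraph V} [G.LocallyFinite]

/-- The current vertex has an unvisited neighbour, and its edges are light. -/
def Fresh (G : SimpleGraph V) (s : Hist V) : Prop :=
  ∃ z, G.Adj s.1 z ∧ z ∉ visited s ∧ ∀ w, wt s s(s.1, w) ≤ 2

theorem openSet_push_eq_or_fresh (s : Hist V) (y : V) :
    openSet G (push s y) = openSet G s ∨ Fresh G (push s y) := by
  classical
  rw [openSet_push]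
  split_ifs with h
  · obtain ⟨hy, w, hyw, hw⟩ := h
    refine Or.inr ⟨w, hyw, ?_, fun w' => ?_⟩
    · rw [visited_push, Finset.mem_insert]
      rintro (rfl | h)
      · exact hyw.ne rfl
      · exact hw h
    · have h1 := wt_push_le s y s(y, w')
      rw [wt_eq_one_of_notMem s hy] at h1
      exact h1
  · exact Or.inl rfl

/-- The walk may bounce forever between the current vertex and its unvisited neighbour `z`, all
adjacent edges having weight at most two. During this bounce `openSet` grows at most once, when `z`
is first entered, which is why the threshold is two more elements. -/
theorem Fresh.hit_openSet_le {ρ : ℝ} (hρ : 1 < ρ) {D : ℕ} (hD : ∀ u, G.degree u ≤ D)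
    {A : Hist V → Prop} {s : Hist V} (hs : Fresh G s) (n : ℕ) :
    hit G (stepKernel G ρ) A (fun t => (openSet G s).card + 2 ≤ (openSet G t).card) (fun _ => 1) n s
      ≤ 1 - Real.exp (-(D * ((2 : ℕ) : ℝ) ^ ρ * (tailConst ρ * ((1 : ℕ) : ℝ) ^ (1 - ρ)))) := by
  obtain ⟨z, hxz, hz, hw⟩ := hs
  set x := s.1 with hx
  set j := (openSet G s).card with hj
  have hne : x ≠ z := hxz.ne
  refine hit_le_of_bounce (e := s(x, z)) hρ hD
    (P := fun t => x ∈ visited t ∧ (t.1 = x ∨ t.1 = z) ∧ (openSet G t).card ≤ j + 1 ∧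
      (z ∉ visited t → (openSet G t).card ≤ j) ∧ (∀ w, w ≠ z → wt t s(x, w) ≤ 2) ∧
      (∀ w, w ≠ x → wt t s(z, w) ≤ 2)) ?_ ?_ (fun _ => le_rfl) le_rfl ?_ (one_le_wt _ _) n
  · rintro t ⟨hxt, hpos | hpos, h1, h2, h3, h4⟩
    · have e1 : ∀ w, w ≠ z → s(t.1, z) ≠ s(x, w) := fun w hw he => by
        rw [hpos] at he
        exact hw (Sym2.congr_right.1 he).symm
      have e2 : ∀ w, w ≠ x → s(t.1, z) ≠ s(z, w) := fun w hw he => by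
        rw [hpos, Sym2.eq_swap] at he
        exact hw (Sym2.congr_right.1 he).symm
      refine ⟨z, by rw [hpos], by rw [hpos]; exact hxz, fun w _ hw => by rw [hpos]; exact h3 w hw,
        visited_subset_push t z hxt, Or.inr rfl, ?_, fun h => absurd (fst_mem_visited _) h,
        fun w hw => by rw [wt_push_of_ne t (e1 w hw)]; exact h3 w hw,
        fun w hw => by rw [wt_push_of_ne t (e2 w hw)]; exact h4 w hw⟩
      by_cases hzt : z ∈ visited t
      · rw [openSet_push_of_mem hzt]; exact h1
      · exact (card_openSet_push_le t z).trans (Nat.succ_le_succ (h2 hzt))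
    · have e1 : ∀ w, w ≠ z → s(t.1, x) ≠ s(x, w) := fun w hw he => by
        rw [hpos, Sym2.eq_swap] at he
        exact hw (Sym2.congr_right.1 he).symm
      have e2 : ∀ w, w ≠ x → s(t.1, x) ≠ s(z, w) := fun w hw he => by
        rw [hpos] at he
        exact hw (Sym2.congr_right.1 he).symm
      have hzt : z ∈ visited t := hpos ▸ fst_mem_visited t
      refine ⟨x, by rw [hpos, Sym2.eq_swap], by rw [hpos]; exact hxz.symm,
        fun w _ hw => by rw [hpos]; exact h4 w hw, visited_subset_push t x hxt, Or.inl rfl, ?_,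
        fun h => absurd (visited_subset_push t x hzt) h,
        fun w hw => by rw [wt_push_of_ne t (e1 w hw)]; exact h3 w hw,
        fun w hw => by rw [wt_push_of_ne t (e2 w hw)]; exact h4 w hw⟩
      rw [openSet_push_of_mem hxt]; exact h1
  · rintro t ⟨-, -, h1, -⟩ h2
    omega
  · exact ⟨fst_mem_visited s, Or.inl rfl, by omega, fun _ => le_rfl, fun w _ => hw w,
      fun w _ => by rw [wt_eq_one_of_notMem s hz]; norm_num⟩

/-- The number of vertices that have an unvisited neighbour at their first visit has an
exponential tail. -/
theorem hit_openSet_le {ρ : ℝ} (hρ : 1 < ρ) {D : ℕ} (hD : ∀ u, G.degree u ≤ D) (v₀ : V)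
    (R n : ℕ) : hit G (stepKernel G ρ) (fun _ => True) (fun t => 2 * R + 2 ≤ (openSet G t).card)
      (fun _ => 1) n (v₀, []) ≤
    (1 - Real.exp (-(D * ((2 : ℕ) : ℝ) ^ ρ * (tailConst ρ * ((1 : ℕ) : ℝ) ^ (1 - ρ))))) ^ R := by
  set c := 1 - Real.exp (-(D * ((2 : ℕ) : ℝ) ^ ρ * (tailConst ρ * ((1 : ℕ) : ℝ) ^ (1 - ρ)))) with hc
  have hc0 : 0 ≤ c := by
    have := tailConst_pos hρ
    rw [hc, sub_nonneg, Real.exp_le_one_iff, neg_nonpos]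
    positivity
  have hp := fun (s : Hist V) z => stepKernel_nonneg G ρ s z
  induction R with
  | zero =>
    rw [pow_zero]
    exact hit_le_const G (Inv := fun _ => True) hp (fun s _ => sum_stepKernel_le G ρ s)
      (fun _ _ _ _ _ _ => trivial) zero_le_one (fun _ _ _ => le_rfl) n _ trivial
  | succ R ih =>
    refine (hit_le_hit_hit G (Q₁ := fun t => 2 * R + 2 ≤ (openSet G t).card) hp
      (fun _ => zero_le_one) (fun t ht => by omega) n _).trans ?_
    have h := hit_le_hit G (p := stepKernel G ρ) (A := fun _ => True) (A' := fun _ => True)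
      (Q := fun t => 2 * R + 2 ≤ (openSet G t).card)
      -- `openSet` gains one element at a time, and the walk is then at a fresh vertex. When the
      -- threshold is first met, the size is exactly `2 * R + 2` and the previous lemma applies.
      (Inv := fun t => (openSet G t).card < 2 * R + 2 ∨
        ((openSet G t).card = 2 * R + 2 ∧ Fresh G t))
      (F := fun t => hit G (stepKernel G ρ) (fun _ => True)
        (fun t => 2 * (R + 1) + 2 ≤ (openSet G t).card) (fun _ => 1) n t)
      (F' := fun _ => c * 1) hp
      (fun t _ h2 _ z _ => by
        have h3 := card_openSet_push_le (G := G) t z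
        rcases openSet_push_eq_or_fresh (G := G) t z with h4 | h4
        · rw [h4]; left; omega
        · by_cases h5 : (openSet G (push t z)).card < 2 * R + 2
          · exact Or.inl h5
          · exact Or.inr ⟨by omega, h4⟩)
      (fun _ h => h) (fun _ => by simpa using hc0)
      (fun t h1 h2 => by
        obtain ⟨h3, h4⟩ := h1.resolve_left (by omega)
        have := h4.hit_openSet_le hρ hD (A := fun _ => True) n
        rw [h3] at this
        rw [mul_one]; exact this) n (v₀, [])
      (Or.inl (by
        have : (openSet G ((v₀, []) : Hist V)).card = 1 := by simp [openSet, openAux]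
        omega))
    refine h.trans ?_
    rw [hit_const_mul, pow_succ']
    exact mul_le_mul_of_nonneg_left ih hc0

-- By the strong Markov property at level `2 ^ i`, each vertex contributes the chance of reaching
-- that level times `C * θ ^ m`. A vertex with two edges of weight `2 ^ i ≥ 2` has been visited, so
-- `sum_hit_le` bounds the sum of the chances by `r + 1`, whatever the size of the ball.
open Classical in
theorem exists_sum_hit_twoHeavy_le {ρ : ℝ} (hρ : 1 < ρ) (D : ℕ) (hD : ∀ u, G.degree u ≤ D)
    (hnb : ∀ x, ∃ z, G.Adj x z) : ∃ C : ℝ, 0 < C ∧ ∃ θ : ℝ, 0 < θ ∧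
    θ < 1 ∧ ∃ i₀ : ℕ, ∀ (i m M : ℕ) (_ : i₀ ≤ i) (_ : 2 ^ (i + m) ≤ M)
      (_ : 2 * tailConst ρ * ((2 ^ (i + m) : ℕ) : ℝ) ^ (ρ - 1 / 2) ≤ (M : ℝ) ^ (ρ - 1))
      (k r : ℕ) (_ : (r : ℝ) * (D * Real.log (k + 1)) ≤ ((2 ^ i : ℕ) : ℝ) ^ (1 / 2 : ℝ))
      (v₀ : V) (n : ℕ),
      ∑ u ∈ ballFinset G v₀ k, hit G (stepKernel G ρ)
        (fun t => Reach G v₀ t ∧ t.2.length ≤ k ∧ (visited t).card ≤ r) (TwoHeavy G u M)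
        (fun _ => 1) n (v₀, []) ≤ (r + 1) * (C * θ ^ m) := by
  obtain ⟨C, hC, θ, hθ0, hθ1, i₀, h⟩ := exists_hit_twoHeavy_le (V := V) (G := G) hρ D
  refine ⟨C, hC, θ, hθ0, hθ1, max i₀ 1, ?_⟩
  intro i m M hi hM hM' k r hΛ v₀ n
  set A : Hist V → Prop :=
    fun t => Reach G v₀ t ∧ t.2.length ≤ k ∧ (visited t).card ≤ r with hA
  set Λ : ℝ := r * (D * Real.log (k + 1)) with hΛd
  have hlog : 0 ≤ Real.log ((k : ℝ) + 1) := Real.log_nonneg (by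
    have : (0 : ℝ) ≤ k := by positivity
    linarith)
  have hΛ0 : 0 ≤ Λ := by positivity
  have hp := fun (s : Hist V) z => stepKernel_nonneg G ρ s z
  have hAlive : ∀ t, A t → Alive G (ballFinset G v₀ (k + 1)) k Λ t := by
    rintro t ⟨h1, h2, h3⟩
    have h4 : t.1 ∈ ballFinset G v₀ k := ballFinset_mono v₀ h2 (h1.visited_subset (fst_mem_visited t))
    exact ⟨ballFinset_mono v₀ (Nat.le_succ k) h4, fun z hz => mem_ballFinset_succ h4 hz, h2,
      h1.harmonicSum_le_log hD h3 h2⟩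
  have h2i : 2 ≤ 2 ^ i := by
    calc 2 = 2 ^ 1 := rfl
      _ ≤ 2 ^ i := Nat.pow_le_pow_right (by norm_num) ((le_max_right _ _).trans hi)
  have hstep : ∀ u ∈ ballFinset G v₀ k,
      hit G (stepKernel G ρ) A (TwoHeavy G u M) (fun _ => 1) n (v₀, []) ≤
      C * θ ^ m * hit G (stepKernel G ρ) A (TwoHeavy G u (2 ^ i)) (fun _ => 1) n (v₀, []) := by
    intro u hu
    refine (hit_le_hit_hit G (Q₁ := TwoHeavy G u (2 ^ i)) hp (fun _ => zero_le_one)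
      (fun t ht => ht.anti ((Nat.pow_le_pow_right (by norm_num) (Nat.le_add_right i m)).trans hM))
      n _).trans ?_
    rw [← hit_const_mul]
    refine hit_le_hit G (Inv := fun t => ¬ TwoHeavy G u (2 ^ i + 1) t ∧ harmonicSum t ≤ Λ + 1) hp
      (fun t _ h1 h2 z _ => ⟨not_twoHeavy_push h1 z, (hAlive t h2).harmonicSum_push_le z⟩)
      (fun _ h => h) (fun _ => by positivity) (fun t h1 h2 => ?_) n _ ⟨?_, ?_⟩
    · rw [mul_one]
      refine (hit_le_hit G (Inv := fun _ => True) hp (fun _ _ _ _ _ _ => trivial) hAlive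
        (fun _ => zero_le_one) (fun _ _ _ => le_rfl) n t trivial).trans ?_
      exact h i m M ((le_max_left _ _).trans hi) hM hM' u (hD u) _ k Λ
        (ballFinset_mono v₀ (Nat.le_succ k) hu) (fun z hz => mem_ballFinset_succ hu hz) hΛ t
        ⟨h2, h1.1, h1.2⟩ n
    · rintro ⟨a, b, _, _, _, h1, _⟩
      have : wt ((v₀, []) : Hist V) s(u, a) = 1 := rfl
      omega
    · change (0 : ℝ) ≤ Λ + 1
      linarith
  refine (Finset.sum_le_sum hstep).trans ?_
  rw [← Finset.mul_sum, mul_comm]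
  refine mul_le_mul_of_nonneg_right ?_ (by positivity)
  have hsub : ∀ t : Hist V,
      ((ballFinset G v₀ k).filter fun u => TwoHeavy G u (2 ^ i) t).card ≤ (visited t).card :=
    fun t => Finset.card_le_card fun u hu => (Finset.mem_filter.1 hu).2.mem_visited h2i
  have := sum_hit_le (ρ := ρ) hnb (A := A) (ballFinset G v₀ k)
    (Q := fun u => TwoHeavy G u (2 ^ i)) (fun u s z hu => hu.push z) (c := r + 1)
    (fun s hs z _ => (hsub _).trans ((card_visited_push_le s z).trans (by
      have := hs.2.2
      omega))) n (v₀, []) ((hsub _).trans (by simp [visited]))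
  simpa using this

end Spread

/-! ### From hitting expectations to probabilities of the process -/

section Bridge

variable {V : Type*}

/-- The history at time `n` of a trajectory. -/
def histOf (x : ℕ → V) : ℕ → Hist V
  | 0 => (x 0, [])
  | n + 1 => push (histOf x n) (x (n + 1))

theorem histOf_fst (x : ℕ → V) (n : ℕ) : (histOf x n).1 = x n := by
  cases n <;> rfl

theorem histOf_length (x : ℕ → V) (n : ℕ) : (histOf x n).2.length = n := by
  induction n with
  | zero => rfl
  | succ n ih => simp [histOf, ih]

theorem histOf_congr {x y : ℕ → V} {n : ℕ} (h : ∀ i ≤ n, x i = y i) : histOf x n = histOf y n := by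
  induction n with
  | zero => simp [histOf, h 0 le_rfl]
  | succ n ih => rw [histOf, histOf, ih fun i hi => h i (by omega), h (n + 1) le_rfl]

theorem reach_histOf {G : SimpleGraph V} {x : ℕ → V} (h : ∀ n, G.Adj (x n) (x (n + 1))) (n : ℕ) :
    Reach G (x 0) (histOf x n) := by
  induction n with
  | zero => exact Reach.init
  | succ n ih => exact Reach.step ih (by rw [histOf_fst]; exact h n)

theorem edgeWeight_eq_wt (x : ℕ → V) (n : ℕ) (e : Sym2 V) :
    edgeWeight (fun _ => 1) x n e = wt (histOf x n) e := by
  classical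
  unfold edgeWeight
  induction n with
  | zero => simp [histOf, wt, wtAux]
  | succ n ih =>
    rw [histOf, wt_push, ← ih, histOf_fst, add_assoc]
    congr 1
    have hfin : ∀ n, {i : ℕ | i < n ∧ s(x i, x (i + 1)) = e}.Finite := fun n =>
      (Set.finite_lt_nat n).subset fun i hi => hi.1
    split_ifs with h
    · have : {i : ℕ | i < n + 1 ∧ s(x i, x (i + 1)) = e} =
          insert n {i : ℕ | i < n ∧ s(x i, x (i + 1)) = e} := by
        ext i
        simp only [Set.mem_ofPred_eq, Set.mem_insert_iff]
        constructor
        · rintro ⟨h1, h2⟩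
          by_cases hin : i = n
          · exact Or.inl hin
          · exact Or.inr ⟨by omega, h2⟩
        · rintro (rfl | ⟨h1, h2⟩)
          · exact ⟨by omega, h⟩
          · exact ⟨by omega, h2⟩
      rw [this, Set.ncard_insert_of_notMem (fun h => lt_irrefl _ h.1) (hfin n)]
    · rw [add_zero]
      congr 1
      ext i
      simp only [Set.mem_ofPred_eq]
      constructor
      · rintro ⟨h1, h2⟩
        refine ⟨?_, h2⟩
        by_contra hcon
        obtain rfl : i = n := by omega
        exact h h2
      · rintro ⟨h1, h2⟩
        exact ⟨by omega, h2⟩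

variable {G : SimpleGraph V} [G.LocallyFinite]

theorem stepProb_eq (ρ : ℝ) (x : ℕ → V) (n : ℕ) {v : V} (h : G.Adj (x n) v) :
    stepProb G (fun k : ℕ => (k : ℝ) ^ ρ) (fun _ => 1) x n v = stepKernel G ρ (histOf x n) v := by
  unfold stepProb stepKernel totalWeight
  rw [if_pos h]
  simp only [edgeWeight_eq_wt]
  have : ∀ u, u = x n → ∑ y ∈ G.neighborFinset (x n), (wt (histOf x n) s(x n, y) : ℝ) ^ ρ =
      ∑ y ∈ G.neighborFinset u, (wt (histOf x n) s(u, y) : ℝ) ^ ρ := by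
    rintro _ rfl; rfl
  rw [this _ (histOf_fst x n), histOf_fst]

variable {Ω : Type*}

/-- The set of outcomes whose trajectory agrees with `x` up to time `n`. -/
def pathCylinder (I : ℕ → Ω → V) (x : ℕ → V) (n : ℕ) : Set Ω := {ω | ∀ i ≤ n, I i ω = x i}

theorem histOf_eq_of_mem_cylinder {I : ℕ → Ω → V} {x : ℕ → V} {n : ℕ} {ω : Ω}
    (h : ω ∈ pathCylinder I x n) : histOf (fun i => I i ω) n = histOf x n := histOf_congr h

variable [MeasurableSpace Ω] {μ : Measure Ω} [IsProbabilityMeasure μ] {I : ℕ → Ω → V} {ρ : ℝ}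
  {v₀ : V}

theorem measurableSet_cylinder (H : IsERRW G (fun k : ℕ => (k : ℝ) ^ ρ) (fun _ => 1) v₀ μ I)
    (x : ℕ → V) (n : ℕ) : MeasurableSet (pathCylinder I x n) := by
  have : pathCylinder I x n = ⋂ i ∈ Set.Iic n, {ω | I i ω = x i} := by
    ext ω; simp [pathCylinder]
  rw [this]
  exact MeasurableSet.biInter (Set.finite_Iic n).countable fun i _ => H.measurableSet_eq i (x i)

open Classical in
theorem update_cylinder (x : ℕ → V) (n : ℕ) (y : V) :
    pathCylinder I (Function.update x (n + 1) y) (n + 1) = pathCylinder I x n ∩ {ω | I (n + 1) ω = y} := by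
  ext ω
  simp only [pathCylinder, Set.mem_ofPred_eq, Set.mem_inter_iff]
  constructor
  · intro h
    refine ⟨fun i hi => ?_, by simpa using h (n + 1) le_rfl⟩
    have := h i (by omega)
    rwa [Function.update_of_ne (by omega)] at this
  · rintro ⟨h1, h2⟩ i hi
    by_cases hin : i = n + 1
    · subst hin; simpa using h2
    · rw [Function.update_of_ne hin]; exact h1 i (by omega)

open Classical in
theorem histOf_update (x : ℕ → V) (n : ℕ) (y : V) :
    histOf (Function.update x (n + 1) y) (n + 1) = push (histOf x n) y := by
  rw [histOf, Function.update_self]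
  congr 1
  exact histOf_congr fun i hi => Function.update_of_ne (by omega) _ _

open Classical in
theorem measureReal_cylinder_update
    (H : IsERRW G (fun k : ℕ => (k : ℝ) ^ ρ) (fun _ => 1) v₀ μ I) (x : ℕ → V) (n : ℕ) {y : V}
    (h : G.Adj (x n) y) : μ.real (pathCylinder I (Function.update x (n + 1) y) (n + 1)) =
      μ.real (pathCylinder I x n) * stepKernel G ρ (histOf x n) y := by
  have h1 := H.transition n (Function.update x (n + 1) y)
  have h2 : {ω | ∀ i ≤ n, I i ω = Function.update x (n + 1) y i} = pathCylinder I x n := by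
    ext ω
    simp only [pathCylinder, Set.mem_ofPred_eq]
    refine forall₂_congr fun i hi => ?_
    rw [Function.update_of_ne (by omega)]
  have h3 : Function.update x (n + 1) y n = x n := Function.update_of_ne (by omega) _ _
  rw [h2, Function.update_self, stepProb_eq ρ _ _ (by rw [h3]; exact h)] at h1
  refine h1.trans ?_
  congr 2
  exact histOf_congr fun i hi => Function.update_of_ne (by omega) _ _

open Classical in
/-- Conditioning on the next step. -/
theorem measureReal_cylinder_inter_le
    (H : IsERRW G (fun k : ℕ => (k : ℝ) ^ ρ) (fun _ => 1) v₀ μ I) (x : ℕ → V) (n : ℕ) {z : V}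
    (hz : G.Adj (x n) z) (E : Set Ω) :
    μ.real (pathCylinder I x n ∩ E) ≤ ∑ y ∈ G.neighborFinset (x n),
      μ.real (pathCylinder I (Function.update x (n + 1) y) (n + 1) ∩ E) := by
  set S : V → Set Ω := fun y => pathCylinder I (Function.update x (n + 1) y) (n + 1) with hS
  have hsub : ∀ y, S y ⊆ pathCylinder I x n := fun y => by
    simp only [hS]; rw [update_cylinder]; exact Set.inter_subset_left
  have hmeas : ∀ y, MeasurableSet (S y) := fun y => measurableSet_cylinder H _ _
  have hunion : μ.real (⋃ y ∈ G.neighborFinset (x n), S y) = μ.real (pathCylinder I x n) := by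
    rw [measureReal_biUnion_finset]
    · rw [Finset.sum_congr rfl fun y hy =>
        measureReal_cylinder_update H x n (by simpa using hy : G.Adj (x n) y), ← Finset.mul_sum]
      have := sum_stepKernel ρ (histOf x n) (z := z) (by rw [histOf_fst]; exact hz)
      rw [histOf_fst] at this
      rw [this, mul_one]
    · intro y _ y' _ hyy
      refine Set.disjoint_left.2 fun ω h1 h2 => hyy ?_
      simp only [hS] at h1 h2
      rw [update_cylinder] at h1 h2
      exact h1.2.symm.trans h2.2
    · exact fun y _ => hmeas y
  -- The step probabilities to the neighbours sum to one, so a step to a non-neighbour is a null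
  -- event. The set `E` itself need not be measurable.
  have hnull : μ.real (pathCylinder I x n \ ⋃ y ∈ G.neighborFinset (x n), S y) = 0 := by
    rw [measureReal_sdiff (Set.iUnion₂_subset fun y _ => hsub y)
      (Finset.measurableSet_biUnion _ fun y _ => hmeas y), hunion, sub_self]
  calc μ.real (pathCylinder I x n ∩ E)
      ≤ μ.real ((⋃ y ∈ G.neighborFinset (x n), S y ∩ E) ∪
        (pathCylinder I x n \ ⋃ y ∈ G.neighborFinset (x n), S y)) := by
        refine measureReal_mono ?_
        rintro ω ⟨h1, h2⟩
        by_cases h : ω ∈ ⋃ y ∈ G.neighborFinset (x n), S y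
        · obtain ⟨y, hy, h3⟩ := Set.mem_iUnion₂.1 h
          exact Or.inl (Set.mem_iUnion₂.2 ⟨y, hy, h3, h2⟩)
        · exact Or.inr ⟨h1, h⟩
    _ ≤ μ.real (⋃ y ∈ G.neighborFinset (x n), S y ∩ E) + 0 := by
        rw [← hnull]; exact measureReal_union_le _ _
    _ ≤ _ := by
        rw [add_zero]; exact measureReal_biUnion_finset_le _ _

/-- The event that the walk meets `Q` within `m` steps after time `n`, and `A` before. -/
def meets (I : ℕ → Ω → V) (A Q : Hist V → Prop) (n m : ℕ) : Set Ω :=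
  {ω | ∃ t ≤ m, Q (histOf (fun i => I i ω) (n + t)) ∧
    ∀ j < t, A (histOf (fun i => I i ω) (n + j))}

/-- Hitting expectations bound probabilities on the underlying probability space. -/
theorem measureReal_inter_meets_le
    (H : IsERRW G (fun k : ℕ => (k : ℝ) ^ ρ) (fun _ => 1) v₀ μ I) (hnb : ∀ x, ∃ z, G.Adj x z)
    {A Q : Hist V → Prop} {F : Hist V → ℝ} {E : Set Ω} {N : ℕ}
    (hE : ∀ n ≤ N, ∀ x, Q (histOf x n) →
      μ.real (pathCylinder I x n ∩ E) ≤ μ.real (pathCylinder I x n) * F (histOf x n)) (m n : ℕ)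
    (x : ℕ → V) (hmn : n + m ≤ N) :
    μ.real (pathCylinder I x n ∩ (E ∩ meets I A Q n m)) ≤
      μ.real (pathCylinder I x n) * hit G (stepKernel G ρ) A Q F m (histOf x n) := by
  classical
  induction m generalizing n x with
  | zero =>
    by_cases hQ : Q (histOf x n)
    · rw [hit_of_mem G hQ]
      exact (measureReal_mono (Set.inter_subset_inter_right _ Set.inter_subset_left)).trans
        (hE n (by omega) x hQ)
    · rw [hit_zero_of_not G hQ, mul_zero]
      refine le_of_eq ?_
      convert measureReal_empty (μ := μ)
      refine Set.eq_empty_of_forall_notMem ?_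
      rintro ω ⟨h1, _, t, ht, h2, _⟩
      obtain rfl : t = 0 := by omega
      rw [add_zero, histOf_eq_of_mem_cylinder h1] at h2
      exact hQ h2
  | succ m ih =>
    by_cases hQ : Q (histOf x n)
    · rw [hit_of_mem G hQ]
      exact (measureReal_mono (Set.inter_subset_inter_right _ Set.inter_subset_left)).trans
        (hE n (by omega) x hQ)
    by_cases hA : A (histOf x n)
    swap
    · rw [hit_of_not_mem G hQ hA, mul_zero]
      refine le_of_eq ?_
      convert measureReal_empty (μ := μ)
      refine Set.eq_empty_of_forall_notMem ?_
      rintro ω ⟨h1, _, t, ht, h2, h3⟩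
      rcases Nat.eq_zero_or_pos t with rfl | htp
      · rw [add_zero, histOf_eq_of_mem_cylinder h1] at h2
        exact hQ h2
      · have := h3 0 htp
        rw [add_zero, histOf_eq_of_mem_cylinder h1] at this
        exact hA this
    obtain ⟨z, hz⟩ := hnb (x n)
    rw [hit_succ_of_not G hQ hA, histOf_fst, Finset.mul_sum]
    refine (measureReal_cylinder_inter_le H x n hz _).trans (Finset.sum_le_sum fun y hy => ?_)
    have h1 := ih (n + 1) (Function.update x (n + 1) y) (by omega)
    rw [histOf_update, measureReal_cylinder_update H x n (by simpa using hy), mul_assoc] at h1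
    refine le_trans (measureReal_mono ?_) h1
    rintro ω ⟨h2, h3, t, ht, h4, h5⟩
    refine ⟨h2, h3, ?_⟩
    have h6 : ω ∈ pathCylinder I x n := by
      rw [update_cylinder] at h2; exact h2.1
    rcases Nat.eq_zero_or_pos t with rfl | htp
    · rw [add_zero, histOf_eq_of_mem_cylinder h6] at h4
      exact absurd h4 hQ
    · refine ⟨t - 1, by omega, ?_, fun j hj => ?_⟩
      · rwa [show n + 1 + (t - 1) = n + t by omega]
      · have := h5 (j + 1) (by omega)
        rwa [show n + 1 + j = n + (j + 1) by ring]

theorem measureReal_cylinder_inter_meets_le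
    (H : IsERRW G (fun k : ℕ => (k : ℝ) ^ ρ) (fun _ => 1) v₀ μ I) (hnb : ∀ x, ∃ z, G.Adj x z)
    {A Q : Hist V → Prop} (n m : ℕ) (x : ℕ → V) :
    μ.real (pathCylinder I x n ∩ meets I A Q n m) ≤
      μ.real (pathCylinder I x n) * hit G (stepKernel G ρ) A Q (fun _ => 1) m (histOf x n) := by
  have := measureReal_inter_meets_le H hnb (A := A) (Q := Q) (F := fun _ => 1)
    (E := Set.univ) (N := n + m) (fun n _ x _ => by simp) m n x le_rfl
  rwa [Set.univ_inter] at this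

theorem measureReal_le_cylinder_zero
    (H : IsERRW G (fun k : ℕ => (k : ℝ) ^ ρ) (fun _ => 1) v₀ μ I) (E : Set Ω) :
    μ.real E ≤ μ.real (pathCylinder I (fun _ => v₀) 0 ∩ E) := by
  have h0 : μ.real ((pathCylinder I (fun _ => v₀) 0)ᶜ) = 0 := by
    rw [measureReal_def, ENNReal.toReal_eq_zero_iff]
    left
    refine measure_mono_null ?_ (ae_iff.1 H.initial)
    intro ω hω h
    exact hω fun i hi => by rw [Nat.le_zero.1 hi]; exact h
  calc μ.real E ≤ μ.real (pathCylinder I (fun _ => v₀) 0 ∩ E ∪ (pathCylinder I (fun _ => v₀) 0)ᶜ) :=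
        measureReal_mono fun ω hω => by
          by_cases h : ω ∈ pathCylinder I (fun _ => v₀) 0
          · exact Or.inl ⟨h, hω⟩
          · exact Or.inr h
    _ ≤ _ := (measureReal_union_le _ _).trans (by rw [h0, add_zero])

theorem measureReal_meets_le
    (H : IsERRW G (fun k : ℕ => (k : ℝ) ^ ρ) (fun _ => 1) v₀ μ I) (hnb : ∀ x, ∃ z, G.Adj x z)
    (A Q : Hist V → Prop) (m : ℕ) :
    μ.real (meets I A Q 0 m) ≤ hit G (stepKernel G ρ) A Q (fun _ => 1) m (v₀, []) := by
  refine (measureReal_le_cylinder_zero H _).trans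
    ((measureReal_cylinder_inter_meets_le H hnb 0 m fun _ => v₀).trans ?_)
  exact mul_le_of_le_one_left
    (hit_nonneg G (fun s z => stepKernel_nonneg G ρ s z) (fun _ => zero_le_one) _ _)
    measureReal_le_one

/-- Almost surely, the walk is a path of the graph. -/
theorem ae_adj (H : IsERRW G (fun k : ℕ => (k : ℝ) ^ ρ) (fun _ => 1) v₀ μ I)
    (hnb : ∀ x, ∃ z, G.Adj x z) : ∀ᵐ ω ∂μ, ∀ n, G.Adj (I n ω) (I (n + 1) ω) := by
  have hnull : ∀ m, μ (meets I (fun _ => True) (fun s => ¬ Reach G v₀ s) 0 m) = 0 := fun m => by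
    have h1 := measureReal_meets_le H hnb (fun _ => True) (fun s => ¬ Reach G v₀ s) m
    have h2 := hit_le_const G (p := stepKernel G ρ) (A := fun _ => True)
      (Q := fun s => ¬ Reach G v₀ s) (F := fun _ => 1) (Inv := fun s => Reach G v₀ s)
      (fun s z => stepKernel_nonneg G ρ s z) (fun s _ => sum_stepKernel_le G ρ s)
      (fun s h _ _ y hy => h.step hy) le_rfl (fun s h h' => absurd h h') m (v₀, []) Reach.init
    have h3 := le_antisymm (h1.trans h2) measureReal_nonneg
    exact (measureReal_eq_zero_iff).1 h3
  have : ∀ᵐ ω ∂μ, ∀ n, Reach G v₀ (histOf (fun i => I i ω) n) := by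
    refine ae_all_iff.2 fun n => ?_
    rw [ae_iff]
    refine measure_mono_null ?_ (hnull n)
    intro ω hω
    exact ⟨n, le_rfl, by rw [zero_add]; exact hω, fun _ _ => trivial⟩
  filter_upwards [this] with ω hω n
  have h := hω (n + 1)
  rw [histOf] at h
  generalize ht : push (histOf (fun i => I i ω) n) (I (n + 1) ω) = t at h
  cases h with
  | init => simp [push] at ht
  | @step s y h1 h2 =>
    have h3 := congrArg Prod.fst ht
    have h4 := congrArg Prod.snd ht
    simp only [push_fst, push_snd, List.cons.injEq, histOf_fst] at h3 h4
    rw [h3, h4.1]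
    exact h2

end Bridge

/-! ### Traps and the combination of the bad events -/

section Final

variable {V : Type*} {G : SimpleGraph V} [G.LocallyFinite]

/-- The walk sits at an edge of weight at least `L` whose adjacent edges have weight at most `M`. -/
def Trap (G : SimpleGraph V) (M L : ℕ) (s : Hist V) : Prop :=
  ∃ b, G.Adj s.1 b ∧ L ≤ wt s s(s.1, b) ∧ (∀ z, G.Adj s.1 z → z ≠ b → wt s s(s.1, z) ≤ M) ∧
    ∀ z, G.Adj b z → z ≠ s.1 → wt s s(b, z) ≤ M

/-- The bound on the probability of leaving a trap. -/
def escapeProb (ρ : ℝ) (D M L : ℕ) : ℝ :=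
  1 - Real.exp (-(D * (M : ℝ) ^ ρ * (tailConst ρ * (L : ℝ) ^ (1 - ρ))))

theorem escapeProb_nonneg {ρ : ℝ} (hρ : 1 < ρ) (D M L : ℕ) : 0 ≤ escapeProb ρ D M L := by
  have := tailConst_pos hρ
  rw [escapeProb, sub_nonneg, Real.exp_le_one_iff, neg_nonpos]
  positivity

theorem escapeProb_lt_one (ρ : ℝ) (D M L : ℕ) : escapeProb ρ D M L < 1 :=
  sub_lt_self _ (Real.exp_pos _)

variable {Ω : Type*}

/-- The event that the edge traversed changes after time `k`. -/
def switches (I : ℕ → Ω → V) (k : ℕ) : Set Ω :=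
  {ω | ∃ n ≥ k, s(I n ω, I (n + 1) ω) ≠ s(I (n + 1) ω, I (n + 2) ω)}

theorem setOf_lt_attractionTime_subset (I : ℕ → Ω → V) (k : ℕ) :
    {ω | (k : ℕ∞) < attractionTime (fun n => I n ω)} ⊆ switches I k := by
  intro ω hω
  by_contra hcon
  have h : ∀ n ≥ k, s(I n ω, I (n + 1) ω) = s(I (n + 1) ω, I (n + 2) ω) := by
    intro n hn
    by_contra hne
    exact hcon ⟨n, hn, hne⟩
  have h2 : attractionTime (fun n => I n ω) ≤ (k : ℕ∞) := iInf₂_le k h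
  exact absurd hω (not_lt.2 h2)

variable [MeasurableSpace Ω] {μ : Measure Ω} [IsProbabilityMeasure μ] {I : ℕ → Ω → V} {ρ : ℝ}
  {v₀ : V}

/-- Traps are rarely left. -/
theorem Trap.measureReal_inter_switches_le (hρ : 1 < ρ)
    (H : IsERRW G (fun k : ℕ => (k : ℝ) ^ ρ) (fun _ => 1) v₀ μ I) (hnb : ∀ x, ∃ z, G.Adj x z)
    {D : ℕ} (hD : ∀ u, G.degree u ≤ D) {M L : ℕ} (hL : 1 ≤ L) {n k : ℕ} (hnk : n ≤ k)
    {x : ℕ → V} (ht : Trap G M L (histOf x n)) :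
    μ.real (pathCylinder I x n ∩ switches I k) ≤
      μ.real (pathCylinder I x n) * escapeProb ρ D M L := by
  obtain ⟨b, hab, hLb, ha, hb⟩ := ht
  set a := (histOf x n).1 with had
  have hxa : x n = a := (histOf_fst x n).symm
  -- Crossing `a b` leaves the adjacent weights unchanged, so `P` persists as long as the walk only
  -- crosses this edge. Conversely, almost surely, if `P` never fails then no other edge is ever
  -- used.
  set P : Hist V → Prop := fun t => (t.1 = a ∨ t.1 = b) ∧
    (∀ z, G.Adj a z → z ≠ b → wt t s(a, z) ≤ M) ∧
    ∀ z, G.Adj b z → z ≠ a → wt t s(b, z) ≤ M with hP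
  have hhit : ∀ m, hit G (stepKernel G ρ) (fun _ => True) (fun t => ¬ P t) (fun _ => 1) m
      (histOf x n) ≤ escapeProb ρ D M L := by
    intro m
    refine hit_le_of_bounce (e := s(a, b)) (P := P) hρ hD ?_ (fun t h h' => h' h) (fun _ => le_rfl)
      hL ⟨Or.inl rfl, ha, hb⟩ hLb m
    rintro t ⟨hpos | hpos, h3, h4⟩
    · refine ⟨b, by rw [hpos], by rw [hpos]; exact hab,
        fun z hz hzb => by rw [hpos] at hz ⊢; exact h3 z hz hzb, Or.inr rfl, ?_, ?_⟩
      · intro z hz hzb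
        rw [wt_push_of_ne]
        · exact h3 z hz hzb
        · rw [hpos]; exact fun he => hzb (Sym2.congr_right.1 he).symm
      · intro z hz hza
        rw [wt_push_of_ne]
        · exact h4 z hz hza
        · rw [hpos, Sym2.eq_swap]; exact fun he => hza (Sym2.congr_right.1 he).symm
    · refine ⟨a, by rw [hpos, Sym2.eq_swap], by rw [hpos]; exact hab.symm,
        fun z hz hza => by rw [hpos] at hz ⊢; exact h4 z hz hza, Or.inl rfl, ?_, ?_⟩
      · intro z hz hzb
        rw [wt_push_of_ne]
        · exact h3 z hz hzb
        · rw [hpos, Sym2.eq_swap]; exact fun he => hzb (Sym2.congr_right.1 he).symm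
      · intro z hz hza
        rw [wt_push_of_ne]
        · exact h4 z hz hza
        · rw [hpos]; exact fun he => hza (Sym2.congr_right.1 he).symm
  set S : ℕ → Set Ω := fun m => pathCylinder I x n ∩ meets I (fun _ => True) (fun t => ¬ P t) n m
    with hS
  set c := μ.real (pathCylinder I x n) * escapeProb ρ D M L with hc
  have hc0 : 0 ≤ c := mul_nonneg measureReal_nonneg (escapeProb_nonneg hρ D M L)
  have hSle : ∀ m, μ (S m) ≤ ENNReal.ofReal c := fun m => by
    rw [← ofReal_measureReal]
    refine ENNReal.ofReal_le_ofReal ?_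
    exact (measureReal_cylinder_inter_meets_le H hnb n m x).trans
      (mul_le_mul_of_nonneg_left (hhit m) measureReal_nonneg)
  have hmono : Monotone S := fun m m' hm => Set.inter_subset_inter_right _
    fun ω ⟨t, ht, h⟩ => ⟨t, ht.trans hm, h⟩
  have hunion : μ (⋃ m, S m) ≤ ENNReal.ofReal c := by
    rw [hmono.measure_iUnion]; exact iSup_le hSle
  have hle : μ (pathCylinder I x n ∩ switches I k) ≤ μ (⋃ m, S m) := by
    refine measure_mono_ae ?_
    filter_upwards [ae_adj H hnb] with ω hadj hω
    obtain ⟨h1, N, hN, hne⟩ := hω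
    by_contra hcon
    have hPt : ∀ t, P (histOf (fun i => I i ω) (n + t)) := by
      intro t
      by_contra hPt
      exact hcon (Set.mem_iUnion.2 ⟨t, h1, t, le_rfl, hPt, fun _ _ => trivial⟩)
    have hedge : ∀ j, n ≤ j → s(I j ω, I (j + 1) ω) = s(a, b) := by
      intro j hj
      obtain ⟨t, rfl⟩ := Nat.exists_eq_add_of_le hj
      have h2 := (hPt t).1
      have h3 := (hPt (t + 1)).1
      rw [histOf_fst] at h2 h3
      have h4 := hadj (n + t)
      rw [← add_assoc] at h3
      rcases h2 with h2 | h2 <;> rcases h3 with h3 | h3 <;> rw [h2, h3] at h4 ⊢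
      · exact absurd rfl h4.ne
      · exact Sym2.eq_swap
      · exact absurd rfl h4.ne
    exact hne ((hedge N (hnk.trans hN)).trans (hedge (N + 1) (by omega)).symm)
  rw [measureReal_def]
  exact ENNReal.toReal_le_of_le_ofReal hc0 (hle.trans hunion)

/-- The edge traversed changes with probability bounded away from one. -/
theorem measureReal_switches_le_const (hρ : 1 < ρ)
    (H : IsERRW G (fun k : ℕ => (k : ℝ) ^ ρ) (fun _ => 1) v₀ μ I) (hnb : ∀ x, ∃ z, G.Adj x z)
    {D : ℕ} (hD : ∀ u, G.degree u ≤ D) (k : ℕ) : μ.real (switches I k) ≤ escapeProb ρ D 1 1 := by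
  obtain ⟨b, hb⟩ := hnb v₀
  have ht : Trap G 1 1 (histOf (fun _ => v₀) 0) :=
    ⟨b, hb, le_rfl, fun _ _ _ => le_rfl, fun _ _ _ => le_rfl⟩
  refine (measureReal_le_cylinder_zero H _).trans
    ((ht.measureReal_inter_switches_le hρ H hnb hD le_rfl (Nat.zero_le k)).trans ?_)
  exact mul_le_of_le_one_left (escapeProb_nonneg hρ D 1 1) measureReal_le_one

/-- If few vertices were visited and no vertex has two heavy edges, the walk was trapped. -/
theorem exists_trap {x : ℕ → V} (hx : ∀ n, G.Adj (x n) (x (n + 1))) {D M L r k : ℕ}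
    (hD : ∀ u, G.degree u ≤ D) (hL : 1 ≤ L) (hML : M ≤ L) (hk : r * (D * L) < k)
    (hr : (visited (histOf x k)).card ≤ r)
    (hM : ∀ t ≤ k, ∀ u, ¬ TwoHeavy G u M (histOf x t)) : ∃ t ≤ k, Trap G M L (histOf x t) := by
  by_contra hcon
  push Not at hcon
  -- An edge of weight `L ≥ M` at the walker would be a trap, since neither endpoint has a second
  -- edge of weight `M`. Without traps no weight can pass `L`, and then `r * (D * L)` bounds the
  -- length of the walk.
  have hlt : ∀ t ≤ k, ∀ z, G.Adj (x t) z → wt (histOf x t) s(x t, z) < L := by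
    intro t ht z hz
    by_contra hle
    push Not at hle
    refine hcon t ht ⟨z, ?_⟩
    rw [histOf_fst]
    refine ⟨hz, hle, fun w hw hwz => ?_, fun w hw hwx => ?_⟩
    · by_contra hw'
      exact hM t ht (x t) ⟨z, w, hwz.symm, hz, hw, by omega, by omega⟩
    · by_contra hw'
      exact hM t ht z ⟨x t, w, hwx.symm, hz.symm, hw, by rw [Sym2.eq_swap]; omega, by omega⟩
  have hle : ∀ t ≤ k, ∀ e, wt (histOf x t) e ≤ L := by
    intro t
    induction t with
    | zero => exact fun _ _ => hL
    | succ t ih =>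
      intro ht e
      rw [histOf]
      by_cases he : s((histOf x t).1, x (t + 1)) = e
      · rw [← he, wt_push_self, histOf_fst]
        exact hlt t (by omega) _ (hx t)
      · rw [wt_push_of_ne _ he]
        exact ih (by omega) e
  have h1 := (reach_histOf hx k).length_le
  rw [histOf_length] at h1
  have h2 : ∑ u ∈ visited (histOf x k), degWt G u (histOf x k) ≤
      (visited (histOf x k)).card • (D * L) := by
    refine Finset.sum_le_card_nsmul _ _ _ fun u _ => ?_
    calc degWt G u (histOf x k) ≤ (G.neighborFinset u).card • L :=
          Finset.sum_le_card_nsmul _ _ _ fun a _ => hle k le_rfl _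
      _ ≤ D * L := by rw [smul_eq_mul]; exact Nat.mul_le_mul_right _ (hD u)
  rw [smul_eq_mul] at h2
  have h3 := Nat.mul_le_mul_right (D * L) hr
  omega

/-- The main estimate, in terms of all parameters. -/
theorem exists_measureReal_switches_le (hρ : 1 < ρ) {D : ℕ} (hD : ∀ u, G.degree u ≤ D)
    (hnb : ∀ x, ∃ z, G.Adj x z) : ∃ C : ℝ, 0 < C ∧ ∃ θ : ℝ, 0 < θ ∧ θ < 1 ∧ ∃ i₀ : ℕ,
    ∀ (i m M L R r k : ℕ) (_ : i₀ ≤ i) (_ : 2 ^ (i + m) ≤ M) (_ : 2 ≤ M) (_ : M ≤ L)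
      (_ : r = 1 + (2 * R + 1) * D)
      (_ : 2 * tailConst ρ * ((2 ^ (i + m) : ℕ) : ℝ) ^ (ρ - 1 / 2) ≤ (M : ℝ) ^ (ρ - 1))
      (_ : (r : ℝ) * (D * Real.log (k + 1)) ≤ ((2 ^ i : ℕ) : ℝ) ^ (1 / 2 : ℝ))
      (_ : r * (D * L) < k) (v₀ : V) (Ω : Type*) [MeasurableSpace Ω] (μ : Measure Ω)
      [IsProbabilityMeasure μ] (I : ℕ → Ω → V),
      IsERRW G (fun k : ℕ => (k : ℝ) ^ ρ) (fun _ => 1) v₀ μ I →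
      μ.real (switches I k) ≤
        escapeProb ρ D 2 1 ^ R + (r + 1) * (C * θ ^ m) + escapeProb ρ D M L := by
  obtain ⟨C, hC, θ, hθ0, hθ1, i₀, h⟩ := exists_sum_hit_twoHeavy_le hρ D hD hnb
  refine ⟨C, hC, θ, hθ0, hθ1, i₀, ?_⟩
  intro i m M L R r k hi hM hM2 hML hr hM' hΛ hk v₀ Ω _ μ _ I H
  set A : Hist V → Prop :=
    fun t => Reach G v₀ t ∧ t.2.length ≤ k ∧ (visited t).card ≤ r with hA
  -- The three ways for the traversed edge to change after time `k`: too many open vertices, two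
  -- heavy edges at one vertex, or a trap that is left again.
  set E₁ := meets I (fun _ => True) (fun t => 2 * R + 2 ≤ (openSet G t).card) 0 k with hE₁
  set E₂ := ⋃ u ∈ ballFinset G v₀ k, meets I A (TwoHeavy G u M) 0 k with hE₂
  set E₃ := switches I k ∩ meets I (fun _ => True) (Trap G M L) 0 k with hE₃
  have hcover : μ.real (switches I k) ≤ μ.real (E₁ ∪ E₂ ∪ E₃) := by
    rw [measureReal_def, measureReal_def]
    refine ENNReal.toReal_mono (measure_ne_top _ _) (measure_mono_ae ?_)
    filter_upwards [ae_adj H hnb, H.initial] with ω hadj h0 hω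
    by_contra hcon
    set x : ℕ → V := fun i => I i ω with hx
    have hreach : ∀ t, Reach G v₀ (histOf x t) := fun t => by
      have := reach_histOf (G := G) (x := x) hadj t
      rwa [show x 0 = v₀ from h0] at this
    have hvis : ∀ t ≤ k, (visited (histOf x t)).card ≤ r := fun t ht => by
      refine ((hreach t).card_visited_le hD).trans ?_
      rw [hr]
      refine Nat.add_le_add_left (Nat.mul_le_mul_right _ ?_) _
      by_contra hcard
      exact hcon (Or.inl (Or.inl ⟨t, ht, by rw [zero_add]; change 2 * R + 2 ≤ (openSet G (histOf x t)).card; omega,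
        fun _ _ => trivial⟩))
    have htwo : ∀ t ≤ k, ∀ u, ¬ TwoHeavy G u M (histOf x t) := by
      intro t ht u hu
      have hub : u ∈ ballFinset G v₀ k := by
        have h1 := (hreach t).visited_subset (hu.mem_visited hM2)
        rw [histOf_length] at h1
        exact ballFinset_mono v₀ ht h1
      refine hcon (Or.inl (Or.inr (Set.mem_iUnion₂.2 ⟨u, hub, t, ht, ?_, fun j hj => ?_⟩)))
      · rw [zero_add]; exact hu
      · rw [zero_add]
        exact ⟨hreach j, by rw [histOf_length]; omega, hvis j (by omega)⟩
    obtain ⟨t, ht, htrap⟩ := exists_trap hadj hD (by omega) hML hk (hvis k le_rfl) htwo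
    exact hcon (Or.inr ⟨hω, t, ht, by rw [zero_add]; exact htrap, fun _ _ => trivial⟩)
  have h1 : μ.real E₁ ≤ escapeProb ρ D 2 1 ^ R :=
    (measureReal_meets_le H hnb _ _ k).trans (hit_openSet_le hρ hD v₀ R k)
  have h2 : μ.real E₂ ≤ (r + 1) * (C * θ ^ m) :=
    (measureReal_biUnion_finset_le _ _).trans ((Finset.sum_le_sum fun u _ =>
      measureReal_meets_le H hnb A (TwoHeavy G u M) k).trans (h i m M hi hM hM' k r hΛ v₀ k))
  have h3 : μ.real E₃ ≤ escapeProb ρ D M L := by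
    refine (measureReal_le_cylinder_zero H _).trans ((measureReal_inter_meets_le H hnb
      (F := fun _ => escapeProb ρ D M L) (N := k) (fun n hn x hx =>
        hx.measureReal_inter_switches_le hρ H hnb hD (by omega) hn) k 0 (fun _ => v₀)
        (by omega)).trans ?_)
    have hF0 := escapeProb_nonneg hρ D M L
    have h4 := hit_le_const G (p := stepKernel G ρ) (A := fun _ => True) (Q := Trap G M L)
      (Inv := fun _ => True) (fun s z => stepKernel_nonneg G ρ s z)
      (fun s _ => sum_stepKernel_le G ρ s) (fun _ _ _ _ _ _ => trivial) hF0
      (fun _ _ _ => le_rfl) k (histOf (fun _ => v₀) 0) trivial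
    have h5 := hit_nonneg G (p := stepKernel G ρ) (A := fun _ => True) (Q := Trap G M L)
      (F := fun _ => escapeProb ρ D M L) (fun s z => stepKernel_nonneg G ρ s z) (fun _ => hF0) k
      (histOf (fun _ => v₀) 0)
    exact (mul_le_of_le_one_left h5 measureReal_le_one).trans h4
  have h6 := measureReal_union_le (μ := μ) (E₁ ∪ E₂) E₃
  have h7 := measureReal_union_le (μ := μ) E₁ E₂
  linarith

end Final

/-! ### Choice of the parameters and conclusion -/

section Exponents

theorem cast_two_pow_rpow (n : ℕ) (t : ℝ) : ((2 ^ n : ℕ) : ℝ) ^ t = (2 : ℝ) ^ ((n : ℝ) * t) := by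
  rw [Nat.cast_pow, Nat.cast_ofNat, ← Real.rpow_natCast, ← Real.rpow_mul (by norm_num)]

theorem eventually_mul_pow_le (c : ℝ) (d : ℕ) {x ε : ℝ} (hx0 : 0 ≤ x) (hx1 : x < 1) (hε : 0 < ε) :
    ∀ᶠ q : ℕ in Filter.atTop, c * ((q : ℝ) ^ d * x ^ q) ≤ ε := by
  have h := (tendsto_pow_const_mul_const_pow_of_abs_lt_one d
    (by rwa [abs_of_nonneg hx0] : |x| < 1)).const_mul c
  rw [mul_zero] at h
  exact (h.eventually (gt_mem_nhds hε)).mono fun q hq => le_of_lt hq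

theorem exists_le_inv_rpow {X B : ℝ} (hX0 : 0 < X) (hX1 : X < 1) (hB : 1 ≤ B) :
    ∃ p : ℝ, 0 < p ∧ ∀ p', p' ≤ p → X ≤ (B ^ p')⁻¹ := by
  have hlogB := Real.log_nonneg hB
  have hlogX := Real.log_neg hX0 hX1
  refine ⟨-Real.log X / (Real.log B + 1), div_pos (by linarith) (by linarith), fun p' hp' => ?_⟩
  have h1 : p' * (Real.log B + 1) ≤ -Real.log X := (le_div_iff₀ (by linarith)).1 hp'
  have h2 : Real.log B * p' ≤ -Real.log X := by
    by_cases hp0 : 0 ≤ p'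
    · linarith
    · nlinarith
  rw [le_inv_comm₀ hX0 (by positivity), Real.rpow_def_of_pos (by linarith)]
  calc Real.exp (Real.log B * p') ≤ Real.exp (-Real.log X) := Real.exp_le_exp.2 h2
    _ = X⁻¹ := by rw [Real.exp_neg, Real.exp_log hX0]

theorem escapeProb_le {ρ : ℝ} (D M L : ℕ) :
    escapeProb ρ D M L ≤ D * tailConst ρ * ((M : ℝ) ^ ρ * (L : ℝ) ^ (1 - ρ)) := by
  unfold escapeProb
  have := Real.add_one_le_exp (-(D * (M : ℝ) ^ ρ * (tailConst ρ * (L : ℝ) ^ (1 - ρ))))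
  linarith

variable {V : Type*} {G : SimpleGraph V} [G.LocallyFinite]

set_option maxHeartbeats 1000000 in
theorem exists_measureReal_switches_le_pow {ρ : ℝ} (hρ : 1 < ρ) {D : ℕ} (hD : ∀ u, G.degree u ≤ D)
    (hnb : ∀ x, ∃ z, G.Adj x z) : ∃ N : ℕ, 1 ≤ N ∧ ∃ Θ : ℝ, 0 < Θ ∧ Θ < 1 ∧ ∃ q₀ : ℕ,
    ∀ (q k : ℕ) (_ : q₀ ≤ q) (_ : 2 ^ (N * q) ≤ k) (_ : k < 2 ^ (N * (q + 1)))
      (v₀ : V) (Ω : Type*) [MeasurableSpace Ω] (μ : Measure Ω)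
      [IsProbabilityMeasure μ] (I : ℕ → Ω → V),
      IsERRW G (fun k : ℕ => (k : ℝ) ^ ρ) (fun _ => 1) v₀ μ I →
      μ.real (switches I k) ≤ Θ ^ (q + 1) := by
  obtain ⟨C, hC, θ, hθ0, hθ1, i₀, h⟩ := exists_measureReal_switches_le hρ hD hnb
  have hρ1 : 0 < ρ - 1 := by linarith
  -- The scales are `M = 2 ^ (a * q)`, `L = 2 ^ (l * q)` and `k` of order `2 ^ ((l + 1) * q)`. The
  -- condition `a * (ρ - 1) ≥ 2 * ρ` makes `M ^ (ρ - 1)` dominate `2 ^ q * 2 ^ (2 * q * (ρ - 1/2))`,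
  -- and the summand `2` ensures `M ≥ 2 ^ (2 * q)`. The choice of `l` gives `M ^ ρ * L ^ (1 - ρ) ≤ 2
  -- ^ (-q)`.
  set a : ℕ := ⌈2 * ρ / (ρ - 1)⌉₊ + 2 with ha
  have haρ : 2 * ρ ≤ a * (ρ - 1) := by
    rw [← div_le_iff₀ hρ1, ha]
    push_cast
    linarith [Nat.le_ceil (2 * ρ / (ρ - 1))]
  set l : ℕ := ⌈(a * ρ + 1) / (ρ - 1)⌉₊ with hl
  have hlρ : a * ρ + 1 ≤ l * (ρ - 1) := by
    rw [← div_le_iff₀ hρ1]; exact Nat.le_ceil _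
  have hal : a ≤ l := by
    have h0 : (0 : ℝ) ≤ a := by positivity
    have : (a : ℝ) * (ρ - 1) ≤ l * (ρ - 1) := by nlinarith
    exact_mod_cast le_of_mul_le_mul_right this hρ1
  set κ := escapeProb ρ D 2 1 with hκ
  have hκ0 : 0 ≤ κ := escapeProb_nonneg hρ D 2 1
  have hκ1 : κ < 1 := escapeProb_lt_one ρ D 2 1
  set σ : ℝ := max κ (max θ (1 / 2)) with hσ
  have hσ1 : σ < 1 := max_lt hκ1 (max_lt hθ1 (by norm_num))
  have hσθ : θ ≤ σ := (le_max_left _ _).trans (le_max_right _ _)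
  have hσ2 : 1 / 2 ≤ σ := (le_max_right _ _).trans (le_max_right _ _)
  have hσκ : κ ≤ σ := le_max_left _ _
  have hσ0 : 0 < σ := by linarith
  -- The errors are of order `q * σ ^ q`. A rate strictly between `σ` and `1` absorbs the factor
  -- `q`, the constants, and the shift to the exponent `q + 1`.
  set Θ : ℝ := (1 + σ) / 2 with hΘ
  have hΘ0 : 0 < Θ := by linarith
  have hΘ1 : Θ < 1 := by linarith
  have hσΘ : σ < Θ := by linarith
  have htail := tailConst_pos hρ
  have ev2 : ∀ᶠ q : ℕ in Filter.atTop, 2 * tailConst ρ ≤ (2 : ℝ) ^ q :=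
    (tendsto_pow_atTop_atTop_of_one_lt (by norm_num : (1 : ℝ) < 2)).eventually_ge_atTop _
  have hs2 : 1 < √(2 : ℝ) := Real.lt_sqrt_of_sq_lt (by norm_num)
  have ev3 := eventually_mul_pow_le ((1 + 3 * D) * (D * ((l + 1) * 2)) + 1) 2
    (x := (√2)⁻¹) (by positivity) (inv_lt_one_of_one_lt₀ hs2) one_pos
  have ev5 := eventually_mul_pow_le (1 + (2 + 3 * D) * C + D * tailConst ρ) 1
    (x := σ / Θ) (by positivity) ((div_lt_one hΘ0).2 hσΘ) hΘ0
  obtain ⟨q₀, hq₀⟩ := Filter.eventually_atTop.1 ((ev2.and ev3).and ev5)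
  refine ⟨l + 1, by omega, Θ, hΘ0, hΘ1, max q₀ (max i₀ 1), ?_⟩
  intro q k hq hk1 hk2 v₀ Ω _ μ _ I H
  obtain ⟨⟨h2, h3⟩, h5⟩ := hq₀ q ((le_max_left _ _).trans hq)
  have hqi : i₀ ≤ q := ((le_max_left _ _).trans (le_max_right _ _)).trans hq
  have hq1 : 1 ≤ q := ((le_max_right _ _).trans (le_max_right _ _)).trans hq
  have hq1' : (1 : ℝ) ≤ q := by exact_mod_cast hq1
  have hq0 : (0 : ℝ) < q := by linarith
  have hD0 : (0 : ℝ) ≤ D := by positivity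
  set r : ℕ := 1 + (2 * q + 1) * D with hr
  have hrq : (r : ℝ) ≤ (1 + 3 * D) * q := by
    rw [hr]; push_cast; nlinarith
  have hr0 : (0 : ℝ) ≤ r := by positivity
  have hsq : ((2 ^ q : ℕ) : ℝ) ^ (1 / 2 : ℝ) = √2 ^ q := by
    rw [← Real.sqrt_eq_rpow, Nat.cast_pow, Nat.cast_ofNat]
    exact Real.sqrt_eq_iff_mul_self_eq (by positivity) (by positivity) |>.2 (by
      rw [← mul_pow, Real.mul_self_sqrt (by norm_num)])
  have hmain : (r : ℝ) * (D * ((l + 1) * (q + 1))) + 1 ≤ √2 ^ q := by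
    have h6 : (r : ℝ) * (D * ((l + 1) * (q + 1))) + 1 ≤
        ((1 + 3 * D) * (D * ((l + 1) * 2)) + 1) * (q : ℝ) ^ 2 := by
      calc (r : ℝ) * (D * ((l + 1) * (q + 1))) + 1
          ≤ ((1 + 3 * D) * q) * (D * ((l + 1) * (q + q))) + (q : ℝ) ^ 2 := by
            have : 1 ≤ (q : ℝ) ^ 2 := one_le_pow₀ hq1'
            gcongr
        _ = _ := by ring
    refine h6.trans ?_
    have h7 : (0 : ℝ) < √2 ^ q := by positivity
    rw [inv_pow, ← mul_assoc, ← div_eq_mul_inv, div_le_one h7] at h3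
    exact h3
  have hk2' : (k : ℝ) + 1 ≤ 2 ^ ((l + 1) * (q + 1)) := by exact_mod_cast hk2
  have hlog : Real.log (k + 1) ≤ (l + 1) * (q + 1) := by
    calc Real.log (k + 1) ≤ Real.log (2 ^ ((l + 1) * (q + 1))) :=
          Real.log_le_log (by positivity) hk2'
      _ = ((l + 1) * (q + 1)) * Real.log 2 := by rw [Real.log_pow]; push_cast; ring
      _ ≤ ((l + 1) * (q + 1)) * 1 := by
          have := Real.log_two_lt_d9
          gcongr
          linarith
      _ = _ := mul_one _
  have hML : 2 ^ (a * q) ≤ 2 ^ (l * q) :=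
    Nat.pow_le_pow_right (by norm_num) (Nat.mul_le_mul_right _ hal)
  have hM2 : 2 ≤ 2 ^ (a * q) := by
    calc 2 = 2 ^ 1 := rfl
      _ ≤ 2 ^ (a * q) := Nat.pow_le_pow_right (by norm_num) (by
        have : 1 * 1 ≤ a * q := Nat.mul_le_mul (by omega) hq1
        omega)
  have hMqq : 2 ^ (q + q) ≤ 2 ^ (a * q) :=
    Nat.pow_le_pow_right (by norm_num) (by
      have : 2 * q ≤ a * q := Nat.mul_le_mul_right _ (by omega)
      omega)
  -- The extra factor `2 ^ q` in `k` compared with `L` beats `r * D`, which is only linear in `q`.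
  have hrDL : r * (D * 2 ^ (l * q)) < k := by
    have h8 : (r * D : ℝ) < 2 ^ q := by
      have h9 : (r : ℝ) * D ≤ r * (D * ((l + 1) * (q + 1))) := by
        refine mul_le_mul_of_nonneg_left (le_mul_of_one_le_right hD0 ?_) hr0
        have : (0 : ℝ) ≤ l := by positivity
        nlinarith
      have h10 : √2 ^ q ≤ (2 : ℝ) ^ q :=
        pow_le_pow_left₀ (by positivity) (Real.sqrt_le_iff.2 ⟨by norm_num, by norm_num⟩) q
      linarith
    have h8' : r * D < 2 ^ q := by exact_mod_cast h8
    calc r * (D * 2 ^ (l * q)) = (r * D) * 2 ^ (l * q) := by ring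
      _ < 2 ^ q * 2 ^ (l * q) := Nat.mul_lt_mul_of_pos_right h8' (by positivity)
      _ = 2 ^ ((l + 1) * q) := by rw [← pow_add]; congr 1; ring
      _ ≤ k := hk1
  have hgrow : 2 * tailConst ρ * ((2 ^ (q + q) : ℕ) : ℝ) ^ (ρ - 1 / 2) ≤
      ((2 ^ (a * q) : ℕ) : ℝ) ^ (ρ - 1) := by
    rw [cast_two_pow_rpow, cast_two_pow_rpow]
    calc _ ≤ (2 : ℝ) ^ (q : ℝ) * 2 ^ (((q + q : ℕ) : ℝ) * (ρ - 1 / 2)) := by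
          rw [Real.rpow_natCast]; gcongr
      _ = (2 : ℝ) ^ ((q : ℝ) + ((q + q : ℕ) : ℝ) * (ρ - 1 / 2)) := by
          rw [Real.rpow_add (by norm_num)]
      _ ≤ _ := by
          refine Real.rpow_le_rpow_of_exponent_le (by norm_num) ?_
          push_cast
          nlinarith
  have hmain2 := h q q (2 ^ (a * q)) (2 ^ (l * q)) q r k hqi hMqq hM2 hML hr hgrow
    (by
      rw [hsq]
      have : (r : ℝ) * (D * Real.log (k + 1)) ≤ r * (D * ((l + 1) * (q + 1))) := by gcongr
      linarith) hrDL v₀ Ω μ I H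
  refine hmain2.trans ?_
  have hesc : escapeProb ρ D (2 ^ (a * q)) (2 ^ (l * q)) ≤ D * tailConst ρ * σ ^ q := by
    refine (escapeProb_le _ _ _).trans (mul_le_mul_of_nonneg_left ?_ (by positivity))
    rw [cast_two_pow_rpow, cast_two_pow_rpow, ← Real.rpow_add (by norm_num)]
    calc _ ≤ (2 : ℝ) ^ (-(q : ℝ)) := by
          refine Real.rpow_le_rpow_of_exponent_le (by norm_num) ?_
          push_cast
          nlinarith
      _ = (1 / 2) ^ q := by rw [Real.rpow_neg (by norm_num), Real.rpow_natCast, one_div, inv_pow]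
      _ ≤ σ ^ q := pow_le_pow_left₀ (by norm_num) hσ2 q
  have hsum : κ ^ q + (r + 1) * (C * θ ^ q) + escapeProb ρ D (2 ^ (a * q)) (2 ^ (l * q)) ≤
      (1 + (2 + 3 * D) * C + D * tailConst ρ) * (q * σ ^ q) := by
    have h11 : κ ^ q ≤ q * σ ^ q :=
      (pow_le_pow_left₀ hκ0 hσκ q).trans (le_mul_of_one_le_left (by positivity) hq1')
    have h12 : (r + 1) * (C * θ ^ q) ≤ ((2 + 3 * D) * q) * (C * σ ^ q) := by
      have : (r : ℝ) + 1 ≤ (2 + 3 * D) * q := by linarith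
      gcongr
    have h13 : D * tailConst ρ * σ ^ q ≤ D * tailConst ρ * (q * σ ^ q) :=
      mul_le_mul_of_nonneg_left (le_mul_of_one_le_left (by positivity) hq1') (by positivity)
    linarith
  refine hsum.trans ?_
  rw [pow_one, div_pow, ← mul_div_assoc, ← mul_div_assoc, div_le_iff₀ (by positivity)] at h5
  rw [pow_succ']
  exact h5

end Exponents

end
theorem corollary26 {V : Type*} (G : SimpleGraph V) [G.LocallyFinite] (hconn : G.Connected)
    (D : ℕ) (hD : ∀ v : V, G.degree v ≤ D) (ρ : ℝ) (hρ : 1 < ρ) :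
    ∃ p : ℝ, 0 < p ∧
      ∀ (v₀ : V) (Ω : Type*) [MeasurableSpace Ω] (μ : Measure Ω) [IsProbabilityMeasure μ]
        (I : ℕ → Ω → V),
        IsERRW G (fun k : ℕ => (k : ℝ) ^ ρ) (fun _ => 1) v₀ μ I →
          ∀ k : ℕ, 1 ≤ k →
            μ.real {ω | (k : ℕ∞) < attractionTime (fun n => I n ω)} ≤ 1 / (k : ℝ) ^ p := by
  by_cases hnb : ∀ x, ∃ z, G.Adj x z
  swap
  · push Not at hnb
    obtain ⟨x, hx⟩ := hnb
    have hall : ∀ y, y = x := by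
      intro y
      obtain ⟨w⟩ := hconn.preconnected x y
      cases w with
      | nil => rfl
      | cons h _ => exact absurd h (hx _)
    refine ⟨1, one_pos, fun v₀ Ω _ μ _ I H => ?_⟩
    -- A connected graph with an isolated vertex is a single point. All step probabilities then
    -- vanish although the process has nowhere else to be, so no such process exists.
    exfalso
    have h1 := H.transition 0 (fun _ => x)
    have h2 : {ω | ∀ i ≤ 0 + 1, I i ω = x} = Set.univ :=
      Set.eq_univ_of_forall fun ω i _ => hall _
    rw [h2, stepProb, if_neg (hx x), mul_zero] at h1
    simp at h1
  obtain ⟨N, hN, Θ, hΘ0, hΘ1, q₀, h⟩ := exists_measureReal_switches_le_pow hρ hD hnb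
  -- For the finitely many `k` below the asymptotic range, a bound below one that does not depend on
  -- `v₀` suffices, as `p` may be decreased. The maximum with `1 / 2` only ensures positivity.
  set β := max (escapeProb ρ D 1 1) (1 / 2) with hβ
  have hβ1 : β < 1 := max_lt (escapeProb_lt_one ρ D 1 1) (by norm_num)
  have hβ0 : 0 < β := lt_max_of_lt_right (by norm_num)
  obtain ⟨p₁, hp₁, h₁⟩ := exists_le_inv_rpow hΘ0 hΘ1 (one_le_pow₀ (by norm_num) : (1 : ℝ) ≤ 2 ^ N)
  obtain ⟨p₂, hp₂, h₂⟩ := exists_le_inv_rpow hβ0 hβ1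
    (one_le_pow₀ (by norm_num) : (1 : ℝ) ≤ 2 ^ (N * q₀))
  set p := min p₁ p₂ with hp
  have hp0 : 0 < p := lt_min hp₁ hp₂
  refine ⟨p, hp0, fun v₀ Ω _ μ _ I H k hk => ?_⟩
  refine (measureReal_mono (setOf_lt_attractionTime_subset I k)).trans ?_
  have hk0 : (0 : ℝ) < k := by exact_mod_cast hk
  have hinv : ∀ B : ℝ, (k : ℝ) ≤ B → (B ^ p)⁻¹ ≤ 1 / (k : ℝ) ^ p := fun B hB => by
    rw [one_div]
    exact inv_anti₀ (by positivity) (Real.rpow_le_rpow hk0.le hB hp0.le)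
  -- This places `k` in the block from `2 ^ (N * q)` to `2 ^ (N * (q + 1))`. The exponent `q + 1` of
  -- `Θ` matches the upper end of the block, so no multiplicative constant is lost.
  set q := Nat.log 2 k / N with hq
  have hk1 : 2 ^ (N * q) ≤ k :=
    (Nat.pow_le_pow_right (by norm_num) (Nat.mul_div_le _ _)).trans
      (Nat.pow_log_le_self 2 (by omega))
  have hk2 : k < 2 ^ (N * (q + 1)) :=
    (Nat.lt_pow_succ_log_self (by norm_num) k).trans_le
      (Nat.pow_le_pow_right (by norm_num) (Nat.lt_mul_div_succ _ (by omega)))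
  by_cases hqq : q₀ ≤ q
  · refine (h q k hqq hk1 hk2 v₀ Ω μ I H).trans (le_trans ?_ (hinv ((2 ^ N) ^ (q + 1)) ?_))
    · calc Θ ^ (q + 1) ≤ (((2 : ℝ) ^ N) ^ p)⁻¹ ^ (q + 1) :=
            pow_le_pow_left₀ hΘ0.le (h₁ p (min_le_left _ _)) _
        _ = _ := by
            rw [inv_pow, ← Real.rpow_natCast, ← Real.rpow_mul (by positivity), mul_comm p,
              Real.rpow_mul (by positivity), Real.rpow_natCast]
    · rw [← pow_mul]; exact_mod_cast hk2.le
  · refine (measureReal_switches_le_const hρ H hnb hD k).trans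
      ((le_max_left _ _).trans ((h₂ p (min_le_right _ _)).trans (hinv _ ?_)))
    have : k ≤ 2 ^ (N * q₀) :=
      hk2.le.trans (Nat.pow_le_pow_right (by norm_num) (Nat.mul_le_mul_left _ (by omega)))
    exact_mod_cast this
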